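/- Algorithms are deterministic word-RAM algorithms with words of $O(\log n)$ bits, constant-time random access to memory and input, and unit-cost instructions. In the $k$-SUM problem one is given $k$ finite sets $S_1,\dots,S_k$ of integers in $[-M,M]$, with $n=|S_1|+\cdots+|S_k|\ge 1$, and has to decide whether there are $x_1\in S_1,\dots,x_k\in S_k$ with $x_1+\cdots+x_k=0$. The $k$-SUM Hypothesis states that for every integer $k\ge 3$ and every $\varepsilon>0$, no $O(n^{\lceil k/2\rceil-\varepsilon})$-time algorithm solves $k$-SUM, even when $M=n^{2k}$. A set $D$ of vertices of a graph $G$ is dominating if every vertex outside $D$ has a neighbour in $D$. Graphs are finite and nonempty, $n$ denotes the number of vertices, and a graph is given by its adjacency matrix. For a fixed $k$, an algorithm approximates $k$-DomSet within a factor $F(n)\ge 1$ if, on every $n$-vertex graph that has a dominating set of size at most $k$, it outputs a dominating set of size at most $F(n)\cdot k$. **Theorem.** Assume the $k$-SUM Hypothesis. Then there is a polynomial $p$ with natural-number coefficients such that for every integer $k\ge 3$ we have $p(k)>0$ and, for every $\varepsilon>0$, no $O(n^{\lceil k/2\rceil-\varepsilon})$-time algorithm approximates $k$-DomSet within the factor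 $F(n)=\max\{1,(\log n)^{1/p(k)}\}$. Moreover, no $O(n^{\lceil k/2\rceil-\varepsilon})$-time algorithm even distinguishes graphs that have a dominating set of size at most $k$ from graphs that have no dominating set of size at most $F(n)\cdot k$. -/

import Mathlib

/-! ## A word random-access machine

A deterministic word RAM, programmed with structured control flow.  It has registers, finitely many
random-access arrays (all cells initially `0`), and a read-only random-access input.  Every
elementary instruction and every test costs one unit of time.  Words are integers of absolute
value at most `W`; for inputs of size `n` the bound `W` will be polynomial in `n`, so a word has
`O(log n)` bits.  A computation that would produce a larger number has no result. -/

namespace RAM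

/-- Arithmetic instructions. -/
inductive Op where
  | add | sub | mul | div | mod | lt

/-- Value of an arithmetic instruction; `lt` returns `1` for true and `0` for false. -/
def Op.eval : Op → ℤ → ℤ → ℤ
  | .add, x, y => x + y
  | .sub, x, y => x - y
  | .mul, x, y => x * y
  | .div, x, y => x / y
  | .mod, x, y => x % y
  | .lt, x, y => if x < y then 1 else 0

/-- Programs. Registers and arrays are named by natural numbers; a program mentions only finitely
many of them. -/
inductive Prog where
  /-- do nothing -/
  | skip : Prog
  /-- `const r c` : register `r` receives the constant `c` -/
  | const (r : ℕ) (c : ℤ) : Prog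
  /-- `op o r a b` : register `r` receives the value of `o` on registers `a` and `b` -/
  | op (o : Op) (r a b : ℕ) : Prog
  /-- `load r A a` : register `r` receives the cell of array `A` whose address is in register `a` -/
  | load (r A a : ℕ) : Prog
  /-- `store A a b` : the cell of array `A` whose address is in register `a` receives the content
  of register `b` -/
  | store (A a b : ℕ) : Prog
  /-- `input r a` : register `r` receives the input cell whose address is in register `a` -/
  | input (r a : ℕ) : Prog
  /-- sequential composition -/
  | seq (P Q : Prog) : Prog
  /-- `ite r P Q` : run `P` if register `r` is nonzero, otherwise run `Q` -/
  | ite (r : ℕ) (P Q : Prog) : Prog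
  /-- `loop r P` : as long as register `r` is nonzero, run `P` -/
  | loop (r : ℕ) (P : Prog) : Prog

/-- A memory state: the contents of the registers and of the arrays. -/
structure State where
  reg : ℕ → ℤ
  arr : ℕ → ℤ → ℤ

/-- The initial state: everything is zero. -/
def State.init : State := ⟨fun _ => 0, fun _ _ => 0⟩

/-- Overwrite a register. -/
def State.setReg (s : State) (r : ℕ) (v : ℤ) : State :=
  ⟨Function.update s.reg r v, s.arr⟩

/-- Overwrite an array cell. -/
def State.setArr (s : State) (A : ℕ) (a v : ℤ) : State :=
  ⟨s.reg, Function.update s.arr A (Function.update (s.arr A) a v)⟩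

/-- The input cell with address `a`; cells outside of the input contain `0`. -/
def readInput (inp : List ℤ) (a : ℤ) : ℤ :=
  if 0 ≤ a then inp.getD a.toNat 0 else 0

/-- `Exec W inp P s t s'`: with words of absolute value at most `W` and on input `inp`, the program
`P`, started in state `s`, halts in state `s'` after exactly `t` time units. -/
inductive Exec (W : ℕ) (inp : List ℤ) : Prog → State → ℕ → State → Prop where
  | skip (s : State) : Exec W inp .skip s 1 s
  | const (s : State) (r : ℕ) (c : ℤ) (h : |c| ≤ (W : ℤ)) :
      Exec W inp (.const r c) s 1 (s.setReg r c)
  | op (s : State) (o : Op) (r a b : ℕ) (h : |o.eval (s.reg a) (s.reg b)| ≤ (W : ℤ)) :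
      Exec W inp (.op o r a b) s 1 (s.setReg r (o.eval (s.reg a) (s.reg b)))
  | load (s : State) (r A a : ℕ) :
      Exec W inp (.load r A a) s 1 (s.setReg r (s.arr A (s.reg a)))
  | store (s : State) (A a b : ℕ) :
      Exec W inp (.store A a b) s 1 (s.setArr A (s.reg a) (s.reg b))
  | input (s : State) (r a : ℕ) (h : |readInput inp (s.reg a)| ≤ (W : ℤ)) :
      Exec W inp (.input r a) s 1 (s.setReg r (readInput inp (s.reg a)))
  | seq {P Q : Prog} {s s₁ s₂ : State} {t₁ t₂ : ℕ}
      (h₁ : Exec W inp P s t₁ s₁) (h₂ : Exec W inp Q s₁ t₂ s₂) :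
      Exec W inp (.seq P Q) s (t₁ + t₂) s₂
  | iteTrue {r : ℕ} {P Q : Prog} {s s' : State} {t : ℕ} (hr : s.reg r ≠ 0)
      (h : Exec W inp P s t s') : Exec W inp (.ite r P Q) s (t + 1) s'
  | iteFalse {r : ℕ} {P Q : Prog} {s s' : State} {t : ℕ} (hr : s.reg r = 0)
      (h : Exec W inp Q s t s') : Exec W inp (.ite r P Q) s (t + 1) s'
  | loopDone {r : ℕ} {P : Prog} {s : State} (hr : s.reg r = 0) :
      Exec W inp (.loop r P) s 1 s
  | loopStep {r : ℕ} {P : Prog} {s s₁ s₂ : State} {t₁ t₂ : ℕ} (hr : s.reg r ≠ 0)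
      (h₁ : Exec W inp P s t₁ s₁) (h₂ : Exec W inp (.loop r P) s₁ t₂ s₂) :
      Exec W inp (.loop r P) s (t₁ + t₂ + 1) s₂

/-- The computational task given by a type `ι` of instances, their sizes `size x`, their
encodings `enc x`, and the relation `ok x s` ("the final state `s` holds a correct output for `x`")
can be performed by an algorithm that runs in time `O(n ^ e)` on instances of size `n`, on a word
RAM whose words have `O(log n)` bits.  (Used for instances of positive size only.) -/
def SolvableInTime {ι : Type} (size : ι → ℕ) (enc : ι → List ℤ) (ok : ι → State → Prop)
    (e : ℝ) : Prop :=
  ∃ (P : Prog) (C : ℕ), ∀ x : ι, ∃ (t : ℕ) (s : State),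
    Exec (C * size x ^ C) (enc x) P State.init t s ∧
    (t : ℝ) ≤ C * (size x : ℝ) ^ e ∧ ok x s

/-- The final state accepts if register `0` is nonzero. -/
def State.Accepts (s : State) : Prop := s.reg 0 ≠ 0

/-- The final state outputs the list `l` of natural numbers: register `0` holds its length, and
array `0` holds its entries. -/
def State.Outputs (s : State) (l : List ℕ) : Prop :=
  s.reg 0 = l.length ∧ ∀ (j : ℕ) (h : j < l.length), s.arr 0 j = (l[j] : ℤ)

end RAM

/-! ## The `k`-SUM problem and hypothesis -/

/-- An instance of `k`-SUM: `k` finite sets of integers, each listed without repetition in an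
arbitrary order, with `n ≥ 1` integers in total, all in `[-M, M]` for `M = n ^ (2 * k)`. -/
structure KSumInstance (k : ℕ) where
  S : Fin k → List ℤ
  nodup : ∀ i, (S i).Nodup
  pos : 0 < ∑ i, (S i).length
  bound : ∀ i, ∀ x ∈ S i, |x| ≤ ((∑ j, (S j).length : ℕ) : ℤ) ^ (2 * k)

namespace KSumInstance

/-- The total number `n` of input integers. -/
def size {k : ℕ} (I : KSumInstance k) : ℕ := ∑ i, (I.S i).length

/-- Encoding: the `k` cardinalities, followed by the elements of the `k` sets. -/
def encode {k : ℕ} (I : KSumInstance k) : List ℤ :=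
  List.ofFn (fun i => ((I.S i).length : ℤ)) ++ (List.ofFn I.S).flatten

/-- One integer can be picked from each set such that the sum is zero. -/
def IsYes {k : ℕ} (I : KSumInstance k) : Prop :=
  ∃ x : Fin k → ℤ, (∀ i, x i ∈ I.S i) ∧ ∑ i, x i = 0

end KSumInstance

/-- The `k`-SUM Hypothesis: for every integer `k ≥ 3` and every `ε > 0`, no `O(n ^ (⌈k/2⌉ - ε))`-time
algorithm solves `k`-SUM on `n` integers, even when `M = n ^ (2 * k)`. -/
def KSumHypothesis : Prop :=
  ∀ k : ℕ, 3 ≤ k → ∀ ε : ℝ, 0 < ε →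
    ¬ RAM.SolvableInTime (ι := KSumInstance k) KSumInstance.size KSumInstance.encode
      (fun I s => s.Accepts ↔ I.IsYes) ((⌈(k : ℝ) / 2⌉ : ℝ) - ε)

/-! ## Dominating sets and their approximation -/

/-- `D` is a dominating set of `G`: every vertex outside of `D` has a neighbour in `D`. -/
def SimpleGraph.IsDominatingSet {V : Type*} (G : SimpleGraph V) (D : Finset V) : Prop :=
  ∀ v, v ∉ D → ∃ u ∈ D, G.Adj v u

/-- A finite nonempty graph, on the vertices `0, …, n - 1`. -/
structure GraphInstance where
  n : ℕ
  pos : 0 < n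
  G : SimpleGraph (Fin n)

open Classical in
/-- Encoding: the number `n` of vertices, followed by the `n × n` adjacency matrix, row by row. -/
noncomputable def GraphInstance.encode (I : GraphInstance) : List ℤ :=
  (I.n : ℤ) :: List.ofFn (fun c : Fin (I.n * I.n) => if I.G.Adj c.divNat c.modNat then 1 else 0)

/-- The graph has a dominating set of size at most `r`. -/
def GraphInstance.HasDomSet (I : GraphInstance) (r : ℝ) : Prop :=
  ∃ D : Finset (Fin I.n), I.G.IsDominatingSet D ∧ (D.card : ℝ) ≤ r

/-- An algorithm running in time `O(n ^ e)` on `n`-vertex graphs finds, in every graph that has a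
dominating set of size at most `k`, a dominating set of size at most `F n * k`. (On the other
graphs it has to halt in time, but its output is unrestricted.) -/
def DomSetApproximable (k : ℕ) (F : ℕ → ℝ) (e : ℝ) : Prop :=
  RAM.SolvableInTime GraphInstance.n GraphInstance.encode
    (fun I s => I.HasDomSet k →
      ∃ l : List (Fin I.n), s.Outputs (l.map Fin.val) ∧
        I.G.IsDominatingSet l.toFinset ∧ (l.length : ℝ) ≤ F I.n * k) e

/-- An algorithm running in time `O(n ^ e)` on `n`-vertex graphs accepts every graph that has a
dominating set of size at most `k`, and rejects every graph that has no dominating set of size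
at most `F n * k`. -/
def DomSetGapDecidable (k : ℕ) (F : ℕ → ℝ) (e : ℝ) : Prop :=
  RAM.SolvableInTime GraphInstance.n GraphInstance.encode
    (fun I s => (I.HasDomSet k → s.Accepts) ∧ (¬ I.HasDomSet (F I.n * k) → ¬ s.Accepts)) e

/-- The approximation factor `(log n) ^ (1 / d)`, raised to `1` for the few `n` where it is
smaller than `1`. -/
noncomputable def logFactor (d : ℕ) (n : ℕ) : ℝ :=
  max 1 (Real.log n ^ (1 / (d : ℝ)))

/-! The proof reduces `k`-SUM to a gap version of dominating set, `DomSetGapSolvable`, without ever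
writing the graph down.

The graph (`KSumReduction.graph`) has one candidate for each of the `n` numbers, forming a clique,
and an independent set of `R ^ 3` tests. A test consists of a modulus `m + 1`, a multiplier `a` and
a function `F` that selects an index `i < k` for each `k`-tuple of hash values. The hash function
multiplies by `a` modulo `m + 1` and rounds to `b` values. Rounding costs less than one unit per
summand, so the hash values of a zero-sum tuple have a sum in a fixed window of `k` residues modulo
`b`; tuples with such a sum are acceptable. A candidate of the `i`-th set covers a test if its hash
value is the `i`-th entry of an acceptable tuple for which `F` selects `i`.

Completeness (`exists_dominatingSet`): the `k` numbers of a solution have an acceptable hash tuple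
in every test, and whichever index `F` selects, the corresponding number covers the test.

Soundness (`exists_sum_eq_zero`): let `D` be a dominating set of size `d` and suppose there is no
solution. The at most `d ^ k` sums of tuples from `D` are nonzero, so some prime `p` with `b < p ≤
R` divides none of them, and some multiplier `a` moves all of them far from `0` modulo `p`. By
`hash_sound` no tuple from `D` then has acceptable hash values. Hence every acceptable tuple has an
index at which `D` misses its entry; the `F` that selects these indices gives a test that `D` does
not dominate.

Parameters: with `U = (b + 1) ^ k` tuples there are `k ^ U` functions, and `R = k ^ U` also bounds
moduli and multipliers. Choosing `R ^ 3 = O(n)` makes `U` of order `log n`, hence `b` of order `(log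
n) ^ (1 / k)`. Soundness needs `4 * k * d ^ k ≤ b`, which holds for large `n` if `d` is of order
`(log n) ^ (1 / (k * (k + 1)))`; this is the polynomial of the theorem.

Time: writing an `n × n` matrix is too slow for `k = 3, 4`. Instead the given algorithm is simulated
(`Runs.simulate`), and each of its input accesses is answered by computing one matrix entry in time
`O(U) = O(log n)`. An approximation algorithm becomes a gap algorithm by verifying its output, which
takes time `O(N * log N)` and is affordable because the exponent may be assumed to be at least `3 /
2`. -/

namespace RAM

/-! ## Program logic with time bounds -/

/-- Started in `s`, the program halts within `T` steps in a state satisfying `Q`. -/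
def Runs (W : ℕ) (inp : List ℤ) (P : Prog) (s : State) (T : ℕ) (Q : State → Prop) : Prop :=
  ∃ t s', Exec W inp P s t s' ∧ t ≤ T ∧ Q s'

@[simp] theorem State.setReg_reg (s : State) (r r' : ℕ) (v : ℤ) :
    (s.setReg r v).reg r' = if r' = r then v else s.reg r' := by
  simp [State.setReg, Function.update_apply]

@[simp] theorem State.setReg_arr (s : State) (r : ℕ) (v : ℤ) :
    (s.setReg r v).arr = s.arr := rfl

theorem Runs.mono {W : ℕ} {inp : List ℤ} {P : Prog} {s : State} {T T' : ℕ}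
    {Q Q' : State → Prop} (h : Runs W inp P s T Q) (hT : T ≤ T') (hQ : ∀ s, Q s → Q' s) :
    Runs W inp P s T' Q' := by
  obtain ⟨t, s', h1, h2, h3⟩ := h
  exact ⟨t, s', h1, h2.trans hT, hQ _ h3⟩

theorem Runs.seq {W : ℕ} {inp : List ℤ} {P P' : Prog} {s : State} {T T' : ℕ}
    {Q Q' : State → Prop} (h : Runs W inp P s T Q) (h' : ∀ s, Q s → Runs W inp P' s T' Q') :
    Runs W inp (.seq P P') s (T + T') Q' := by
  obtain ⟨t, s', h1, h2, h3⟩ := h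
  obtain ⟨t', s'', h1', h2', h3'⟩ := h' _ h3
  exact ⟨t + t', s'', .seq h1 h1', by omega, h3'⟩

theorem Runs.ite {W : ℕ} {inp : List ℤ} {P P' : Prog} {s : State} {r T : ℕ}
    {Q : State → Prop} (h : s.reg r ≠ 0 → Runs W inp P s T Q)
    (h' : s.reg r = 0 → Runs W inp P' s T Q) :
    Runs W inp (.ite r P P') s (T + 1) Q := by
  by_cases hr : s.reg r = 0
  · obtain ⟨t, s', h1, h2, h3⟩ := h' hr
    exact ⟨t + 1, s', .iteFalse hr h1, by omega, h3⟩
  · obtain ⟨t, s', h1, h2, h3⟩ := h hr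
    exact ⟨t + 1, s', .iteTrue hr h1, by omega, h3⟩

/-- A loop whose invariant counts the remaining iterations. -/
theorem Runs.loop {W : ℕ} {inp : List ℤ} {P : Prog} {r T : ℕ} {Q : State → Prop}
    (Inv : ℕ → State → Prop) (h0 : ∀ s, Inv 0 s → s.reg r = 0 ∧ Q s)
    (hs : ∀ j s, Inv (j + 1) s → s.reg r ≠ 0 ∧ Runs W inp P s T (Inv j)) :
    ∀ (j : ℕ) (s : State), Inv j s → Runs W inp (.loop r P) s (j * (T + 1) + 1) Q := by
  intro j
  induction j with
  | zero => exact fun s h => ⟨1, s, .loopDone (h0 s h).1, by omega, (h0 s h).2⟩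
  | succ j ih =>
    intro s h
    obtain ⟨hr, t, s', h1, h2, h3⟩ := hs j s h
    obtain ⟨t', s'', h1', h2', h3'⟩ := ih s' h3
    refine ⟨t + t' + 1, s'', .loopStep hr h1 h1', ?_, h3'⟩
    rw [Nat.add_mul]
    omega

/-- Weakest precondition of loop-free code. -/
def Prog.wp (W : ℕ) (inp : List ℤ) : Prog → (State → Prop) → State → Prop
  | .skip, Q, s => Q s
  | .const r c, Q, s => |c| ≤ (W : ℤ) ∧ Q (s.setReg r c)
  | .op o r a b, Q, s =>
      |o.eval (s.reg a) (s.reg b)| ≤ (W : ℤ) ∧ Q (s.setReg r (o.eval (s.reg a) (s.reg b)))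
  | .load r A a, Q, s => Q (s.setReg r (s.arr A (s.reg a)))
  | .store A a b, Q, s => Q (s.setArr A (s.reg a) (s.reg b))
  | .input r a, Q, s =>
      |readInput inp (s.reg a)| ≤ (W : ℤ) ∧ Q (s.setReg r (readInput inp (s.reg a)))
  | .seq P P', Q, s => P.wp W inp (P'.wp W inp Q) s
  | .ite r P P', Q, s => (s.reg r ≠ 0 → P.wp W inp Q s) ∧ (s.reg r = 0 → P'.wp W inp Q s)
  | .loop _ _, _, _ => False

/-- Bound for the running time of loop-free code. -/
def Prog.cost : Prog → ℕ
  | .seq P P' => P.cost + P'.cost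
  | .ite _ P P' => max P.cost P'.cost + 1
  | _ => 1

/-- Loop-free code is verified by symbolic evaluation: `Prog.wp` unfolds by `simp`, and `Prog.cost`
is computed. Loops have the precondition `False` and are left to `Runs.loop`. -/
theorem Runs.of_wp {W : ℕ} {inp : List ℤ} {P : Prog} {T : ℕ} (hT : P.cost ≤ T) :
    ∀ {s : State} {Q : State → Prop}, P.wp W inp Q s → Runs W inp P s T Q := by
  induction P generalizing T with
  | skip => exact fun h => ⟨1, _, .skip _, hT, h⟩
  | const r c => exact fun h => ⟨1, _, .const _ r c h.1, hT, h.2⟩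
  | op o r a b => exact fun h => ⟨1, _, .op _ o r a b h.1, hT, h.2⟩
  | load r A a => exact fun h => ⟨1, _, .load _ r A a, hT, h⟩
  | store A a b => exact fun h => ⟨1, _, .store _ A a b, hT, h⟩
  | input r a => exact fun h => ⟨1, _, .input _ r a h.1, hT, h.2⟩
  | seq P P' ih ih' =>
    intro s Q h
    exact ((ih le_rfl h).seq fun s' hs' => ih' le_rfl hs').mono hT fun _ => id
  | ite r P P' ih ih' =>
    intro s Q h
    exact (Runs.ite (fun hr => ih (le_max_left _ _) (h.1 hr))
      fun hr => ih' (le_max_right _ _) (h.2 hr)).mono hT fun _ => id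
  | loop r P ih => exact fun h => h.elim

/-- Sequential composition of a list of programs. -/
def Prog.block : List Prog → Prog
  | [] => .skip
  | [P] => P
  | P :: P' :: l => .seq P (Prog.block (P' :: l))

/-- Replace the register `r` by `r * x ^ j`, where `x` is the content of the register `a`. -/
def Prog.mulPow (r a : ℕ) : ℕ → Prog
  | 0 => .skip
  | j + 1 => .seq (.op .mul r r a) (Prog.mulPow r a j)

theorem Prog.cost_mulPow (r a j : ℕ) : (Prog.mulPow r a j).cost = j + 1 := by
  induction j with
  | zero => rfl
  | succ j ih => simp [Prog.mulPow, Prog.cost, ih]; omega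

theorem State.setReg_setReg (s : State) (r : ℕ) (v v' : ℤ) :
    (s.setReg r v).setReg r v' = s.setReg r v' := by
  simp [State.setReg]

theorem State.setReg_self (s : State) (r : ℕ) : s.setReg r (s.reg r) = s := by
  simp [State.setReg]

theorem Prog.wp_mulPow {W : ℕ} {inp : List ℤ} {Q : State → Prop} {r a : ℕ} (hra : a ≠ r) (j : ℕ) :
    ∀ {s : State}, (∀ i ≤ j, |s.reg r * s.reg a ^ i| ≤ (W : ℤ)) →
      Q (s.setReg r (s.reg r * s.reg a ^ j)) → (Prog.mulPow r a j).wp W inp Q s := by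
  induction j with
  | zero => intro s _ h; simpa [Prog.mulPow, Prog.wp, State.setReg_self] using h
  | succ j ih =>
    intro s hW hQ
    refine ⟨by simpa [Op.eval] using hW 1 (by omega), ih ?_ ?_⟩
    · intro i hi
      have := hW (i + 1) (by omega)
      simpa [hra, Op.eval, pow_succ', mul_assoc] using this
    · simpa [hra, Op.eval, pow_succ', mul_assoc, State.setReg_setReg] using hQ

/-- The word bound is only ever an upper bound in the rules. This lets a given algorithm run inside
a larger program whose words are longer. -/
theorem Exec.mono {W W' : ℕ} (hW : W ≤ W') {inp : List ℤ} {P : Prog} {s s' : State} {t : ℕ}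
    (h : Exec W inp P s t s') : Exec W' inp P s t s' := by
  have hW' : (W : ℤ) ≤ W' := by exact_mod_cast hW
  induction h with
  | skip s => exact .skip s
  | const s r c h => exact .const s r c (h.trans hW')
  | op s o r a b h => exact .op s o r a b (h.trans hW')
  | load s r A a => exact .load s r A a
  | store s A a b => exact .store s A a b
  | input s r a h => exact .input s r a (h.trans hW')
  | seq _ _ ih ih' => exact .seq ih ih'
  | iteTrue hr _ ih => exact .iteTrue hr ih
  | iteFalse hr _ ih => exact .iteFalse hr ih
  | loopDone hr => exact .loopDone hr
  | loopStep hr _ _ ih ih' => exact .loopStep hr ih ih'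

/-! ## Simulation of a program on a virtual input -/

/-- Shift all registers by `40` and replace the input instruction by the subroutine `query`. -/
def Prog.simulate (query : ℕ → ℕ → Prog) : Prog → Prog
  | .skip => .skip
  | .const r c => .const (r + 40) c
  | .op o r a b => .op o (r + 40) (a + 40) (b + 40)
  | .load r A a => .load (r + 40) A (a + 40)
  | .store A a b => .store A (a + 40) (b + 40)
  | .input r a => query (r + 40) (a + 40)
  | .seq P P' => .seq (P.simulate query) (P'.simulate query)
  | .ite r P P' => .ite (r + 40) (P.simulate query) (P'.simulate query)
  | .loop r P => .loop (r + 40) (P.simulate query)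

/-- The state `s'` represents `s`: registers are shifted by `40`, and the invariant `I` of the
lower registers holds. -/
structure State.Represents (I : (ℕ → ℤ) → Prop) (s' s : State) : Prop where
  reg : ∀ r, s'.reg (r + 40) = s.reg r
  arr : s'.arr = s.arr
  inv : I s'.reg

/-- Induction on the execution. Only an input instruction costs more than the original, `κ` steps
instead of one, whence the factor. The arrays are shared, because the subroutine leaves them alone;
`hI` says that the invariant does not depend on the shifted registers. -/
theorem Runs.simulate {W W' : ℕ} (hW : W ≤ W') {inp inp' : List ℤ} {query : ℕ → ℕ → Prog}
    {I : (ℕ → ℤ) → Prop} {κ : ℕ} (hκ : 1 ≤ κ)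
    (hI : ∀ f r v, I f → I (Function.update f (r + 40) v))
    (hq : ∀ s r a, I s.reg → |readInput inp (s.reg (a + 40))| ≤ (W : ℤ) →
      Runs W' inp' (query (r + 40) (a + 40)) s κ fun s' => s'.arr = s.arr ∧ I s'.reg ∧
        ∀ r', s'.reg (r' + 40) =
          if r' = r then readInput inp (s.reg (a + 40)) else s.reg (r' + 40))
    {P : Prog} {s s₁ : State} {t : ℕ} (h : Exec W inp P s t s₁) :
    ∀ s', s'.Represents I s →
      Runs W' inp' (P.simulate query) s' (κ * t) fun s'' => s''.Represents I s₁ := by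
  have hW' : (W : ℤ) ≤ W' := by exact_mod_cast hW
  have set : ∀ {s' s : State} (r : ℕ) (v : ℤ), s'.Represents I s →
      (s'.setReg (r + 40) v).Represents I (s.setReg r v) := by
    intro s' s r v h
    refine ⟨fun r' => ?_, h.arr, hI _ _ _ h.inv⟩
    simp [h.reg]
  induction h with
  | skip s => exact fun s' hs => ⟨1, s', .skip s', by omega, hs⟩
  | const s r c h =>
    exact fun s' hs => ⟨1, _, .const s' _ c (h.trans hW'), by omega, set r c hs⟩
  | op s o r a b h =>
    intro s' hs
    refine ⟨1, _, .op s' o _ _ _ ?_, by omega, ?_⟩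
    · rw [hs.reg, hs.reg]; exact h.trans hW'
    · rw [hs.reg, hs.reg]; exact set _ _ hs
  | load s r A a =>
    intro s' hs
    refine ⟨1, _, .load s' _ _ _, by omega, ?_⟩
    rw [hs.reg, hs.arr]; exact set _ _ hs
  | store s A a b =>
    intro s' hs
    refine ⟨1, _, .store s' _ _ _, by omega, ?_⟩
    rw [hs.reg, hs.reg]
    exact ⟨hs.reg, by simp [State.setArr, hs.arr], hs.inv⟩
  | input s r a h =>
    intro s' hs
    refine (hq s' r a hs.inv (by rwa [hs.reg])).mono (by omega) ?_
    rintro s'' ⟨h1, h2, h3⟩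
    exact ⟨fun r' => by simp [h3, hs.reg], by simp [h1, hs.arr], h2⟩
  | seq _ _ ih ih' =>
    intro s' hs
    exact ((ih s' hs).seq ih').mono (by rw [Nat.mul_add]) fun _ => id
  | iteTrue hr _ ih =>
    intro s' hs
    exact (Runs.ite (fun _ => ih s' hs) fun h => absurd (hs.reg _ ▸ h) hr).mono
      (by rw [Nat.mul_add]; omega) fun _ => id
  | iteFalse hr _ ih =>
    intro s' hs
    exact (Runs.ite (fun h => absurd hr (hs.reg _ ▸ h)) fun _ => ih s' hs).mono
      (by rw [Nat.mul_add]; omega) fun _ => id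
  | loopDone hr =>
    intro s' hs
    exact ⟨1, s', .loopDone (by rwa [hs.reg]), by omega, hs⟩
  | loopStep hr _ _ ih ih' =>
    intro s' hs
    obtain ⟨t, s₂, h1, h2, h3⟩ := ih s' hs
    obtain ⟨t', s₃, h1', h2', h3'⟩ := ih' s₂ h3
    refine ⟨t + t' + 1, s₃, .loopStep (by rwa [hs.reg]) h1 h1', ?_, h3'⟩
    rw [Nat.mul_add, Nat.mul_add]
    omega

end RAM

namespace KSumReduction

/-! ## Rounded linear hashing modulo a prime -/

/-- The integer `x` is multiplied by `a` modulo `m + 1`, and the result is rounded down to one of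
`b` equally spaced values. -/
def hash (b m a : ℕ) (x : ℤ) : ℤ := (a * x) % ((m : ℤ) + 1) * b / ((m : ℤ) + 1)

theorem hash_nonneg (b m a : ℕ) (x : ℤ) : 0 ≤ hash b m a x := by
  have := Int.emod_nonneg (a * x) (show (m : ℤ) + 1 ≠ 0 by positivity)
  exact Int.ediv_nonneg (by positivity) (by positivity)

theorem hash_lt {b : ℕ} (hb : 0 < b) (m a : ℕ) (x : ℤ) : hash b m a x < b := by
  have := Int.emod_lt_of_pos (a * x) (show 0 < (m : ℤ) + 1 by positivity)
  refine Int.ediv_lt_of_lt_mul (by positivity) ?_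
  have hb' : (0 : ℤ) < b := by exact_mod_cast hb
  nlinarith

/-- Each hash value is a quotient by `m + 1` rounded down, and the remainder that is lost is at most
`m`. -/
theorem sum_hash_bounds {k : ℕ} (b m a : ℕ) (x : Fin k → ℤ) :
    (m + 1 : ℤ) * ∑ i, hash b m a (x i) ≤ (∑ i, (a * x i) % ((m : ℤ) + 1)) * b ∧
    (∑ i, (a * x i) % ((m : ℤ) + 1)) * b ≤ (m + 1 : ℤ) * ∑ i, hash b m a (x i) + k * m := by
  have hm : 0 < (m : ℤ) + 1 := by positivity
  have h1 : ∀ y : ℤ, (m + 1 : ℤ) * (y / (m + 1)) ≤ y := fun y => Int.mul_ediv_self_le (by omega)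
  have h2 : ∀ y : ℤ, y ≤ (m + 1 : ℤ) * (y / (m + 1)) + m := fun y => by
    have := Int.emod_add_mul_ediv y ((m : ℤ) + 1)
    have := Int.emod_lt_of_pos y hm
    omega
  constructor
  · rw [Finset.mul_sum, Finset.sum_mul]
    exact Finset.sum_le_sum fun i _ => h1 _
  · rw [Finset.mul_sum, Finset.sum_mul]
    have : (k : ℤ) * m = ∑ _i : Fin k, (m : ℤ) := by simp
    rw [this, ← Finset.sum_add_distrib]
    exact Finset.sum_le_sum fun i _ => h2 _

theorem dvd_sum_emod_sub {k : ℕ} (m a : ℕ) (x : Fin k → ℤ) :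
    (m + 1 : ℤ) ∣ a * ∑ i, x i - ∑ i, (a * x i) % ((m : ℤ) + 1) := by
  rw [Finset.mul_sum, ← Finset.sum_sub_distrib]
  exact Finset.dvd_sum fun i _ => Int.dvd_self_sub_emod

/-- If the sum is zero, then the sum of the hash values is congruent to one of `0, …, -(k - 1)`. -/
theorem hash_complete {k b : ℕ} (hk : 1 ≤ k) (hkb : k ≤ b) (m a : ℕ) (x : Fin k → ℤ)
    (hx : ∑ i, x i = 0) : (∑ i, hash b m a (x i) + k - 1) % b < k := by
  obtain ⟨h1, h2⟩ := sum_hash_bounds b m a x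
  obtain ⟨c, hc⟩ := dvd_sum_emod_sub m a x
  rw [hx, mul_zero, zero_sub] at hc
  have hS : ∑ i, (a * x i) % ((m : ℤ) + 1) = (m + 1) * -c := by linarith
  rw [hS] at h1 h2
  generalize ∑ i, hash b m a (x i) = H at *
  have hm : 0 < (m : ℤ) + 1 := by positivity
  have e1 : H ≤ -c * b := by
    refine le_of_mul_le_mul_left (a := (m + 1 : ℤ)) ?_ hm
    linarith
  -- Strict, because the total rounding error is at most `k * m < k * (m + 1)`. So the multiple `-c
  -- * b` of `b` lies between `H` and `H + k - 1`.
  have e2 : -c * b < H + k := by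
    refine lt_of_mul_lt_mul_left (a := (m + 1 : ℤ)) ?_ hm.le
    have : (1 : ℤ) ≤ k := by exact_mod_cast hk
    nlinarith
  have : H + k - 1 = (H + k - 1 + c * b) + b * (-c) := by ring
  rw [this, Int.add_mul_emod_self_left, Int.emod_eq_of_lt] <;> [skip; linarith; skip]
  · linarith
  · have : (k : ℤ) ≤ b := by exact_mod_cast hkb
    linarith

/-- If the sum of the hash values is as for a zero sum, then the sum is close to `0`. -/
theorem hash_sound {k b : ℕ} (hk : 1 ≤ k) (hkb : k ≤ b) (m a : ℕ) (x : Fin k → ℤ)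
    (h : (∑ i, hash b m a (x i) + k - 1) % b < k) :
    ∃ e ∈ Finset.Icc (-((k * (m + 1) / b : ℕ) : ℤ)) ((k * (m + 1) / b : ℕ) : ℤ),
      ((m + 1 : ℕ) : ℤ) ∣ a * ∑ i, x i - e := by
  obtain ⟨h1, h2⟩ := sum_hash_bounds b m a x
  have hd := dvd_sum_emod_sub m a x
  generalize ∑ i, hash b m a (x i) = H at *
  generalize ∑ i, (a * x i) % ((m : ℤ) + 1) = Y at *
  have hb : (0 : ℤ) < b := by exact_mod_cast (by omega : 0 < b)
  set c := (H + k - 1) / b with hc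
  have h3 := Int.emod_add_mul_ediv (H + k - 1) b
  have h4 := Int.emod_nonneg (H + k - 1) hb.ne'
  rw [← hc] at h3
  have hk' : (1 : ℤ) ≤ k := by exact_mod_cast hk
  have hm : 0 < (m : ℤ) + 1 := by positivity
  have l1 : H ≤ b * c := by linarith
  have l2 : b * c ≤ H + k - 1 := by linarith
  have m1 := mul_le_mul_of_nonneg_left l1 hm.le
  have m2 := mul_le_mul_of_nonneg_left l2 hm.le
  -- Here `b * c` is the multiple of `b` between `H` and `H + k - 1`. Scaling back, `(m + 1) * c` is
  -- a multiple of the modulus at distance at most `k * (m + 1) / b` from `Y`.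
  refine ⟨Y - (m + 1) * c, ?_, ?_⟩
  · rw [Finset.mem_Icc, Int.natCast_ediv]
    push_cast
    have e1 : (Y - (m + 1) * c) * b ≤ k * (m + 1) := by
      linarith [mul_comm (b : ℤ) c, mul_assoc (m + 1 : ℤ) c b, mul_left_comm (m + 1 : ℤ) b c]
    have e2 : -(Y - (m + 1) * c) * b ≤ k * (m + 1) := by
      linarith [mul_comm (b : ℤ) c, mul_assoc (m + 1 : ℤ) c b, mul_left_comm (m + 1 : ℤ) b c]
    have := Int.le_ediv_of_mul_le hb e1
    have := Int.le_ediv_of_mul_le hb e2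
    constructor <;> linarith
  · have : (a * ∑ i, x i - (Y - (m + 1) * c) : ℤ) = (a * ∑ i, x i - Y) + (m + 1) * c := by ring
    push_cast
    rw [this]
    exact dvd_add hd (dvd_mul_right _ _)

/-- Multiplication by `X` is injective modulo `p`, so each value `e` in the window comes from at
most one multiplier. -/
theorem card_multipliers_le {p E : ℕ} (hp : p.Prime) {X : ℤ} (hX : ¬ (p : ℤ) ∣ X) :
    ((Finset.range p).filter fun a : ℕ => ∃ e ∈ Finset.Icc (-(E : ℤ)) E,
      (p : ℤ) ∣ a * X - e).card ≤ 2 * E + 1 := by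
  classical
  have : ∀ a ∈ (Finset.range p).filter (fun a : ℕ => ∃ e ∈ Finset.Icc (-(E : ℤ)) E,
      (p : ℤ) ∣ a * X - e), ∃ e ∈ Finset.Icc (-(E : ℤ)) E, (p : ℤ) ∣ a * X - e :=
    fun a ha => (Finset.mem_filter.1 ha).2
  choose! g hg hg' using this
  refine (Finset.card_le_card_of_injOn g hg ?_).trans (by simp; omega)
  intro a ha a' ha' heq
  have h1 := hg' a ha
  have h2 := hg' a' ha'
  rw [heq] at h1
  have h3 : (p : ℤ) ∣ ((a : ℤ) - a') * X := by
    have := dvd_sub h1 h2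
    rwa [sub_sub_sub_cancel_right, ← sub_mul] at this
  have h4 := ((Nat.prime_iff_prime_int.1 hp).dvd_or_dvd h3).resolve_right hX
  have la := Finset.mem_range.1 (Finset.mem_filter.1 ha).1
  have la' := Finset.mem_range.1 (Finset.mem_filter.1 ha').1
  have h5 : ((a : ℤ) - a').natAbs = 0 := by
    refine Int.natAbs_eq_zero.2 (Int.eq_zero_of_abs_lt_dvd h4 ?_)
    rw [abs_lt]; constructor <;> omega
  omega

/-! ## A prime that divides none of several integers -/

theorem card_primeFactors_le_log {n : ℕ} (hn : n ≠ 0) : n.primeFactors.card ≤ Nat.log 2 n := by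
  refine Nat.le_log_of_pow_le (by norm_num) ?_
  calc 2 ^ n.primeFactors.card = ∏ _p ∈ n.primeFactors, 2 := by simp
    _ ≤ ∏ p ∈ n.primeFactors, p := Finset.prod_le_prod' fun p hp =>
        (Nat.prime_of_mem_primeFactors hp).two_le
    _ ≤ n := Nat.le_of_dvd (Nat.pos_of_ne_zero hn) (Nat.prod_primeFactors_dvd n)

/-- Counting: every `X` has at most `Nat.log 2 Y` prime factors, and at most `b` primes are excluded
for being too small. -/
theorem exists_prime_not_dvd (S : Finset ℤ) {Y b R : ℕ} (h0 : ∀ X ∈ S, X ≠ 0)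
    (hY : ∀ X ∈ S, |X| ≤ Y) (hR : S.card * Nat.log 2 Y + b < Nat.primeCounting R) :
    ∃ p : ℕ, p.Prime ∧ p ≤ R ∧ b < p ∧ ∀ X ∈ S, ¬ (p : ℤ) ∣ X := by
  classical
  by_contra! hcon
  have hsub : Nat.primesLE R ⊆
      S.biUnion (fun X => X.natAbs.primeFactors) ∪ Finset.Ioc 0 b := by
    intro p hp
    obtain ⟨hpR, hp⟩ := Nat.mem_primesLE.1 hp
    rw [Finset.mem_union, Finset.mem_biUnion, Finset.mem_Ioc]
    by_cases hb : p ≤ b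
    · exact .inr ⟨hp.pos, hb⟩
    · obtain ⟨X, hX, hd⟩ := hcon p hp hpR (by omega)
      exact .inl ⟨X, hX, Nat.mem_primeFactors.2 ⟨hp, Int.natCast_dvd.1 hd, by simpa using h0 X hX⟩⟩
  have h1 := Finset.card_le_card hsub
  have h2 := Finset.card_union_le (S.biUnion fun X => X.natAbs.primeFactors) (Finset.Ioc 0 b)
  have h3 : (S.biUnion fun X => X.natAbs.primeFactors).card ≤ S.card * Nat.log 2 Y := by
    refine Finset.card_biUnion_le_card_mul _ _ _ fun X hX => ?_
    refine (card_primeFactors_le_log (by simpa using h0 X hX)).trans (Nat.log_mono_right ?_)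
    have := hY X hX
    rw [Int.abs_eq_natAbs] at this
    exact_mod_cast this
  have h4 : (Nat.primesLE R).card = Nat.primeCounting R := by
    simp [Nat.primesLE_card_eq_primeCounting]
  simp only [Nat.card_Ioc] at h2
  omega

end KSumReduction

namespace KSumReduction

/-! ## The graph -/

/-- The candidate `x` from the set with index `i` passes the test with modulus `m + 1`,
multiplier `a` and selection function `F` (given by its base-`k` digits): there is an acceptable
`k`-tuple `u` of hash values (given by its base-`b + 1` digits) whose `i`-th entry is the hash value
of `x`, and for which `F` selects `i`. -/
def Covers (k b m a F i : ℕ) (x : ℤ) : Prop :=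
  ∃ u < (b + 1) ^ k, F / k ^ u % k = i ∧ ((u / (b + 1) ^ i % (b + 1) : ℕ) : ℤ) = hash b m a x ∧
    (u + k - 1) % b < k

/-- Adjacency between the candidate `w` and the test `z`. -/
def CandidateTest (k b R : ℕ) (own : ℕ → ℕ) (val : ℕ → ℤ) (w z : ℕ) : Prop :=
  Covers k b (z / R / R) (z / R % R) (z % R) (own w) (val w)

/-- Adjacency: the candidates `0, …, n - 1` form a clique, the tests `n, n + 1, …` an independent
set. -/
def Adj (k b R n : ℕ) (own : ℕ → ℕ) (val : ℕ → ℤ) (u v : ℕ) : Prop :=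
  (u < n ∧ v < n ∧ u ≠ v) ∨ (u < n ∧ n ≤ v ∧ CandidateTest k b R own val u (v - n)) ∨
    (v < n ∧ n ≤ u ∧ CandidateTest k b R own val v (u - n))

/-- The graph with `n` candidates and `R ^ 3` tests. -/
def graph (k b R n : ℕ) (own : ℕ → ℕ) (val : ℕ → ℤ) : SimpleGraph (Fin (n + R ^ 3)) where
  Adj u v := Adj k b R n own val u v
  symm := ⟨fun u v h => by
    rcases h with ⟨h1, h2, h3⟩ | h | h
    · exact .inl ⟨h2, h1, h3.symm⟩
    · exact .inr (.inr h)
    · exact .inr (.inl h)⟩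
  loopless := ⟨fun u h => by
    rcases h with ⟨h1, h2, h3⟩ | h | h
    · exact h3 rfl
    · omega
    · omega⟩

/-- Casting out: `b + 1 ≡ 1` modulo `b`, so a number is congruent to its digit sum in base `b + 1`.
This is why tuples of hash values below `b` are written in base `b + 1`: acceptability is read off
the code of the tuple without extracting digits. -/
theorem sum_digits_mod {k b : ℕ} (g : Fin k → Fin (b + 1)) :
    ((finFunctionFinEquiv g : ℕ) + k - 1) % b = (∑ i, (g i : ℕ) + k - 1) % b := by
  rcases k with - | k
  · simp
  have h : (finFunctionFinEquiv g : ℕ) ≡ ∑ i, (g i : ℕ) [MOD b] := by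
    rw [finFunctionFinEquiv_apply]
    refine Nat.ModEq.sum fun i _ => ?_
    have : (b + 1) ^ (i : ℕ) ≡ 1 [MOD b] := by
      have h1 : b + 1 ≡ 1 [MOD b] := by simp [Nat.ModEq]
      simpa using h1.pow i
    simpa using this.mul_left (g i : ℕ)
  exact h.add_right k

theorem digit_finFunctionFinEquiv {m n : ℕ} (f : Fin n → Fin m) (i : Fin n) :
    (finFunctionFinEquiv f : ℕ) / m ^ (i : ℕ) % m = f i := by
  have := congrFun (finFunctionFinEquiv.symm_apply_apply f) i
  rw [← this]; rfl

/-- The hash values of a solution form an acceptable tuple `u` for every test. Whatever index the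
test selects for `u`, the candidate with this index covers it. The remaining candidates are
dominated through the clique. -/
theorem exists_dominatingSet {k b R n : ℕ} {own : ℕ → ℕ} {val : ℕ → ℤ} (hk : 1 ≤ k) (hkb : k ≤ b)
    (w : Fin k → ℕ) (hw : ∀ i, w i < n) (hown : ∀ i, own (w i) = i) (hsum : ∑ i, val (w i) = 0) :
    ∃ D, (graph k b R n own val).IsDominatingSet D ∧ D.card ≤ k := by
  classical
  let e : Fin k → Fin (n + R ^ 3) := fun i => ⟨w i, (hw i).trans_le (Nat.le_add_right _ _)⟩
  refine ⟨Finset.univ.image e, fun v hv => ?_, Finset.card_image_le.trans (by simp)⟩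
  have hne : ∀ i, e i ≠ v := fun i h => hv (Finset.mem_image.2 ⟨i, Finset.mem_univ _, h⟩)
  by_cases hvn : (v : ℕ) < n
  · refine ⟨e ⟨0, hk⟩, Finset.mem_image_of_mem _ (Finset.mem_univ _), .inl ⟨hvn, hw _, ?_⟩⟩
    exact fun h => hne _ (Fin.ext h.symm)
  · have hb : 0 < b := by omega
    set m := ((v : ℕ) - n) / R / R
    set a := ((v : ℕ) - n) / R % R
    set F := ((v : ℕ) - n) % R
    let g : Fin k → Fin (b + 1) := fun i => ⟨(hash b m a (val (w i))).toNat, by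
      have := hash_lt hb m a (val (w i))
      omega⟩
    have hg : ∀ i, ((g i : ℕ) : ℤ) = hash b m a (val (w i)) := fun i =>
      Int.toNat_of_nonneg (hash_nonneg _ _ _ _)
    set u := finFunctionFinEquiv g
    have hsel : F / k ^ (u : ℕ) % k < k := Nat.mod_lt _ hk
    refine ⟨e ⟨_, hsel⟩, Finset.mem_image_of_mem _ (Finset.mem_univ _),
      .inr (.inr ⟨hw _, not_lt.1 hvn, u, u.isLt, (hown ⟨_, hsel⟩).symm, ?_, ?_⟩)⟩
    · change (((u : ℕ) / (b + 1) ^ own (w ⟨_, hsel⟩) % (b + 1) : ℕ) : ℤ) =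
        hash b m a (val (w ⟨_, hsel⟩))
      rw [hown, ← hg, digit_finFunctionFinEquiv]
    · rw [sum_digits_mod]
      have := hash_complete hk hkb m a (fun i => val (w i)) hsum
      simp_rw [← hg] at this
      zify
      rw [Nat.cast_sub (by omega)]
      push_cast
      exact this

/-- The sums of the `k`-tuples of candidates in `D`, one from each set. -/
noncomputable def tupleSums (k : ℕ) {N : ℕ} (n : ℕ) (own : ℕ → ℕ) (val : ℕ → ℤ)
    (D : Finset (Fin N)) : Finset ℤ :=
  ((Fintype.piFinset fun _ : Fin k => D).filter fun w => ∀ i : Fin k,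
    (w i : ℕ) < n ∧ own (w i) = i).image
    fun w => ∑ i, val (w i)

theorem card_tupleSums_le (k : ℕ) {N : ℕ} (n : ℕ) (own : ℕ → ℕ) (val : ℕ → ℤ)
    (D : Finset (Fin N)) : (tupleSums k n own val D).card ≤ D.card ^ k :=
  Finset.card_image_le.trans ((Finset.card_filter_le _ _).trans (by simp))

/-- There is a multiplier rejecting all nonzero sums of tuples and avoiding some given values. -/
theorem exists_multiplier {k b p d : ℕ} (hp : p.Prime) (S : Finset ℤ) (A : Finset ℕ)
    (hk : k ≠ 0) (hA : A.card ≤ d) (hS : S.card ≤ d ^ k) (hd : 4 * k * d ^ k ≤ b) (hbp : b < p)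
    (hSp : ∀ X ∈ S, ¬ (p : ℤ) ∣ X) :
    ∃ a < p, a ∉ A ∧ ∀ X ∈ S, ∀ e ∈ Finset.Icc (-((k * p / b : ℕ) : ℤ)) ((k * p / b : ℕ) : ℤ),
      ¬ (p : ℤ) ∣ a * X - e := by
  classical
  by_contra! hcon
  set E := k * p / b
  have hsub : Finset.range p ⊆ A ∪ S.biUnion (fun X => (Finset.range p).filter fun a : ℕ =>
      ∃ e ∈ Finset.Icc (-(E : ℤ)) E, (p : ℤ) ∣ a * X - e) := by
    intro a ha
    by_cases haA : a ∈ A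
    · exact Finset.mem_union_left _ haA
    · obtain ⟨X, hX, e, he, h⟩ := hcon a (Finset.mem_range.1 ha) haA
      exact Finset.mem_union_right _ (Finset.mem_biUnion.2
        ⟨X, hX, Finset.mem_filter.2 ⟨ha, e, he, h⟩⟩)
  have h1 := (Finset.card_le_card hsub).trans (Finset.card_union_le _ _)
  have h2 := Finset.card_biUnion_le_card_mul S _ _ fun X hX =>
    card_multipliers_le (E := E) hp (hSp X hX)
  rw [Finset.card_range] at h1
  have h3 : S.card * (2 * E + 1) ≤ d ^ k * (2 * E + 1) := Nat.mul_le_mul_right _ hS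
  have h4 : d ≤ d ^ k := Nat.le_self_pow hk d
  have h5 : E * b ≤ k * p := Nat.div_mul_le_self _ _
  generalize d ^ k = L at *
  have hk1 : 1 ≤ k := by omega
  -- The `L = d ^ k` sums exclude at most `2 * L * E + L` multipliers, and `2 * L * E ≤ p / 2`. The
  -- other excluded ones number at most `L + d ≤ 2 * L ≤ b / 2 < p / 2`, so a multiplier is left
  -- over.
  have h6 : 4 * L * E ≤ p := by
    refine le_of_mul_le_mul_left (a := k) ?_ (by omega)
    calc k * (4 * L * E) = E * (4 * k * L) := by ring
      _ ≤ E * b := Nat.mul_le_mul_left _ hd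
      _ ≤ k * p := h5
  have h7 : 4 * L ≤ b := (by nlinarith : 4 * L ≤ 4 * k * L).trans hd
  have h8 : L * (2 * E + 1) = 2 * (L * E) + L := by ring
  have h9 : 4 * L * E = 4 * (L * E) := by ring
  omega

/-- A small dominating set without a zero-sum tuple is defeated by a single test: a prime and a
multiplier for which no tuple from `D` looks like a zero sum, and the selection function that points
to an entry missed by `D` in each acceptable tuple. -/
theorem exists_sum_eq_zero {k b R n M : ℕ} {own : ℕ → ℕ} {val : ℕ → ℤ} (hk : 1 ≤ k) (hkb : k ≤ b)
    (hR : R = k ^ (b + 1) ^ k) (hval : ∀ w < n, |val w| ≤ M)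
    {D : Finset (Fin (n + R ^ 3))} (hD : (graph k b R n own val).IsDominatingSet D)
    (hd : 4 * k * D.card ^ k ≤ b)
    (hπ : D.card ^ k * Nat.log 2 (k * M) + b < Nat.primeCounting R) :
    ∃ w : Fin k → ℕ, (∀ i, w i < n) ∧ (∀ i, own (w i) = i) ∧ ∑ i, val (w i) = 0 := by
  classical
  by_contra! hcon
  have hb : 0 < b := by omega
  have hS := card_tupleSums_le k n own val D
  obtain ⟨p, hp, hpR, hbp, hdvd⟩ := exists_prime_not_dvd (tupleSums k n own val D) (b := b)
    (Y := k * M) (R := R) (by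
      intro X hX
      obtain ⟨w, hw, rfl⟩ := Finset.mem_image.1 hX
      have hw := (Finset.mem_filter.1 hw).2
      exact hcon (fun i => w i) (fun i => (hw i).1) fun i => (hw i).2) (by
      intro X hX
      obtain ⟨w, hw, rfl⟩ := Finset.mem_image.1 hX
      have hw := (Finset.mem_filter.1 hw).2
      refine (Finset.abs_sum_le_sum_abs _ _).trans
        ((Finset.sum_le_sum fun i _ => hval _ (hw i).1).trans (by simp))) (by
      have := Nat.mul_le_mul_right (Nat.log 2 (k * M)) hS
      omega)
  -- The multipliers of the tests in `D` are avoided as well, so that the test constructed below is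
  -- itself outside `D`. A candidate in `D` merely adds `0` to the avoided values, by truncated
  -- subtraction.
  obtain ⟨a, hap, haA, ha⟩ := exists_multiplier hp (tupleSums k n own val D)
    (D.image fun v : Fin _ => ((v : ℕ) - n) / R % R) (show k ≠ 0 by omega)
    Finset.card_image_le hS hd hbp hdvd
  obtain ⟨m, rfl⟩ : ∃ m, p = m + 1 := ⟨p - 1, by have := hp.pos; omega⟩
  -- If `D` hit all entries of an acceptable tuple, the candidates hitting them would have a sum in
  -- `tupleSums` that `a` sends close to `0` modulo the prime.
  have hsel : ∀ u : Fin ((b + 1) ^ k), ((u : ℕ) + k - 1) % b < k → ∃ i : Fin k,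
      ∀ w ∈ D, (w : ℕ) < n → own w = i →
        (((u : ℕ) / (b + 1) ^ (i : ℕ) % (b + 1) : ℕ) : ℤ) ≠ hash b m a (val w) := by
    intro u hu
    by_contra! h
    choose w hwD hwn hwo hwh using h
    have hmem : ∑ i, val (w i) ∈ tupleSums k n own val D :=
      Finset.mem_image.2 ⟨w, Finset.mem_filter.2 ⟨Fintype.mem_piFinset.2 hwD,
        fun i => ⟨hwn i, hwo i⟩⟩, rfl⟩
    obtain ⟨g, rfl⟩ := finFunctionFinEquiv.surjective u
    simp_rw [digit_finFunctionFinEquiv] at hwh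
    rw [sum_digits_mod] at hu
    obtain ⟨e, he, hdv⟩ := hash_sound hk hkb m a (fun i => val (w i)) (by
      simp_rw [← hwh]
      zify at hu
      rw [Nat.cast_sub (by omega)] at hu
      push_cast at hu
      exact hu)
    exact ha _ hmem e he hdv
  have : Nonempty (Fin k) := ⟨⟨0, hk⟩⟩
  choose! f hf using hsel
  set F := finFunctionFinEquiv f
  have hF : (F : ℕ) < R := hR ▸ F.isLt
  have hR0 : 0 < R := by omega
  set z := (m * R + a) * R + F with hz
  have z1 : z / R = m * R + a := by
    rw [hz, mul_comm, Nat.mul_add_div hR0, Nat.div_eq_of_lt hF, add_zero]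
  have z2 : z % R = F := by
    rw [hz, mul_comm, Nat.mul_add_mod, Nat.mod_eq_of_lt hF]
  have z3 : z / R / R = m := by
    rw [z1, mul_comm, Nat.mul_add_div hR0, Nat.div_eq_of_lt (by omega), add_zero]
  have z4 : z / R % R = a := by
    rw [z1, mul_comm, Nat.mul_add_mod, Nat.mod_eq_of_lt (by omega)]
  have z5 : z < R ^ 3 := by
    have : (m * R + a) + 1 ≤ R * R := by nlinarith
    calc z < (m * R + a + 1) * R := by rw [add_mul (m * R + a) 1, one_mul]; omega
      _ ≤ R * R * R := Nat.mul_le_mul_right _ this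
      _ = R ^ 3 := by ring
  have hv : (⟨n + z, by omega⟩ : Fin (n + R ^ 3)) ∉ D := by
    intro h
    refine haA (Finset.mem_image.2 ⟨_, h, ?_⟩)
    simpa using z4
  obtain ⟨w, hwD, hw⟩ := hD _ hv
  -- Tests are pairwise nonadjacent, so the dominating vertex is a candidate; it would have to hit
  -- an entry that `f` selected as missed.
  rcases hw with ⟨h, -⟩ | ⟨h, -⟩ | ⟨hwn, -, u, hu, h1, h2, h3⟩
  · simp at h
  · simp at h
  · simp only [Nat.add_sub_cancel_left, z2, z3, z4] at h1 h2
    have h4 := digit_finFunctionFinEquiv f ⟨u, hu⟩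
    rw [h1] at h4
    exact hf ⟨u, hu⟩ h3 w hwD hwn h4 (by rw [← h4]; exact h2)

end KSumReduction

namespace KSumReduction

/-! ## Choice of the parameters -/

/-- By Chebyshev's lower bound, the number of primes up to `2 ^ U` is of order at least `2 ^ U / U`.
Only `O(U ^ 2)` primes are needed: up to `U` sums have `O(U)` prime factors each. -/
theorem eventually_lt_primeCounting (c : ℕ) :
    ∃ U₀ : ℕ, ∀ U ≥ U₀, c * U ^ 2 < Nat.primeCounting (2 ^ U) := by
  have h := tendsto_pow_const_div_const_pow_of_one_lt 3 (show (1 : ℝ) < 2 by norm_num)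
  have h' := (h.eventually (gt_mem_nhds (show (0 : ℝ) < 1 / (c + 2) by positivity)))
  obtain ⟨U₀, hU₀⟩ := Filter.eventually_atTop.1 h'
  refine ⟨max U₀ 1, fun U hU => ?_⟩
  have h1 := hU₀ U ((le_max_left _ _).trans hU)
  have hU1 : (1 : ℝ) ≤ U := by exact_mod_cast (le_max_right _ _).trans hU
  have h2 : (c + 2) * (U : ℝ) ^ 3 < 2 ^ U := by
    rw [div_lt_div_iff₀ (by positivity) (by positivity)] at h1
    linarith
  have h3 := Chebyshev.pi_ge (2 ^ U)
  have hl : 0 < Real.log 2 := Real.log_pos (by norm_num)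
  have h4 : Real.log ((2 : ℝ) ^ U + 1) ≤ (U + 1) * Real.log 2 := by
    rw [← Nat.cast_succ, ← Real.log_pow]
    refine Real.log_le_log (by positivity) ?_
    have : (1 : ℝ) ≤ 2 ^ U := one_le_pow₀ (by norm_num)
    rw [pow_succ]; linarith
  have h5 : Real.log ((2 : ℝ) ^ U) = U * Real.log 2 := Real.log_pow _ _
  push_cast at h3
  rw [h5, div_le_iff₀ (by positivity)] at h3
  have h6 : (2 : ℝ) ^ U - (U + 1) ≤ Nat.primeCounting (2 ^ U) * U := by
    refine le_of_mul_le_mul_right ?_ hl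
    linarith
  have h7 : (c : ℝ) * U ^ 2 < Nat.primeCounting (2 ^ U) := by
    refine lt_of_mul_lt_mul_right (a := (U : ℝ)) ?_ (by positivity)
    have : (U : ℝ) + 1 ≤ 2 * U ^ 3 := by nlinarith [pow_le_pow_right₀ hU1 (show 1 ≤ 3 by norm_num)]
    nlinarith
  exact_mod_cast h7

theorem succ_pow_le {B : ℕ} (hB : 1 ≤ B) (k : ℕ) : (B + 1) ^ k ≤ 2 ^ k * B ^ k := by
  rw [← Nat.mul_pow]
  exact Nat.pow_le_pow_left (by omega) k

/-- The alphabet size `B` is admissible for instances of size `n`. -/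
structure Admissible (k B₀ n B : ℕ) : Prop where
  le : B₀ ≤ B
  upper : (k ^ B ^ k) ^ 3 ≤ (k ^ B₀ ^ k) ^ 3 * n
  lower : n < (k ^ (B + 1) ^ k) ^ 3

theorem pow_lt_two_pow {k n U c : ℕ} (h : n < (k ^ c) ^ 3) (hc : c ≤ 2 ^ k * U) :
    n < 2 ^ (3 * k * 2 ^ k * U) := by
  refine h.trans_le ?_
  calc (k ^ c) ^ 3 ≤ ((2 ^ k) ^ c) ^ 3 :=
        Nat.pow_le_pow_left (Nat.pow_le_pow_left Nat.lt_two_pow_self.le _) _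
    _ = 2 ^ (3 * k * c) := by rw [← pow_mul, ← pow_mul]; ring_nf
    _ ≤ 2 ^ (3 * k * 2 ^ k * U) := by
        refine Nat.pow_le_pow_right (by norm_num) ?_
        rw [mul_assoc (3 * k)]
        exact Nat.mul_le_mul_left _ hc

/-- This converts the approximation guarantee into the numerical hypotheses of `exists_sum_eq_zero`.
With `U = (B + 1) ^ k`, both `Nat.size` of the number of vertices and the logarithm of the relevant
sums are `O(U)`, with constants depending on `k` only. -/
theorem exists_threshold (k : ℕ) (hk : 2 ≤ k) : ∃ B₀ : ℕ, 1 ≤ B₀ ∧ ∀ B n d : ℕ,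
    Admissible k B₀ n (B + 1) →
    d ^ (k * (k + 1)) ≤ k ^ (k * (k + 1)) * Nat.size (n + (k ^ (B + 1) ^ k) ^ 3) →
    k ≤ B ∧ 4 * k * d ^ k ≤ B ∧
      d ^ k * Nat.log 2 (k * n ^ (2 * k)) + B < Nat.primeCounting (k ^ (B + 1) ^ k) := by
  set P := k * (k + 1)
  set c := 3 * k * 2 ^ k + 1
  set c₂ := k + 3 * k * 2 ^ k * (2 * k)
  obtain ⟨U₀, hU₀⟩ := eventually_lt_primeCounting (c₂ + 1)
  -- The three bounds give, in this order, enough primes, `k ≤ B`, and the contradiction in the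
  -- proof of `h2`.
  refine ⟨max U₀ (max (k + 1) ((4 * k) ^ (k + 1) * (k ^ P * c) + 1)), by simp,
    fun B n d hB hd => ?_⟩
  have hle := hB.le
  simp only [max_le_iff] at hle
  obtain ⟨l1, l2, l3⟩ := hle
  set U := (B + 1) ^ k with hU
  have hBU : B + 1 ≤ U := Nat.le_self_pow (by omega) _
  have hn : n < 2 ^ (3 * k * 2 ^ k * U) := pow_lt_two_pow hB.lower (succ_pow_le (by omega) k)
  have hsize : Nat.size (n + (k ^ U) ^ 3) ≤ c * U := by
    rw [Nat.size_le]
    have h1 : (k ^ U) ^ 3 ≤ 2 ^ (3 * k * 2 ^ k * U) := by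
      calc (k ^ U) ^ 3 ≤ ((2 ^ k) ^ U) ^ 3 :=
            Nat.pow_le_pow_left (Nat.pow_le_pow_left Nat.lt_two_pow_self.le _) _
        _ = 2 ^ (3 * k * 1 * U) := by rw [← pow_mul, ← pow_mul]; ring_nf
        _ ≤ 2 ^ (3 * k * 2 ^ k * U) := by
            refine Nat.pow_le_pow_right (by norm_num) ?_
            gcongr
            exact Nat.one_le_two_pow
    have h2 : c * U = 3 * k * 2 ^ k * U + U := by ring
    have h3 : 2 ^ 1 ≤ 2 ^ U := Nat.pow_le_pow_right (by norm_num) (by omega)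
    rw [h2, pow_add]
    nlinarith
  have h2 : 4 * k * d ^ k ≤ B := by
    by_contra! hlt
    -- This is where the exponent `k * (k + 1)` is needed: if `d ^ k` were of order `B`, then `d ^
    -- (k * (k + 1))` would be of order `B ^ (k + 1)`, while it is bounded by a multiple of `U = (B
    -- + 1) ^ k`.
    have e1 : (B + 1) ^ (k + 1) ≤ (4 * k) ^ (k + 1) * (k ^ P * c) * (B + 1) ^ k := by
      calc (B + 1) ^ (k + 1) ≤ (4 * k * d ^ k) ^ (k + 1) := Nat.pow_le_pow_left hlt _
        _ = (4 * k) ^ (k + 1) * d ^ P := by rw [mul_pow (4 * k), ← pow_mul]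
        _ ≤ (4 * k) ^ (k + 1) * (k ^ P * (c * U)) :=
            Nat.mul_le_mul_left _ (hd.trans (Nat.mul_le_mul_left _ hsize))
        _ = _ := by rw [hU]; ring
    rw [pow_succ, mul_comm] at e1
    have := le_of_mul_le_mul_right e1 (by positivity)
    omega
  refine ⟨by omega, h2, ?_⟩
  have h3 : d ^ k ≤ B := (Nat.le_mul_of_pos_left _ (by omega)).trans h2
  have h4 : Nat.log 2 (k * n ^ (2 * k)) ≤ c₂ * U := by
    have : k * n ^ (2 * k) ≤ 2 ^ (c₂ * U) := by
      calc k * n ^ (2 * k) ≤ 2 ^ (k * U) * (2 ^ (3 * k * 2 ^ k * U)) ^ (2 * k) := by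
            refine Nat.mul_le_mul (Nat.lt_two_pow_self.le.trans ?_) (Nat.pow_le_pow_left hn.le _)
            exact Nat.pow_le_pow_right (by norm_num) (Nat.le_mul_of_pos_right _ (by omega))
        _ = 2 ^ (c₂ * U) := by
            rw [← pow_mul, ← pow_add]
            congr 1
            simp only [c₂]; ring
    calc Nat.log 2 (k * n ^ (2 * k)) ≤ Nat.log 2 (2 ^ (c₂ * U)) := Nat.log_mono_right this
      _ = c₂ * U := Nat.log_pow (by norm_num) _
  refine lt_of_le_of_lt ?_ ((hU₀ U (by omega)).trans_le (Nat.monotone_primeCounting ?_))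
  · calc d ^ k * Nat.log 2 (k * n ^ (2 * k)) + B ≤ U * (c₂ * U) + U * U := by
          refine Nat.add_le_add (Nat.mul_le_mul (by omega) h4) ?_
          nlinarith
      _ = (c₂ + 1) * U ^ 2 := by ring
  · exact Nat.pow_le_pow_left hk _

/-- The search for the alphabet size also evaluates the next larger candidate. The resulting number
is far above `n`, but still polynomial in `n`, so it fits into a word. -/
theorem Admissible.pow_le {k B₀ n B : ℕ} (h : Admissible k B₀ n B) (hB : 1 ≤ B) (hk : 1 ≤ k) :
    (k ^ (B + 1) ^ k) ^ 3 ≤ ((k ^ B₀ ^ k) ^ 3 * n) ^ 2 ^ k := by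
  calc (k ^ (B + 1) ^ k) ^ 3 ≤ (k ^ (2 ^ k * B ^ k)) ^ 3 :=
        Nat.pow_le_pow_left (Nat.pow_le_pow_right hk (succ_pow_le hB k)) _
    _ = ((k ^ B ^ k) ^ 3) ^ 2 ^ k := by
        rw [← pow_mul, ← pow_mul, ← pow_mul]; ring_nf
    _ ≤ _ := Nat.pow_le_pow_left h.upper _

end KSumReduction

namespace KSumReduction
open RAM

/-! ## The reduction on the word RAM -/

/-- Number of elements of the first `i` sets. -/
def pre (len : ℕ → ℕ) (i : ℕ) : ℕ := ∑ i' ∈ Finset.range i, len i'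

/-- Index of the set that contains the element number `w`. -/
noncomputable def owner (len : ℕ → ℕ) (w : ℕ) : ℕ := sInf {i | w < pre len (i + 1)}

theorem pre_mono (len : ℕ → ℕ) : Monotone (pre len) := fun _ _ h =>
  Finset.sum_le_sum_of_subset (Finset.range_mono h)

theorem pre_succ (len : ℕ → ℕ) (i : ℕ) : pre len (i + 1) = pre len i + len i :=
  Finset.sum_range_succ _ _

theorem owner_eq {len : ℕ → ℕ} {w i : ℕ} (h1 : pre len i ≤ w) (h2 : w < pre len (i + 1)) :
    owner len w = i := by
  refine le_antisymm (Nat.sInf_le h2) (not_lt.1 fun h => ?_)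
  have h3 : w < pre len (owner len w + 1) :=
    Nat.sInf_mem (s := {i | w < pre len (i + 1)}) ⟨i, h2⟩
  have := pre_mono len (show owner len w + 1 ≤ i from h)
  omega

/-- The input `inp` encodes `k` sets with `len i` elements in the `i`-th set, `n` elements in
total; the elements are `val 0, …, val (n - 1)`. -/
structure Reads (k n : ℕ) (len : ℕ → ℕ) (val : ℕ → ℤ) (inp : List ℤ) : Prop where
  total : pre len k = n
  len_eq : ∀ i < k, readInput inp i = len i
  val_eq : ∀ w < n, readInput inp ((k : ℤ) + w) = val w
  bound : ∀ w < n, |val w| ≤ (n : ℤ) ^ (2 * k)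

section
variable {k n : ℕ} {len : ℕ → ℕ} {val : ℕ → ℤ} {inp : List ℤ}

theorem Reads.owner_lt (h : Reads k n len val inp) {w : ℕ} (hw : w < n) : owner len w < k := by
  have h1 : 0 < k := by
    rcases Nat.eq_zero_or_pos k with rfl | h0
    · have := h.total
      simp [pre] at this
      omega
    · exact h0
  have : owner len w ≤ k - 1 := Nat.sInf_le (by
    rw [Set.mem_ofPred_eq, Nat.sub_add_cancel h1, h.total]; exact hw)
  omega

theorem Reads.lt_pre_owner (h : Reads k n len val inp) {w i : ℕ} (hw : w < n) :
    w < pre len (i + 1) ↔ owner len w ≤ i := by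
  refine ⟨fun h => Nat.sInf_le h, fun hi => ?_⟩
  have h1 : w < pre len (owner len w + 1) := by
    refine Nat.sInf_mem (s := {i | w < pre len (i + 1)}) ⟨k - 1, ?_⟩
    have := h.owner_lt hw
    rw [Set.mem_ofPred_eq, Nat.sub_add_cancel (by omega), h.total]; exact hw
  exact h1.trans_le (pre_mono len (by omega))

theorem Reads.len_le (h : Reads k n len val inp) {i : ℕ} (hi : i < k) :
    pre len i + len i ≤ n := by
  rw [← pre_succ, ← h.total]
  exact pre_mono len hi

end

/-- `s'` arises from `s` by changing only registers between `a` and `b`. -/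
def Frame (a b : ℕ) (s s' : State) : Prop :=
  s'.arr = s.arr ∧ ∀ r, r < a ∨ b ≤ r → s'.reg r = s.reg r

theorem Frame.refl (a b : ℕ) (s : State) : Frame a b s s := ⟨rfl, fun _ _ => rfl⟩

theorem Frame.trans {a b : ℕ} {s s' s'' : State} (h : Frame a b s s') (h' : Frame a b s' s'') :
    Frame a b s s'' :=
  ⟨h'.1.trans h.1, fun r hr => (h'.2 r hr).trans (h.2 r hr)⟩

theorem Frame.mono {a b a' b' : ℕ} {s s' : State} (h : Frame a b s s') (ha : a' ≤ a)
    (hb : b ≤ b') : Frame a' b' s s' :=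
  ⟨h.1, fun r hr => h.2 r (by omega)⟩

theorem Frame.setReg {a b r : ℕ} {s s' : State} {v : ℤ} (h : Frame a b s s') (ha : a ≤ r)
    (hb : r < b) : Frame a b s (s'.setReg r v) :=
  ⟨h.1, fun r' hr' => by
    rw [State.setReg_reg, if_neg (by omega)]; exact h.2 r' hr'⟩

theorem abs_natCast_le {a W : ℕ} (h : a ≤ W) : |(a : ℤ)| ≤ W := by
  rw [Nat.abs_cast]; exact_mod_cast h

theorem abs_ite_le {W : ℤ} (hW : 1 ≤ W) (p : Prop) [Decidable p] :
    |if p then (1 : ℤ) else 0| ≤ W := by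
  split_ifs <;> simp <;> omega

theorem abs_one_sub_ite_le {W : ℤ} (hW : 1 ≤ W) (p : Prop) [Decidable p] :
    |1 - if p then (1 : ℤ) else 0| ≤ W := by
  split_ifs <;> simp <;> omega

/-- Determines the index of the set to which the element number `reg 17` belongs (register 21),
and the corresponding power of the alphabet size (register 22). -/
def locateInit : Prog := .block [
  .op .add 20 17 7, .const 21 0, .const 22 1, .input 23 21, .op .lt 24 20 23, .op .sub 24 8 24]

/-- The loop body belonging to `locateInit`. -/
def locateBody : Prog := .block [
  .op .sub 20 20 23, .op .add 21 21 8, .op .mul 22 22 5, .input 23 21, .op .lt 24 20 23,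
  .op .sub 24 8 24]

/-- Cardinalities are subtracted until the remainder is smaller than the next one. The power of `B`
is accumulated on the way, so that a digit of a tuple is later obtained with one division. -/
theorem runs_locate {W k n B : ℕ} {len : ℕ → ℕ} {val : ℕ → ℤ} {inp : List ℤ}
    (hr : Reads k n len val inp) (hnW : n ≤ W) (hkW : k ≤ W) (hBW : B ^ k ≤ W) (hB : 1 ≤ B)
    {s : State} {w : ℕ} (hw : w < n) (h17 : s.reg 17 = w) (h5 : s.reg 5 = B) (h7 : s.reg 7 = 0)
    (h8 : s.reg 8 = 1) :
    Runs W inp (.seq locateInit (.loop 24 locateBody)) s (7 * k + 7) fun s' =>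
      s'.reg 21 = owner len w ∧ s'.reg 22 = (B : ℤ) ^ owner len w ∧ Frame 20 25 s s' := by
  have hWn : (n : ℤ) ≤ W := by exact_mod_cast hnW
  have hW1 : (1 : ℤ) ≤ W := by omega
  have hok := hr.owner_lt hw
  have hpow : ∀ i ≤ k, (B : ℤ) ^ i ≤ W := fun i hi => by
    exact_mod_cast (Nat.pow_le_pow_right hB hi).trans hBW
  let Inv : ℕ → State → Prop := fun j s' => ∃ i, i + j = owner len w ∧
    s'.reg 20 = (w : ℤ) - pre len i ∧ s'.reg 21 = i ∧ s'.reg 22 = (B : ℤ) ^ i ∧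
    s'.reg 23 = len i ∧ s'.reg 24 = (if j = 0 then 0 else 1) ∧ pre len i ≤ w ∧ Frame 20 25 s s'
  have hloop := Runs.loop (W := W) (inp := inp) (P := locateBody) (r := 24) (T := 6) (Q := fun s' =>
      s'.reg 21 = owner len w ∧ s'.reg 22 = (B : ℤ) ^ owner len w ∧ Frame 20 25 s s') Inv
    (by
      rintro s' ⟨i, hi, h20, h21, h22, h23, h24, -, hf⟩
      obtain rfl : i = owner len w := by omega
      exact ⟨by simpa using h24, h21, h22, hf⟩)
    (by
      rintro j s' ⟨i, hi, h20, h21, h22, h23, h24, hle, hf⟩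
      refine ⟨by simp [h24], Runs.of_wp (by decide) ?_⟩
      have hge : pre len (i + 1) ≤ w := not_lt.1 fun h => by
        have := (hr.lt_pre_owner hw).1 h
        omega
      have hlt := hr.lt_pre_owner (i := i + 1) hw
      have hlen := hr.len_le (i := i) (by omega)
      have hlen' := hr.len_le (i := i + 1) (by omega)
      have hread := hr.len_eq (i + 1) (by omega)
      push_cast at hread
      have hge' := hge
      rw [pre_succ] at hge' hlen'
      rw [pre_succ, pre_succ] at hlt
      have h5' : s'.reg 5 = B := (hf.2 5 (by simp)).trans h5
      have h8' : s'.reg 8 = 1 := (hf.2 8 (by simp)).trans h8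
      have hp := hpow (i + 1) (by omega)
      have hp' : (0 : ℤ) ≤ (B : ℤ) ^ (i + 1) := by positivity
      rw [pow_succ] at hp hp'
      simp only [locateBody, Prog.block, Prog.wp, Op.eval, State.setReg_reg, h20, h21, h22, h23, h5',
        h8', reduceIte, Nat.reduceEqDiff, hread]
      refine ⟨abs_le.2 ⟨by omega, by omega⟩, abs_le.2 ⟨by omega, by omega⟩,
        abs_le.2 ⟨by omega, by omega⟩, abs_le.2 ⟨by omega, by omega⟩, abs_ite_le hW1 _,
        abs_one_sub_ite_le hW1 _, i + 1, by omega, ?_⟩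
      simp only [State.setReg_reg, reduceIte, Nat.reduceEqDiff, Nat.cast_add, Nat.cast_one, pow_succ,
        true_and, pre_succ]
      refine ⟨by ring, ?_, by omega, ?_⟩
      · by_cases hj : j = 0
        · rw [if_pos hj, if_pos (by omega)]; rfl
        · rw [if_neg hj, if_neg (by omega)]; rfl
      · repeat refine Frame.setReg ?_ (by norm_num) (by norm_num)
        exact hf)
  refine (Runs.seq (Runs.of_wp (T := 6) (Q := Inv (owner len w)) (by decide) ?_)
    (hloop _)).mono ?_ fun _ => id
  · have hlt := hr.lt_pre_owner (i := 0) hw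
    have hlen := hr.len_le (i := 0) (by omega)
    have hread := hr.len_eq 0 (by omega)
    push_cast at hread
    simp only [locateInit, Prog.block, Prog.wp, Op.eval, State.setReg_reg, h17, h7,
        h8, reduceIte, Nat.reduceEqDiff, hread]
    simp only [pre, Finset.range_zero, Finset.sum_empty, zero_add, Finset.range_one,
      Finset.sum_singleton] at hlt hlen
    refine ⟨abs_le.2 ⟨by omega, by omega⟩, abs_le.2 ⟨by omega, by omega⟩,
        abs_le.2 ⟨by omega, by omega⟩, abs_le.2 ⟨by omega, by omega⟩, abs_ite_le hW1 _,
        abs_one_sub_ite_le hW1 _, 0, by omega, ?_⟩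
    simp only [State.setReg_reg, reduceIte, Nat.reduceEqDiff, Nat.cast_zero, pow_zero,
        true_and, pre, Finset.range_zero, Finset.sum_empty, Nat.zero_le]
    refine ⟨by ring, ?_, ?_⟩
    · by_cases hj : owner len w = 0
      · rw [if_pos hj, if_pos (by omega)]; rfl
      · rw [if_neg hj, if_neg (by omega)]; rfl
    · repeat refine Frame.setReg ?_ (by norm_num) (by norm_num)
      exact Frame.refl _ _ _
  · have : owner len w * (6 + 1) ≤ k * 7 := Nat.mul_le_mul_right _ hok.le
    omega

/-- Computes the hash value of register 25 for the test in register 18. -/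
def hashCode : Prog := .block [
  .op .mod 26 18 4, .op .div 28 18 4, .op .mod 27 28 4, .op .div 28 28 4, .op .add 28 28 8,
  .op .mul 29 27 25, .op .mod 29 29 28, .op .mul 29 29 10, .op .div 29 29 28]

theorem runs_hash {W b R M : ℕ} {inp : List ℤ} (hRW : R ^ 3 ≤ W) (hMW : R * M ≤ W)
    (hbW : R * b ≤ W) (hb : 0 < b) {s : State} {z : ℕ} {x : ℤ} (hz : z < R ^ 3) (hx : |x| ≤ M)
    (h18 : s.reg 18 = z) (h25 : s.reg 25 = x) (h4 : s.reg 4 = R) (h8 : s.reg 8 = 1)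
    (h10 : s.reg 10 = b) :
    Runs W inp hashCode s 9 fun s' => s'.reg 26 = ((z % R : ℕ) : ℤ) ∧
      s'.reg 29 = hash b (z / R / R) (z / R % R) x ∧ Frame 26 30 s s' := by
  refine Runs.of_wp (by decide) ?_
  have hR0 : 0 < R := Nat.pos_of_ne_zero (by rintro rfl; simp at hz)
  have hRW' : R ≤ W := (Nat.le_self_pow (by norm_num) R).trans hRW
  have hF : z % R < R := Nat.mod_lt _ hR0
  have ha : z / R % R < R := Nat.mod_lt _ hR0
  have hm : z / R / R < R := by
    rw [Nat.div_div_eq_div_mul]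
    exact Nat.div_lt_of_lt_mul (by rwa [mul_assoc, ← pow_three])
  have hzR : z / R ≤ z := Nat.div_le_self _ _
  have hh0 := hash_nonneg b (z / R / R) (z / R % R) x
  have hh1 := hash_lt hb (z / R / R) (z / R % R) x
  have hbW' : b ≤ W := (Nat.le_mul_of_pos_left _ hR0).trans hbW
  have hax : |((z / R % R : ℕ) : ℤ) * x| ≤ W := by
    rw [abs_mul, Nat.abs_cast]
    calc ((z / R % R : ℕ) : ℤ) * |x| ≤ R * M := by
          refine mul_le_mul ?_ hx (abs_nonneg _) (by positivity)
          exact_mod_cast ha.le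
      _ ≤ W := by exact_mod_cast hMW
  simp only [hash] at hh0 hh1 ⊢
  have e1 : (z : ℤ) % R = (z % R : ℕ) := by simp
  have e2 : (z : ℤ) / R = (z / R : ℕ) := by simp
  have e3 : ((z / R : ℕ) : ℤ) % R = (z / R % R : ℕ) := by simp
  have e4 : ((z / R : ℕ) : ℤ) / R = (z / R / R : ℕ) := by simp
  simp only [hashCode, Prog.block, Prog.wp, Op.eval, State.setReg_reg, h18, h25, h4, h8, h10,
    reduceIte, Nat.reduceEqDiff, e1, e2, e3, e4]
  generalize z % R = F at *
  generalize z / R % R = a at *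
  generalize z / R / R = m at *
  have hy0 := Int.emod_nonneg (a * x) (show (m : ℤ) + 1 ≠ 0 by positivity)
  have hy1 := Int.emod_lt_of_pos (a * x) (show 0 < (m : ℤ) + 1 by positivity)
  have hyb : |(a * x) % ((m : ℤ) + 1) * b| ≤ W := by
    rw [abs_mul, Nat.abs_cast, abs_of_nonneg hy0]
    calc (a * x) % ((m : ℤ) + 1) * b ≤ R * b := by
          refine mul_le_mul_of_nonneg_right ?_ (by positivity)
          omega
      _ ≤ W := by exact_mod_cast hbW
  refine ⟨abs_natCast_le (by omega), abs_natCast_le (by omega),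
    abs_le.2 ⟨by omega, by omega⟩, abs_le.2 ⟨by omega, by omega⟩, abs_le.2 ⟨by omega, by omega⟩,
    hax, abs_le.2 ⟨by omega, by omega⟩, hyb, abs_le.2 ⟨by omega, by omega⟩, trivial, trivial, ?_⟩
  repeat refine Frame.setReg ?_ (by norm_num) (by norm_num)
  exact Frame.refl _ _ _

/-- Initialization of the search for an acceptable tuple. -/
def scanInit : Prog := .block [.const 30 0, .op .add 31 26 7, .const 32 0, .op .add 33 6 7]

/-- Tests for the tuple in register 32. -/
def scanTest : Prog := .block [
  .op .mod 34 31 9, .op .sub 34 34 21, .op .div 35 32 22, .op .mod 35 35 5, .op .sub 35 35 29,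
  .op .add 36 32 9, .op .sub 36 36 8, .op .mod 36 36 10, .op .lt 36 36 9,
  .op .div 31 31 9, .op .add 32 32 8, .op .sub 33 33 8]

/-- Evaluation of the tests for one tuple. -/
def scanUpdate : Prog := .ite 36 (.ite 34 .skip (.ite 35 .skip (.const 30 1))) .skip

-- The tuples are visited in increasing order, and `F` is divided by `k` once per tuple, so that its
-- next base-`k` digit is always the selection for the current tuple. Hence the scan takes constant
-- time per tuple.
open Classical in
theorem runs_scan {W k b F i : ℕ} {h : ℤ} {inp : List ℤ} (hk : 1 ≤ k) (hb : 1 ≤ b) (hi : i < k)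
    (hFW : F ≤ W) (hUW : (b + 1) ^ k + k ≤ W) (hbW : b < W) (hh0 : 0 ≤ h) (hhb : h < b)
    {s : State} (h26 : s.reg 26 = F)
    (h21 : s.reg 21 = i) (h22 : s.reg 22 = ((b + 1 : ℕ) : ℤ) ^ i) (h29 : s.reg 29 = h)
    (h5 : s.reg 5 = (b + 1 : ℕ)) (h6 : s.reg 6 = ((b + 1) ^ k : ℕ)) (h7 : s.reg 7 = 0)
    (h8 : s.reg 8 = 1) (h9 : s.reg 9 = k) (h10 : s.reg 10 = b) :
    Runs W inp (.seq scanInit (.loop 33 (.seq scanTest scanUpdate))) s (17 * (b + 1) ^ k + 5)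
      fun s' => (s'.reg 30 = if ∃ u < (b + 1) ^ k, F / k ^ u % k = i ∧
        ((u / (b + 1) ^ i % (b + 1) : ℕ) : ℤ) = h ∧ (u + k - 1) % b < k then 1 else 0) ∧
        Frame 30 37 s s' := by
  set U := (b + 1) ^ k
  let C : ℕ → Prop := fun u => F / k ^ u % k = i ∧
        ((u / (b + 1) ^ i % (b + 1) : ℕ) : ℤ) = h ∧ (u + k - 1) % b < k
  let Inv : ℕ → State → Prop := fun j s' => ∃ u, u + j = U ∧ s'.reg 31 = (F / k ^ u : ℕ) ∧
    s'.reg 32 = u ∧ s'.reg 33 = j ∧ (s'.reg 30 = if ∃ u' < u, C u' then 1 else 0) ∧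
    Frame 30 37 s s'
  -- Between the two halves of the loop body the counters already belong to `u + 1`, while the flag
  -- in register 30 still ignores the tuple `u`.
  let Mid : ℕ → State → Prop := fun j s' => ∃ u, u + (j + 1) = U ∧ s'.reg 31 = (F / k ^ (u + 1) : ℕ) ∧
    s'.reg 32 = (u + 1 : ℕ) ∧ s'.reg 33 = j ∧ (s'.reg 30 = if ∃ u' < u, C u' then 1 else 0) ∧
    Frame 30 37 s s' ∧ (C u ↔ s'.reg 36 ≠ 0 ∧ s'.reg 34 = 0 ∧ s'.reg 35 = 0)
  have hUpdate : ∀ j s', Mid j s' → scanUpdate.wp W inp (Inv j) s' := by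
    rintro j s' ⟨u, hu, h31, h32, h33, h30, hf, hC⟩
    have key : (∃ u' < u + 1, C u') ↔ (∃ u' < u, C u') ∨ C u := by
      simp only [Nat.lt_succ_iff_lt_or_eq, or_and_right, exists_or, exists_eq_left]
    have hno : ¬ C u → Inv j s' := fun hn =>
      ⟨u + 1, by omega, h31, h32, h33, by simp only [key, hn, or_false, h30], hf⟩
    refine ⟨fun h36 => ⟨fun h34 => hno fun h => h34 (hC.1 h).2.1, fun h34 =>
      ⟨fun h35 => hno fun h => h35 (hC.1 h).2.2, fun h35 => ⟨by simp; omega, ?_⟩⟩⟩,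
      fun h36 => hno fun h => (hC.1 h).1 h36⟩
    have hCu := hC.2 ⟨h36, h34, h35⟩
    refine ⟨u + 1, by omega, by simpa using h31, by simpa using h32, by simpa using h33, ?_,
      hf.setReg (by norm_num) (by norm_num)⟩
    simp only [State.setReg_reg, reduceIte, key, hCu, or_true]
  have hTest : ∀ j s', Inv (j + 1) s' → scanTest.wp W inp (Mid j) s' := by
    rintro j s' ⟨u, hu, h31, h32, h33, h30, hf⟩
    have h21' : s'.reg 21 = i := (hf.2 _ (by norm_num)).trans h21
    have h22' : s'.reg 22 = ((b + 1 : ℕ) : ℤ) ^ i := (hf.2 _ (by norm_num)).trans h22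
    have h29' : s'.reg 29 = h := (hf.2 _ (by norm_num)).trans h29
    have h5' : s'.reg 5 = (b + 1 : ℕ) := (hf.2 _ (by norm_num)).trans h5
    have h8' : s'.reg 8 = 1 := (hf.2 _ (by norm_num)).trans h8
    have h9' : s'.reg 9 = k := (hf.2 _ (by norm_num)).trans h9
    have h10' : s'.reg 10 = b := (hf.2 _ (by norm_num)).trans h10
    have e1 : ((F / k ^ u : ℕ) : ℤ) % k = (F / k ^ u % k : ℕ) := by simp
    have e2 : (u : ℤ) / ((b + 1 : ℕ) : ℤ) ^ i = (u / (b + 1) ^ i : ℕ) := by simp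
    have e3 : ((u / (b + 1) ^ i : ℕ) : ℤ) % ((b + 1 : ℕ) : ℤ) =
      (u / (b + 1) ^ i % (b + 1) : ℕ) := by simp
    have e4 : (u : ℤ) + k - 1 = (u + k - 1 : ℕ) := by omega
    have e5 : ((u + k - 1 : ℕ) : ℤ) % b = ((u + k - 1) % b : ℕ) := by simp
    have e6 : ((F / k ^ u : ℕ) : ℤ) / k = (F / k ^ (u + 1) : ℕ) := by
      rw [pow_succ, ← Nat.div_div_eq_div_mul]; simp
    have b1 : F / k ^ u % k < k := Nat.mod_lt _ hk
    have b2 : u / (b + 1) ^ i ≤ u := Nat.div_le_self _ _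
    have b3 : u / (b + 1) ^ i % (b + 1) < b + 1 := Nat.mod_lt _ (by omega)
    have b4 : (u + k - 1) % b < b := Nat.mod_lt _ hb
    have b5 : F / k ^ (u + 1) ≤ F := Nat.div_le_self _ _
    simp only [scanTest, Prog.block, Prog.wp, Op.eval, State.setReg_reg, h31, h32, h33, h21', h22',
      h29', h5', h8', h9', h10', reduceIte, Nat.reduceEqDiff, e1, e2, e3, e4, e5, e6]
    refine ⟨abs_natCast_le (by omega), abs_le.2 ⟨by omega, by omega⟩,
      abs_natCast_le (by omega), abs_natCast_le (by omega),
      abs_le.2 ⟨by omega, by omega⟩, abs_le.2 ⟨by omega, by omega⟩,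
      abs_natCast_le (by omega), abs_natCast_le (by omega), abs_ite_le (by omega) _,
      abs_natCast_le (by omega), abs_le.2 ⟨by omega, by omega⟩,
      abs_le.2 ⟨by omega, by omega⟩, u, by omega, ?_⟩
    simp only [State.setReg_reg, reduceIte, Nat.reduceEqDiff, h30, true_and]
    refine ⟨by push_cast; rfl, by push_cast; ring, ?_, ?_⟩
    · repeat refine Frame.setReg ?_ (by norm_num) (by norm_num)
      exact hf
    · simp only [C, Nat.cast_lt, sub_eq_zero, Nat.cast_inj, ne_eq, ite_eq_right_iff, one_ne_zero,
        imp_false, not_not]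
      tauto
  have hloop := Runs.loop (W := W) (inp := inp) (P := .seq scanTest scanUpdate) (r := 33)
    (T := 12 + 4)
    (Q := fun s' => (s'.reg 30 = if ∃ u < U, C u then 1 else 0) ∧ Frame 30 37 s s') Inv
    (by
      rintro s' ⟨u, hu, -, -, h33, h30, hf⟩
      obtain rfl : u = U := by omega
      exact ⟨by simpa using h33, h30, hf⟩)
    (by
      intro j s' hs
      have h33 : s'.reg 33 = (j + 1 : ℕ) := by
        obtain ⟨u, -, -, -, h33, -⟩ := hs
        exact h33
      exact ⟨by rw [h33]; positivity, (Runs.of_wp (by decide) (hTest j s' hs)).seq fun s'' hs'' =>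
        Runs.of_wp (by decide) (hUpdate j s'' hs'')⟩)
  refine (Runs.seq (Runs.of_wp (T := 4) (Q := Inv U) (by decide) ?_) (hloop _)).mono
    (by omega) fun _ => id
  simp only [scanInit, Prog.block, Prog.wp, Op.eval, State.setReg_reg, h26, h6, h7,
    reduceIte, Nat.reduceEqDiff]
  refine ⟨abs_le.2 ⟨by omega, by omega⟩, abs_le.2 ⟨by omega, by omega⟩,
    abs_le.2 ⟨by omega, by omega⟩, abs_le.2 ⟨by omega, by omega⟩, 0, by omega, ?_⟩
  simp only [State.setReg_reg, reduceIte, Nat.reduceEqDiff, pow_zero, Nat.div_one, add_zero,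
    Nat.cast_zero, true_and, not_lt_zero, false_and, exists_false]
  repeat refine Frame.setReg ?_ (by norm_num) (by norm_num)
  exact Frame.refl _ _ _

end KSumReduction

/-! ### Computing single entries of the adjacency matrix -/

namespace KSumReduction
open RAM

/-- The registers that hold the parameters of the reduction. -/
structure Layout (k b n R : ℕ) (f : ℕ → ℤ) : Prop where
  r1 : f 1 = n
  r2 : f 2 = (n + R ^ 3 : ℕ)
  r3 : f 3 = ((n + R ^ 3) * (n + R ^ 3) + 1 : ℕ)
  r4 : f 4 = R
  r5 : f 5 = (b + 1 : ℕ)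
  r6 : f 6 = ((b + 1) ^ k : ℕ)
  r7 : f 7 = 0
  r8 : f 8 = 1
  r9 : f 9 = k
  r10 : f 10 = b

theorem Layout.of_frame {k b n R a c : ℕ} {s s' : State} (h : Layout k b n R s.reg)
    (hf : Frame a c s s') (ha : 11 ≤ a) : Layout k b n R s'.reg := by
  have h' : ∀ r ≤ 10, s'.reg r = s.reg r := fun r hr => hf.2 r (by omega)
  constructor
  all_goals rw [h' _ (by norm_num)]
  exacts [h.r1, h.r2, h.r3, h.r4, h.r5, h.r6, h.r7, h.r8, h.r9, h.r10]

theorem Layout.update {k b n R : ℕ} {f : ℕ → ℤ} (h : Layout k b n R f) (r : ℕ) (v : ℤ) :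
    Layout k b n R (Function.update f (r + 40) v) := by
  constructor
  all_goals rw [Function.update_of_ne (by omega)]
  exacts [h.r1, h.r2, h.r3, h.r4, h.r5, h.r6, h.r7, h.r8, h.r9, h.r10]

/-- The words are large enough for the reduction. -/
structure WordSize (k b n R W : ℕ) : Prop where
  matrix : (n + R ^ 3) * (n + R ^ 3) + 1 ≤ W
  product : R * n ^ (2 * k) ≤ W
  scaled : R * b ≤ W
  tuples : (b + 1) ^ k + k ≤ W
  alphabet : b < W
  address : n + k ≤ W

/-- Reads the element with number `reg 17`. -/
def loadElement : Prog := .block [.op .add 19 17 9, .input 25 19]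

/-- Decides adjacency of the candidate in register 17 and the test in register 18. -/
def candidateTest : Prog :=
  .seq loadElement (.seq (.seq locateInit (.loop 24 locateBody))
    (.seq hashCode (.seq scanInit (.loop 33 (.seq scanTest scanUpdate)))))

section
variable {W k b n R : ℕ} {len : ℕ → ℕ} {val : ℕ → ℤ} {inp : List ℤ}

open Classical in
theorem runs_candidateTest (hr : Reads k n len val inp) (hW : WordSize k b n R W) (hb : 1 ≤ b)
    {s : State} (hs : Layout k b n R s.reg) {w z : ℕ} (hw : w < n) (hz : z < R ^ 3)
    (h17 : s.reg 17 = w) (h18 : s.reg 18 = z) :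
    Runs W inp candidateTest s (17 * (b + 1) ^ k + 7 * k + 23) fun s' =>
      (s'.reg 30 = if CandidateTest k b R (owner len) val w z then 1 else 0) ∧
        Frame 11 40 s s' := by
  have hok := hr.owner_lt hw
  have hR0 : 0 < R := Nat.pos_of_ne_zero (by rintro rfl; simp at hz)
  have hRW : n + R ^ 3 ≤ W := by nlinarith [hW.matrix]
  have hRR : R ≤ R ^ 3 := Nat.le_self_pow (by norm_num) R
  have hval := hr.bound w hw
  have hvW : n ^ (2 * k) ≤ W := (Nat.le_mul_of_pos_left _ hR0).trans hW.product
  have hread := hr.val_eq w hw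
  have h1 : Runs W inp loadElement s 2 fun s' => s'.reg 25 = val w ∧ Frame 19 26 s s' := by
    refine Runs.of_wp (by decide) ?_
    have e1 : ((w : ℤ) + k) = k + w := add_comm _ _
    have := hW.address
    simp only [loadElement, Prog.block, Prog.wp, Op.eval, State.setReg_reg, h17, hs.r9, reduceIte,
      Nat.reduceEqDiff, e1, hread]
    refine ⟨abs_le.2 ⟨by omega, by omega⟩, hval.trans (by exact_mod_cast hvW), trivial, ?_⟩
    repeat refine Frame.setReg ?_ (by norm_num) (by norm_num)
    exact Frame.refl _ _ _
  refine (h1.seq (T' := (7 * k + 7) + (9 + (17 * (b + 1) ^ k + 5))) ?_).mono (by omega)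
    fun _ => id
  rintro s₁ ⟨h25, hf₁⟩
  have hs₁ := hs.of_frame hf₁ (by norm_num)
  refine Runs.seq (runs_locate hr (by have := hW.address; omega) (by have := hW.address; omega)
    (by have := hW.tuples; omega) (by omega) hw ((hf₁.2 _ (by norm_num)).trans h17) hs₁.r5 hs₁.r7
    hs₁.r8) ?_
  rintro s₂ ⟨h21, h22, hf₂⟩
  have hs₂ := hs₁.of_frame hf₂ (by norm_num)
  refine Runs.seq (runs_hash (M := n ^ (2 * k)) (by omega) hW.product hW.scaled hb hz
    (by exact_mod_cast hval)
    ((hf₂.2 _ (by norm_num)).trans ((hf₁.2 _ (by norm_num)).trans h18))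
    ((hf₂.2 _ (by norm_num)).trans h25) hs₂.r4 hs₂.r8 hs₂.r10) ?_
  rintro s₃ ⟨h26, h29, hf₃⟩
  have hs₃ := hs₂.of_frame hf₃ (by norm_num)
  have hF : z % R < R := Nat.mod_lt _ hR0
  refine (runs_scan (by omega) hb hok (by omega) hW.tuples hW.alphabet (hash_nonneg _ _ _ _)
    (hash_lt hb _ _ _) h26 ((hf₃.2 _ (by norm_num)).trans h21)
    ((hf₃.2 _ (by norm_num)).trans h22) h29 hs₃.r5 hs₃.r6 hs₃.r7 hs₃.r8 hs₃.r9 hs₃.r10).mono le_rfl ?_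
  rintro s₄ ⟨h30, hf₄⟩
  refine ⟨h30.trans (if_congr Iff.rfl rfl rfl), ?_⟩
  exact (((hf₁.mono (by norm_num) (by norm_num)).trans (hf₂.mono (by norm_num) (by norm_num))).trans
    (hf₃.mono (by norm_num) (by norm_num))).trans (hf₄.mono (by norm_num) (by norm_num))

open Classical in
/-- The encoding of a graph with `N` vertices and adjacency relation `A`, as a function of the
address. -/
noncomputable def virtualInput (N : ℕ) (A : ℕ → ℕ → Prop) (y : ℤ) : ℤ :=
  if y = 0 then N else if 0 < y ∧ y ≤ (N * N : ℕ) then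
    if A ((y - 1).toNat / N) ((y - 1).toNat % N) then 1 else 0 else 0

/-- Row and column of the requested entry of the adjacency matrix. -/
def splitAddress (src : ℕ) : Prog := .block [
  .op .sub 11 src 8, .op .div 12 11 2, .op .mod 13 11 2, .op .lt 14 12 1, .op .lt 15 13 1]

/-- Computes an entry of the adjacency matrix. -/
def matrixEntry : Prog :=
  .ite 14
    (.ite 15 (.seq (.op .sub 16 12 13) (.ite 16 (.const 30 1) (.const 30 0)))
      (.seq (.block [.op .add 17 12 7, .op .sub 18 13 1]) candidateTest))
    (.ite 15 (.seq (.block [.op .add 17 13 7, .op .sub 18 12 1]) candidateTest) (.const 30 0))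

/-- Tests whether the address belongs to the adjacency matrix. -/
def rangeTest (src : ℕ) : Prog := .block [.op .lt 11 7 src, .op .lt 12 src 3, .op .mul 11 11 12]

/-- Replaces the instruction `input dst src` on the virtual input. -/
def query (dst src : ℕ) : Prog :=
  .seq (rangeTest src) (.seq
    (.ite 11 (.seq (splitAddress src) matrixEntry) (.ite src (.const 30 0) (.op .add 30 2 7)))
    (.op .add dst 30 7))

open Classical in
theorem runs_matrixEntry (hr : Reads k n len val inp) (hW : WordSize k b n R W) (hb : 1 ≤ b)
    {s : State} (hs : Layout k b n R s.reg) {u v : ℕ} (hu : u < n + R ^ 3) (hv : v < n + R ^ 3)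
    (h12 : s.reg 12 = u) (h13 : s.reg 13 = v) (h14 : s.reg 14 = if (u : ℤ) < n then 1 else 0)
    (h15 : s.reg 15 = if (v : ℤ) < n then 1 else 0) :
    Runs W inp matrixEntry s (17 * (b + 1) ^ k + 7 * k + 27) fun s' =>
      (s'.reg 30 = if Adj k b R n (owner len) val u v then 1 else 0) ∧ Frame 11 40 s s' := by
  have hRW : n + R ^ 3 ≤ W := by nlinarith [hW.matrix]
  have hW1 : (1 : ℤ) ≤ W := by have := hW.alphabet; omega
  have hleaf : ∀ w z : ℕ, w < n → z < R ^ 3 → ∀ s' : State, s'.reg 17 = w → s'.reg 18 = z →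
      Frame 11 40 s s' → Runs W inp candidateTest s' (17 * (b + 1) ^ k + 7 * k + 23) fun s' =>
      (s'.reg 30 = if CandidateTest k b R (owner len) val w z then 1 else 0) ∧
        Frame 11 40 s s' := fun w z hw hz s' h17 h18 hf =>
    (runs_candidateTest hr hW hb (hs.of_frame hf le_rfl) hw hz h17 h18).mono le_rfl
      fun _ h => ⟨h.1, hf.trans h.2⟩
  refine (Runs.ite (T := 17 * (b + 1) ^ k + 7 * k + 26) (fun h => ?_) fun h => ?_)
  all_goals
    refine (Runs.ite (T := 17 * (b + 1) ^ k + 7 * k + 25) (fun h' => ?_) fun h' => ?_)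
    all_goals
      rw [h14] at h; rw [h15] at h'
      simp only [ne_eq, ite_eq_right_iff, one_ne_zero, imp_false, not_not, Nat.cast_lt] at h h'
  · refine Runs.of_wp (by simp [Prog.cost]) ?_
    simp only [Prog.wp, Op.eval, State.setReg_reg, h12, h13, reduceIte, Nat.reduceEqDiff]
    refine ⟨abs_le.2 ⟨by omega, by omega⟩, fun hne => ⟨by simpa using hW1, ?_, ?_⟩,
      fun hne => ⟨by simp, ?_, ?_⟩⟩
    · rw [if_pos (.inl ⟨h, h', by omega⟩)]
    · exact ((Frame.refl _ _ _).setReg (by norm_num) (by norm_num)).setReg (by norm_num)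
        (by norm_num)
    · rw [if_neg]
      rintro (h | h | h) <;> omega
    · exact ((Frame.refl _ _ _).setReg (by norm_num) (by norm_num)).setReg (by norm_num)
        (by norm_num)
  · refine (Runs.seq (T := 2) (Q := fun s' => s'.reg 17 = u ∧ s'.reg 18 = (v - n : ℕ) ∧
      Frame 11 40 s s') (Runs.of_wp (by decide) ?_) fun s' hs' => (hleaf u (v - n) h (by omega) s'
        hs'.1 hs'.2.1 hs'.2.2).mono le_rfl fun s' h'' => ⟨?_, h''.2⟩).mono (by omega) fun _ => id
    · simp only [Prog.block, Prog.wp, Op.eval, State.setReg_reg, h12, h13, reduceIte,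
        Nat.reduceEqDiff, hs.r1, hs.r7]
      refine ⟨abs_le.2 ⟨by omega, by omega⟩, abs_le.2 ⟨by omega, by omega⟩, by simp, by omega, ?_⟩
      exact ((Frame.refl _ _ _).setReg (by norm_num) (by norm_num)).setReg (by norm_num)
        (by norm_num)
    · rw [h''.1]
      refine if_congr ⟨fun hc => .inr (.inl ⟨h, by omega, hc⟩), ?_⟩ rfl rfl
      rintro (hc | hc | hc)
      · omega
      · exact hc.2.2
      · omega
  · refine (Runs.seq (T := 2) (Q := fun s' => s'.reg 17 = v ∧ s'.reg 18 = (u - n : ℕ) ∧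
      Frame 11 40 s s') (Runs.of_wp (by decide) ?_) fun s' hs' => (hleaf v (u - n) h' (by omega) s'
        hs'.1 hs'.2.1 hs'.2.2).mono le_rfl fun s' h'' => ⟨?_, h''.2⟩).mono (by omega) fun _ => id
    · simp only [Prog.block, Prog.wp, Op.eval, State.setReg_reg, h12, h13, reduceIte,
        Nat.reduceEqDiff, hs.r1, hs.r7]
      refine ⟨abs_le.2 ⟨by omega, by omega⟩, abs_le.2 ⟨by omega, by omega⟩, by simp, by omega, ?_⟩
      exact ((Frame.refl _ _ _).setReg (by norm_num) (by norm_num)).setReg (by norm_num)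
        (by norm_num)
    · rw [h''.1]
      refine if_congr ⟨fun hc => .inr (.inr ⟨h', by omega, hc⟩), ?_⟩ rfl rfl
      rintro (hc | hc | hc)
      · omega
      · omega
      · exact hc.2.2
  · refine Runs.of_wp (by simp [Prog.cost]) ?_
    simp only [Prog.wp, State.setReg_reg, reduceIte]
    refine ⟨by simp, ?_, (Frame.refl _ _ _).setReg (by norm_num) (by norm_num)⟩
    rw [if_neg]
    rintro (hc | hc | hc) <;> omega

/-- The value is assembled in register 30 by code confined to registers 11 to 39, and copied only at
the end. So the parameters survive, and of the simulated registers only the destination changes. -/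
theorem runs_query (hr : Reads k n len val inp) (hW : WordSize k b n R W) (hb : 1 ≤ b)
    (s : State) (r a : ℕ) (hs : Layout k b n R s.reg) :
    Runs W inp (query (r + 40) (a + 40)) s (17 * (b + 1) ^ k + 7 * k + 37) fun s' =>
      s'.arr = s.arr ∧ Layout k b n R s'.reg ∧ ∀ r', s'.reg (r' + 40) = if r' = r then
        virtualInput (n + R ^ 3) (Adj k b R n (owner len) val) (s.reg (a + 40))
        else s.reg (r' + 40) := by
  classical
  set N := n + R ^ 3 with hN
  set v := virtualInput N (Adj k b R n (owner len) val) (s.reg (a + 40)) with hv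
  have hNW : N * N + 1 ≤ W := hW.matrix
  have hNN : N ≤ N * N := Nat.le_mul_self N
  have hW1 : (1 : ℤ) ≤ W := by omega
  have h1 : Runs W inp (rangeTest (a + 40)) s 3 fun s' => (s'.reg 11 ≠ 0 ↔
      0 < s.reg (a + 40) ∧ s.reg (a + 40) ≤ (N * N : ℕ)) ∧ Frame 11 40 s s' := by
    refine Runs.of_wp (by simp [rangeTest, Prog.block, Prog.cost]) ?_
    simp only [rangeTest, Prog.block, Prog.wp, Op.eval, State.setReg_reg, hs.r7, hs.r3, reduceIte,
      Nat.reduceEqDiff, ← hN]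
    refine ⟨abs_ite_le hW1 _, abs_ite_le hW1 _, ?_, ?_, ?_⟩
    · split_ifs <;> simp <;> omega
    · push_cast
      split_ifs <;> simp <;> omega
    · repeat refine Frame.setReg ?_ (by norm_num) (by norm_num)
      exact Frame.refl _ _ _
  have h2 : ∀ s', (0 < s.reg (a + 40) ∧ s.reg (a + 40) ≤ (N * N : ℕ)) → Frame 11 40 s s' →
      Runs W inp (.seq (splitAddress (a + 40)) matrixEntry) s' (17 * (b + 1) ^ k + 7 * k + 32)
        fun s' => s'.reg 30 = v ∧ Frame 11 40 s s' := by
    intro s' hy hf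
    have hs' := hs.of_frame hf le_rfl
    have hya : s'.reg (a + 40) = s.reg (a + 40) := hf.2 _ (by omega)
    obtain ⟨c, hc⟩ : ∃ c : ℕ, s.reg (a + 40) = c + 1 := ⟨(s.reg (a + 40) - 1).toNat, by omega⟩
    have hcN : c < N * N := by omega
    have hN0 : 0 < N := Nat.pos_of_ne_zero (by rintro h; simp [h] at hcN)
    have hu : c / N < N := Nat.div_lt_of_lt_mul hcN
    have hw : c % N < N := Nat.mod_lt _ hN0
    refine (Runs.seq (T := 5) (Q := fun s'' => s''.reg 12 = (c / N : ℕ) ∧ s''.reg 13 = (c % N : ℕ) ∧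
      (s''.reg 14 = if ((c / N : ℕ) : ℤ) < n then 1 else 0) ∧
      (s''.reg 15 = if ((c % N : ℕ) : ℤ) < n then 1 else 0) ∧ Frame 11 40 s s'')
      (Runs.of_wp (by simp [splitAddress, Prog.block, Prog.cost]) ?_) fun s'' h'' => (runs_matrixEntry hr hW hb
        (hs.of_frame h''.2.2.2.2 le_rfl) hu hw h''.1 h''.2.1 h''.2.2.1 h''.2.2.2.1).mono le_rfl
        fun s₃ h₃ => ⟨?_, h''.2.2.2.2.trans h₃.2⟩).mono (by omega) fun _ => id
    · have e1 : (c : ℤ) / ((n + R ^ 3 : ℕ) : ℤ) = (c / N : ℕ) := by rw [← hN]; simp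
      have e2 : (c : ℤ) % ((n + R ^ 3 : ℕ) : ℤ) = (c % N : ℕ) := by rw [← hN]; simp
      have n1 : ¬ a + 40 = 11 := by omega
      simp only [splitAddress, Prog.block, Prog.wp, Op.eval, State.setReg_reg, hs'.r1, hs'.r2,
        hs'.r8, hya, hc, reduceIte, Nat.reduceEqDiff, add_sub_cancel_right, e1, e2]
      refine ⟨abs_natCast_le (by omega), abs_natCast_le (by omega), abs_natCast_le (by omega),
        abs_ite_le hW1 _, abs_ite_le hW1 _, trivial, trivial, trivial, trivial, ?_⟩
      repeat refine Frame.setReg ?_ (by norm_num) (by norm_num)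
      exact hf
    · rw [h₃.1]
      symm
      rw [hv, virtualInput, if_neg (by omega), if_pos hy, hc]
      simp
  have h3 : ∀ s', ¬ (0 < s.reg (a + 40) ∧ s.reg (a + 40) ≤ (N * N : ℕ)) → Frame 11 40 s s' →
      Runs W inp (.ite (a + 40) (.const 30 0) (.op .add 30 2 7)) s'
        (17 * (b + 1) ^ k + 7 * k + 32) fun s' => s'.reg 30 = v ∧ Frame 11 40 s s' := by
    intro s' hy hf
    have hs' := hs.of_frame hf le_rfl
    have hya : s'.reg (a + 40) = s.reg (a + 40) := hf.2 _ (by omega)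
    refine Runs.of_wp (by simp [Prog.cost]) ?_
    simp only [Prog.wp, Op.eval, hya, hs'.r2, hs'.r7, State.setReg_reg, reduceIte, ← hN]
    refine ⟨fun h => ⟨by simp, ?_, hf.setReg (by norm_num) (by norm_num)⟩, fun h =>
      ⟨abs_le.2 ⟨by omega, by omega⟩, ?_, hf.setReg (by norm_num) (by norm_num)⟩⟩
    · rw [hv, virtualInput, if_neg h, if_neg hy]
    · rw [hv, virtualInput, if_pos h, add_zero]
  have hvW : |v| ≤ W := by
    rw [hv, virtualInput]
    split_ifs
    · exact abs_natCast_le (by omega)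
    · simpa using hW1
    · simp
    · simp
  refine (h1.seq (T' := 17 * (b + 1) ^ k + 7 * k + 34) fun s₁ ⟨h11, hf₁⟩ => ?_).mono (by omega)
    fun _ => id
  refine (Runs.seq (T' := 1) (Runs.ite (fun h => h2 s₁ (h11.1 h) hf₁)
    fun h => h3 s₁ (fun h' => h11.2 h' h) hf₁) fun s₂ ⟨h30, hf₂⟩ => Runs.of_wp (by rfl) ?_).mono
    (by omega) fun _ => id
  have hs₂ := hs.of_frame hf₂ le_rfl
  simp only [Prog.wp, Op.eval, h30, hs₂.r7, add_zero]
  refine ⟨hvW, hf₂.1, hs₂.update _ _, fun r' => ?_⟩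
  rw [State.setReg_reg]
  by_cases h : r' = r
  · simp [h]
  · rw [if_neg (by omega), if_neg h]
    exact hf₂.2 _ (by omega)

end

end KSumReduction

/-! ### Computing the parameters from the input -/

namespace KSumReduction
open RAM

/-- Take the least `B ≥ B₀` with `n < (k ^ (B + 1) ^ k) ^ 3`. Minimality bounds the number of tests
by `n`, except when `B = B₀`; the constant factor in `Admissible.upper` takes care of that case. The
second conclusion is what keeps the search loop going. -/
theorem exists_admissible {k B₀ n : ℕ} (hk : 2 ≤ k) (hB₀ : 1 ≤ B₀) (hn : 1 ≤ n) :
    ∃ b, Admissible k B₀ n (b + 1) ∧ ∀ B, B₀ ≤ B → B < b + 1 → (k ^ (B + 1) ^ k) ^ 3 ≤ n := by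
  have hex : ∃ B, B₀ ≤ B ∧ n < (k ^ (B + 1) ^ k) ^ 3 := by
    refine ⟨max B₀ n, le_max_left _ _, ?_⟩
    set B := max B₀ n
    have h1 : n ≤ B := le_max_right _ _
    have h2 : B + 1 ≤ (B + 1) ^ k := Nat.le_self_pow (by omega) _
    have h3 : (B + 1) ^ k < k ^ (B + 1) ^ k := Nat.lt_pow_self hk
    have h4 : k ^ (B + 1) ^ k ≤ (k ^ (B + 1) ^ k) ^ 3 := Nat.le_self_pow (by norm_num) _
    omega
  classical
  have hspec := Nat.find_spec hex
  have hmin : ∀ B, B₀ ≤ B → B < Nat.find hex → (k ^ (B + 1) ^ k) ^ 3 ≤ n := fun B h1 h2 =>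
    not_lt.1 fun h => Nat.find_min hex h2 ⟨h1, h⟩
  obtain ⟨b, hb⟩ : ∃ b, Nat.find hex = b + 1 := ⟨Nat.find hex - 1, by omega⟩
  rw [hb] at hspec hmin
  refine ⟨b, ⟨hspec.1, ?_, hspec.2⟩, hmin⟩
  rcases hspec.1.eq_or_lt with h | h
  · rw [h]
    exact Nat.le_mul_of_pos_right _ hn
  · refine (hmin b (by omega) (by omega)).trans (Nat.le_mul_of_pos_left _ ?_)
    positivity

/-- Reads the cardinalities of the `k` sets and adds them. -/
def sizeInit (k : ℕ) : Prog := .block [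
  .const 7 0, .const 8 1, .const 9 k, .const 11 0, .const 12 k, .const 1 0]

/-- The loop body belonging to `sizeInit`. -/
def sizeBody : Prog := .block [.input 13 11, .op .add 1 1 13, .op .add 11 11 8, .op .sub 12 12 8]

section
variable {W k n : ℕ} {len : ℕ → ℕ} {val : ℕ → ℤ} {inp : List ℤ}

theorem runs_size (hr : Reads k n len val inp) (hW : n + k ≤ W) (hn : 1 ≤ n) (s : State) :
    Runs W inp (.seq (sizeInit k) (.loop 12 sizeBody)) s (5 * k + 7) fun s' =>
      s'.reg 1 = n ∧ s'.reg 7 = 0 ∧ s'.reg 8 = 1 ∧ s'.reg 9 = k ∧ Frame 0 40 s s' := by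
  let Inv : ℕ → State → Prop := fun j s' => ∃ i, i + j = k ∧ s'.reg 1 = pre len i ∧
    s'.reg 11 = i ∧ s'.reg 12 = j ∧ s'.reg 7 = 0 ∧ s'.reg 8 = 1 ∧ s'.reg 9 = k ∧ Frame 0 40 s s'
  have hloop := Runs.loop (W := W) (inp := inp) (P := sizeBody) (r := 12) (T := 4) (Q := fun s' =>
      s'.reg 1 = n ∧ s'.reg 7 = 0 ∧ s'.reg 8 = 1 ∧ s'.reg 9 = k ∧ Frame 0 40 s s') Inv
    (by
      rintro s' ⟨i, hi, h1, -, h12, h⟩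
      obtain rfl : i = k := by omega
      exact ⟨by simpa using h12, by rw [h1, hr.total], h⟩)
    (by
      rintro j s' ⟨i, hi, h1, h11, h12, h7, h8, h9, hf⟩
      refine ⟨by rw [h12]; positivity, Runs.of_wp (by decide) ?_⟩
      have hlen := hr.len_le (i := i) (by omega)
      have hread := hr.len_eq i (by omega)
      simp only [sizeBody, Prog.block, Prog.wp, Op.eval, State.setReg_reg, h1, h11, h12, h8,
        reduceIte, Nat.reduceEqDiff, hread]
      refine ⟨abs_le.2 ⟨by omega, by omega⟩, abs_le.2 ⟨by omega, by omega⟩,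
        abs_le.2 ⟨by omega, by omega⟩, abs_le.2 ⟨by omega, by omega⟩, i + 1, by omega, ?_⟩
      simp only [State.setReg_reg, reduceIte, Nat.reduceEqDiff, h7, h8, h9, pre_succ, true_and]
      refine ⟨by push_cast; rfl, by push_cast; rfl, by push_cast; ring, ?_⟩
      repeat refine Frame.setReg ?_ (by norm_num) (by norm_num)
      exact hf)
  refine (Runs.seq (Runs.of_wp (T := 6) (Q := Inv k) (by simp [sizeInit, Prog.block, Prog.cost]) ?_)
    (hloop _)).mono (by omega) fun _ => id
  simp only [sizeInit, Prog.block, Prog.wp]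
  refine ⟨by simp, by simp; omega, abs_natCast_le (by omega), by simp, abs_natCast_le (by omega),
    by simp, 0, by omega, ?_⟩
  simp only [State.setReg_reg, reduceIte, Nat.reduceEqDiff, true_and, pre, Finset.range_zero,
    Finset.sum_empty, Nat.cast_zero]
  repeat refine Frame.setReg ?_ (by norm_num) (by norm_num)
  exact Frame.refl _ _ _

/-- Computes `k ^ (B + 1) ^ k`, where `B` is the content of register 5. -/
def powerCode (k : ℕ) : Prog :=
  .seq (.block [.op .add 13 5 8, .const 14 1]) (.seq (.mulPow 14 13 k)
    (.seq (.block [.const 15 1, .op .add 16 14 7])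
      (.loop 16 (.block [.op .mul 15 15 9, .op .sub 16 16 8]))))

/-- One step of the search for the alphabet size. -/
def searchBody (k : ℕ) : Prog :=
  .seq (powerCode k) (.seq
    (.block [.op .mul 17 15 15, .op .mul 17 17 15, .op .lt 12 1 17, .op .sub 12 8 12])
    (.ite 12 (.block [.op .add 5 13 7, .op .add 6 14 7, .op .add 4 15 7]) .skip))

theorem runs_power {B : ℕ} (hk : 2 ≤ k) (hW : k ^ (B + 1) ^ k ≤ W) {s : State}
    (h5 : s.reg 5 = B) (h7 : s.reg 7 = 0) (h8 : s.reg 8 = 1) (h9 : s.reg 9 = k) :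
    Runs W inp (powerCode k) s (3 * (B + 1) ^ k + k + 6) fun s' => s'.reg 13 = (B + 1 : ℕ) ∧
      s'.reg 14 = ((B + 1) ^ k : ℕ) ∧ s'.reg 15 = (k ^ (B + 1) ^ k : ℕ) ∧ Frame 13 17 s s' := by
  have hUW : (B + 1) ^ k ≤ W := (Nat.lt_pow_self hk).le.trans hW
  have hBW : B + 1 ≤ W := (Nat.le_self_pow (by omega) _).trans hUW
  have h1 : Runs W inp (.block [.op .add 13 5 8, .const 14 1]) s 2 fun s' =>
      s'.reg 13 = (B + 1 : ℕ) ∧ s'.reg 14 = 1 ∧ Frame 13 17 s s' := by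
    refine Runs.of_wp (by decide) ?_
    simp only [Prog.block, Prog.wp, Op.eval, State.setReg_reg, h5, h8, reduceIte, Nat.reduceEqDiff]
    refine ⟨abs_le.2 ⟨by omega, by omega⟩, by simp; omega, by push_cast; rfl, trivial, ?_⟩
    repeat refine Frame.setReg ?_ (by norm_num) (by norm_num)
    exact Frame.refl _ _ _
  have h2 : ∀ s' : State, (s'.reg 13 = (B + 1 : ℕ) ∧ s'.reg 14 = 1 ∧ Frame 13 17 s s') →
      Runs W inp (.mulPow 14 13 k) s' (k + 1) fun s' => s'.reg 13 = (B + 1 : ℕ) ∧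
        s'.reg 14 = ((B + 1) ^ k : ℕ) ∧ Frame 13 17 s s' := by
    rintro s' ⟨h13, h14, hf⟩
    refine Runs.of_wp (Prog.cost_mulPow _ _ _).le (Prog.wp_mulPow (by norm_num) k ?_ ?_)
    · intro i hi
      rw [h13, h14, one_mul, ← Nat.cast_pow]
      exact abs_natCast_le ((Nat.pow_le_pow_right (by omega) hi).trans hUW)
    · rw [h13, h14, one_mul, ← Nat.cast_pow]
      exact ⟨by simpa using h13, by simp, hf.setReg (by norm_num) (by norm_num)⟩
  let Inv : ℕ → State → Prop := fun j s' => ∃ i, i + j = (B + 1) ^ k ∧ s'.reg 13 = (B + 1 : ℕ) ∧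
    s'.reg 14 = ((B + 1) ^ k : ℕ) ∧ s'.reg 15 = (k ^ i : ℕ) ∧ s'.reg 16 = j ∧ Frame 13 17 s s'
  have h3 : ∀ s' : State, (s'.reg 13 = (B + 1 : ℕ) ∧ s'.reg 14 = ((B + 1) ^ k : ℕ) ∧ Frame 13 17 s s') →
      Runs W inp (.block [.const 15 1, .op .add 16 14 7]) s' 2 (Inv ((B + 1) ^ k)) := by
    rintro s' ⟨h13, h14, hf⟩
    have h7' : s'.reg 7 = 0 := (hf.2 _ (by norm_num)).trans h7
    refine Runs.of_wp (by decide) ?_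
    simp only [Prog.block, Prog.wp, Op.eval, State.setReg_reg, h14, h7', reduceIte,
      Nat.reduceEqDiff, add_zero]
    refine ⟨by simp; omega, abs_natCast_le hUW, 0, by omega, ?_⟩
    simp only [State.setReg_reg, h13, h14, reduceIte, Nat.reduceEqDiff, pow_zero, Nat.cast_one,
      true_and]
    repeat refine Frame.setReg ?_ (by norm_num) (by norm_num)
    exact hf
  have h4 := Runs.loop (W := W) (inp := inp) (P := .block [.op .mul 15 15 9, .op .sub 16 16 8])
    (r := 16) (T := 2) (Q := fun s' => s'.reg 13 = (B + 1 : ℕ) ∧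
      s'.reg 14 = ((B + 1) ^ k : ℕ) ∧ s'.reg 15 = (k ^ (B + 1) ^ k : ℕ) ∧ Frame 13 17 s s') Inv
    (by
      rintro s' ⟨i, hi, h13, h14, h15, h16, hf⟩
      obtain rfl : i = (B + 1) ^ k := by omega
      exact ⟨by simpa using h16, h13, h14, h15, hf⟩)
    (by
      rintro j s' ⟨i, hi, h13, h14, h15, h16, hf⟩
      have h8' : s'.reg 8 = 1 := (hf.2 _ (by norm_num)).trans h8
      have h9' : s'.reg 9 = k := (hf.2 _ (by norm_num)).trans h9
      refine ⟨by rw [h16]; positivity, Runs.of_wp (by decide) ?_⟩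
      have e1 : ((k ^ i : ℕ) : ℤ) * k = (k ^ (i + 1) : ℕ) := by push_cast; ring
      simp only [Prog.block, Prog.wp, Op.eval, State.setReg_reg, h15, h16, h8', h9', reduceIte,
        Nat.reduceEqDiff, e1]
      refine ⟨abs_natCast_le ((Nat.pow_le_pow_right (by omega) (by omega)).trans hW),
        abs_le.2 ⟨by omega, by omega⟩, i + 1, by omega, ?_⟩
      simp only [State.setReg_reg, h13, h14, reduceIte, Nat.reduceEqDiff, true_and]
      refine ⟨by push_cast; ring, ?_⟩
      repeat refine Frame.setReg ?_ (by norm_num) (by norm_num)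
      exact hf)
  exact (h1.seq fun s₁ hs₁ => (h2 s₁ hs₁).seq fun s₂ hs₂ => (h3 s₂ hs₂).seq (h4 _)).mono
    (by omega) fun _ => id

/-- Initialization of the search for the alphabet size. -/
def searchInit (k B₀ : ℕ) : Prog := .block [
  .const 5 B₀, .const 6 (B₀ ^ k : ℕ), .const 4 (k ^ B₀ ^ k : ℕ), .const 12 1]

theorem runs_search {B₀ b : ℕ} (hk : 2 ≤ k) (hB : Admissible k B₀ n (b + 1))
    (hmin : ∀ B, B₀ ≤ B → B < b + 1 → (k ^ (B + 1) ^ k) ^ 3 ≤ n)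
    (hW : (k ^ (b + 2) ^ k) ^ 3 ≤ W) {s : State} (h1 : s.reg 1 = n) (h7 : s.reg 7 = 0)
    (h8 : s.reg 8 = 1) (h9 : s.reg 9 = k) :
    Runs W inp (.seq (searchInit k B₀) (.loop 12 (searchBody k))) s
      ((b + 2) * (3 * (b + 2) ^ k + k + 15) + 5) fun s' => s'.reg 5 = (b + 1 : ℕ) ∧
      s'.reg 6 = ((b + 1) ^ k : ℕ) ∧ s'.reg 4 = (k ^ (b + 1) ^ k : ℕ) ∧ Frame 4 18 s s' ∧
      s'.reg 7 = 0 ∧ s'.reg 8 = 1 ∧ s'.reg 9 = k := by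
  have hle := hB.le
  have hbound : ∀ B ≤ b + 1, (k ^ (B + 1) ^ k) ^ 3 ≤ W := fun B h =>
    le_trans (Nat.pow_le_pow_left (Nat.pow_le_pow_right (by omega)
      (Nat.pow_le_pow_left (by omega) _)) _) hW
  have hcube : ∀ x : ℕ, x ≤ x ^ 3 := fun x => Nat.le_self_pow (by norm_num) x
  have hW1 : (1 : ℤ) ≤ W := by
    have : 0 < (k ^ (b + 2) ^ k) ^ 3 := by positivity
    omega
  -- The last iteration does not advance `B`, it only clears register 12. So the number of remaining
  -- iterations is `b + 2 - B` until it drops to `0` at `B = b + 1`.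
  let Inv : ℕ → State → Prop := fun j s' => ∃ B, (B = b + 1 ∧ j = 0 ∨ B + j = b + 2 ∧ j ≠ 0) ∧
    B₀ ≤ B ∧ s'.reg 12 = (if j = 0 then 0 else 1) ∧ s'.reg 5 = B ∧ s'.reg 6 = (B ^ k : ℕ) ∧
    s'.reg 4 = (k ^ B ^ k : ℕ) ∧ Frame 4 18 s s' ∧ s'.reg 7 = 0 ∧ s'.reg 8 = 1 ∧ s'.reg 9 = k
  have hloop := Runs.loop (W := W) (inp := inp) (P := searchBody k) (r := 12)
    (T := 3 * (b + 2) ^ k + k + 14) (Q := fun s' => s'.reg 5 = (b + 1 : ℕ) ∧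
      s'.reg 6 = ((b + 1) ^ k : ℕ) ∧ s'.reg 4 = (k ^ (b + 1) ^ k : ℕ) ∧ Frame 4 18 s s' ∧
      s'.reg 7 = 0 ∧ s'.reg 8 = 1 ∧ s'.reg 9 = k) Inv
    (by
      rintro s' ⟨B, hj, -, h12, h5, h6, h4, h⟩
      obtain rfl : B = b + 1 := by omega
      exact ⟨by simpa using h12, h5, h6, h4, h⟩)
    (by
      rintro j s' ⟨B, hj, hB₀, h12, h5, h6, h4, hf, h7, h8, h9⟩
      refine ⟨by simp [h12], ?_⟩
      have hWB := hbound B (by omega)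
      have hpow := runs_power (inp := inp) hk ((hcube _).trans hWB) h5 h7 h8 h9
      have hmono : (B + 1) ^ k ≤ (b + 2) ^ k := Nat.pow_le_pow_left (by omega) _
      refine (hpow.seq (T' := 8) fun s₁ hs₁ => Runs.of_wp (by decide) ?_).mono (by omega)
        fun _ => id
      obtain ⟨h13, h14, h15, hf₁⟩ := hs₁
      have hf₁' : ∀ r, r < 13 → s₁.reg r = s'.reg r := fun r hr => hf₁.2 r (by omega)
      have h1' : s₁.reg 1 = n := (hf₁' _ (by norm_num)).trans ((hf.2 _ (by norm_num)).trans h1)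
      have h5' := (hf₁' _ (by norm_num)).trans h5
      have h6' := (hf₁' _ (by norm_num)).trans h6
      have h4' := (hf₁' _ (by norm_num)).trans h4
      have h7' := (hf₁' _ (by norm_num)).trans h7
      have h8' := (hf₁' _ (by norm_num)).trans h8
      have h9' := (hf₁' _ (by norm_num)).trans h9
      have hlow := hB.lower
      have hU : (B + 1) ^ k < k ^ (B + 1) ^ k := Nat.lt_pow_self hk
      have hBU : B + 1 ≤ (B + 1) ^ k := Nat.le_self_pow (by omega) _
      have hc := hcube (k ^ (B + 1) ^ k)
      have e1 : ((k ^ (B + 1) ^ k : ℕ) : ℤ) * (k ^ (B + 1) ^ k : ℕ) =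
        ((k ^ (B + 1) ^ k) ^ 2 : ℕ) := by push_cast; ring
      have e2 : (((k ^ (B + 1) ^ k) ^ 2 : ℕ) : ℤ) * (k ^ (B + 1) ^ k : ℕ) =
        ((k ^ (B + 1) ^ k) ^ 3 : ℕ) := by push_cast; ring
      have hsq : (k ^ (B + 1) ^ k) ^ 2 ≤ (k ^ (B + 1) ^ k) ^ 3 :=
        Nat.pow_le_pow_right (by positivity) (by norm_num)
      simp only [Prog.block, Prog.wp, Op.eval, State.setReg_reg, h1', h7', h8', h13, h14, h15,
        reduceIte, Nat.reduceEqDiff, e1, e2, add_zero, Nat.cast_lt]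
      refine ⟨abs_natCast_le (by omega), abs_natCast_le (by omega), abs_ite_le hW1 _,
        abs_one_sub_ite_le hW1 _, fun hne => ⟨abs_natCast_le (by omega), abs_natCast_le (by omega),
          abs_natCast_le (by omega), ?_⟩, fun heq => ?_⟩
      · have hn : ¬ n < (k ^ (B + 1) ^ k) ^ 3 := fun h => hne (by rw [if_pos h]; rfl)
        have hBb : B ≠ b + 1 := fun h => hn (h ▸ hlow)
        refine ⟨B + 1, by omega, by omega, ?_⟩
        simp only [State.setReg_reg, reduceIte, Nat.reduceEqDiff, h7', h8', h9', true_and, and_true]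
        refine ⟨?_, ?_⟩
        · rw [if_neg hn, if_neg (by omega)]; rfl
        · repeat refine Frame.setReg ?_ (by norm_num) (by norm_num)
          exact hf.trans (hf₁.mono (by norm_num) (by norm_num))
      · have hn : n < (k ^ (B + 1) ^ k) ^ 3 := by
          by_contra h
          rw [if_neg h] at heq
          exact absurd heq (by norm_num)
        have hBb : B = b + 1 := by
          by_contra h
          exact absurd hn (not_lt.2 (hmin B hB₀ (by omega)))
        refine ⟨B, .inl ⟨hBb, by omega⟩, hB₀, ?_⟩
        simp only [State.setReg_reg, reduceIte, Nat.reduceEqDiff, h4', h5', h6', h7', h8', h9',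
          true_and, and_true]
        refine ⟨?_, ?_⟩
        · rw [if_pos hn, if_pos (by omega)]; rfl
        · repeat refine Frame.setReg ?_ (by norm_num) (by norm_num)
          exact hf.trans (hf₁.mono (by norm_num) (by norm_num)))
  refine (Runs.seq (Runs.of_wp (T := 4) (Q := Inv (b + 2 - B₀))
    (by simp [searchInit, Prog.block, Prog.cost]) ?_) (hloop _)).mono ?_ fun _ => id
  · have hb1 := hbound (b + 1) le_rfl
    have hU : (b + 2) ^ k < k ^ (b + 2) ^ k := Nat.lt_pow_self hk
    have hBU : b + 2 ≤ (b + 2) ^ k := Nat.le_self_pow (by omega) _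
    have hc := hcube (k ^ (b + 2) ^ k)
    have hU₀ : B₀ ^ k ≤ (b + 2) ^ k := Nat.pow_le_pow_left (by omega) _
    have hR₀ : k ^ B₀ ^ k ≤ k ^ (b + 2) ^ k := Nat.pow_le_pow_right (by omega) hU₀
    simp only [searchInit, Prog.block, Prog.wp]
    refine ⟨abs_natCast_le (by omega), abs_natCast_le (by omega), abs_natCast_le (by omega),
      by simpa using hW1, B₀, by omega, le_rfl, ?_⟩
    simp only [State.setReg_reg, reduceIte, Nat.reduceEqDiff, h7, h8, h9, true_and, and_true]
    refine ⟨by rw [if_neg (by omega)], ?_⟩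
    repeat refine Frame.setReg ?_ (by norm_num) (by norm_num)
    exact Frame.refl _ _ _
  · have : (b + 2 - B₀) * (3 * (b + 2) ^ k + k + 14 + 1) ≤ (b + 2) * (3 * (b + 2) ^ k + k + 15) :=
      Nat.mul_le_mul_right _ (by omega)
    omega

/-- Computes the remaining parameters. -/
def finishCode : Prog := .block [
  .op .mul 17 4 4, .op .mul 17 17 4, .op .add 2 1 17, .op .mul 3 2 2, .op .add 3 3 8,
  .op .sub 10 5 8]

/-- Computes all parameters of the reduction. -/
def preamble (k B₀ : ℕ) : Prog :=
  .seq (.seq (sizeInit k) (.loop 12 sizeBody))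
    (.seq (.seq (searchInit k B₀) (.loop 12 (searchBody k))) finishCode)

theorem runs_preamble {B₀ b : ℕ} (hr : Reads k n len val inp) (hn : 1 ≤ n) (hk : 2 ≤ k)
    (hB : Admissible k B₀ n (b + 1))
    (hmin : ∀ B, B₀ ≤ B → B < b + 1 → (k ^ (B + 1) ^ k) ^ 3 ≤ n)
    (hW : (k ^ (b + 2) ^ k) ^ 3 ≤ W) (hW' : WordSize k b n (k ^ (b + 1) ^ k) W) (s : State) :
    Runs W inp (preamble k B₀) s (5 * k + 7 + ((b + 2) * (3 * (b + 2) ^ k + k + 15) + 5 + 6))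
      fun s' => Layout k b n (k ^ (b + 1) ^ k) s'.reg ∧ Frame 0 40 s s' := by
  refine (runs_size hr hW'.address hn s).seq ?_
  rintro s₁ ⟨h1, h7, h8, h9, hf₁⟩
  refine (runs_search hk hB hmin hW h1 h7 h8 h9).seq ?_
  rintro s₂ ⟨h5, h6, h4, hf₂, h7, h8, h9⟩
  have h1' : s₂.reg 1 = n := (hf₂.2 _ (by norm_num)).trans h1
  refine Runs.of_wp (by decide) ?_
  set R := k ^ (b + 1) ^ k
  have e1 : (R : ℤ) * R = (R ^ 2 : ℕ) := by push_cast; ring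
  have e2 : ((R ^ 2 : ℕ) : ℤ) * R = (R ^ 3 : ℕ) := by push_cast; ring
  have e3 : (n : ℤ) + (R ^ 3 : ℕ) = (n + R ^ 3 : ℕ) := by push_cast; ring
  have e4 : ((n + R ^ 3 : ℕ) : ℤ) * (n + R ^ 3 : ℕ) = ((n + R ^ 3) * (n + R ^ 3) : ℕ) := by
    push_cast; ring
  have e5 : (((n + R ^ 3) * (n + R ^ 3) : ℕ) : ℤ) + 1 = ((n + R ^ 3) * (n + R ^ 3) + 1 : ℕ) := by
    push_cast; ring
  have e6 : ((b + 1 : ℕ) : ℤ) - 1 = b := by push_cast; ring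
  have hm := hW'.matrix
  have hNN := Nat.le_mul_self (n + R ^ 3)
  have hsq : R ^ 2 ≤ R ^ 3 := Nat.pow_le_pow_right (by positivity) (by norm_num)
  simp only [finishCode, Prog.block, Prog.wp, Op.eval, State.setReg_reg, h1', h4, h5, h8,
    reduceIte, Nat.reduceEqDiff, e1, e2, e3, e4, e5, e6]
  have hbW := hW'.alphabet
  refine ⟨abs_natCast_le (by omega), abs_natCast_le (by omega), abs_natCast_le (by omega),
    abs_natCast_le (by omega), abs_natCast_le (by omega), abs_natCast_le (by omega), ?_, ?_⟩
  · constructor <;> simp only [State.setReg_reg, reduceIte, Nat.reduceEqDiff, h1', h4, h5, h6, h7,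
      h8, h9]
  · repeat refine Frame.setReg ?_ (by norm_num) (by norm_num)
    exact hf₁.trans (hf₂.mono (by norm_num) (by norm_num))

end

end KSumReduction

/-! ### Encodings of graphs and of `k`-SUM instances -/

open RAM

/-- This identifies the input expected by the simulated algorithm with the values that `query`
computes. -/
theorem GraphInstance.readInput_encode (I : GraphInstance) (A : ℕ → ℕ → Prop)
    (hA : ∀ u v : Fin I.n, I.G.Adj u v ↔ A u v) (y : ℤ) :
    readInput I.encode y = KSumReduction.virtualInput I.n A y := by
  classical
  unfold readInput KSumReduction.virtualInput GraphInstance.encode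
  rcases lt_trichotomy y 0 with hy | rfl | hy
  · rw [if_neg (by omega), if_neg (by omega), if_neg (by omega)]
  · simp
  · obtain ⟨c, rfl⟩ : ∃ c : ℕ, y = c + 1 := ⟨(y - 1).toNat, by omega⟩
    rw [if_pos hy.le, if_neg (by omega)]
    have e1 : ((c : ℤ) + 1).toNat = c + 1 := by omega
    have e2 : ((c : ℤ) + 1 - 1).toNat = c := by omega
    rw [e1, e2, List.getD_cons_succ]
    by_cases hc : c < I.n * I.n
    · rw [if_pos ⟨hy, by omega⟩, List.getD_eq_getElem _ _ (by simpa using hc), List.getElem_ofFn]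
      exact if_congr (hA _ _) rfl rfl
    · rw [if_neg (by omega), List.getD_eq_default _ _ (by simpa using hc)]

namespace KSumInstance
open KSumReduction

variable {k : ℕ} (I : KSumInstance k)

/-- Cardinality of the `i`-th set. -/
def len (i : ℕ) : ℕ := if h : i < k then (I.S ⟨i, h⟩).length else 0

/-- The element number `w`, in the order of the encoding. -/
def val (w : ℕ) : ℤ := (List.ofFn I.S).flatten.getD w 0

theorem pre_len : pre I.len k = I.size := by
  rw [pre, Finset.sum_range]
  exact Finset.sum_congr rfl fun i _ => by simp [len]

theorem _root_.List.getD_flatten (L : List (List ℤ)) (i j : ℕ) (hi : i < L.length)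
    (hj : j < L[i].length) :
    L.flatten.getD (((L.take i).map List.length).sum + j) 0 = L[i][j] := by
  induction L generalizing i with
  | nil => simp at hi
  | cons l L ih =>
    cases i with
    | zero =>
      simp only [List.getElem_cons_zero] at hj
      simp only [List.take_zero, List.map_nil, List.sum_nil, zero_add, List.flatten_cons,
        List.getElem_cons_zero]
      rw [List.getD_append _ _ _ _ hj, List.getD_eq_getElem _ _ hj]
    | succ i =>
      simp only [List.getElem_cons_succ, List.length_cons, Nat.add_lt_add_iff_right] at hj hi
      simp only [List.flatten_cons, List.take_succ_cons, List.map_cons, List.sum_cons,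
        List.getElem_cons_succ]
      rw [List.getD_append_right _ _ _ _ (by omega), ← ih i hi hj]
      congr 1; omega

theorem sum_take (i : ℕ) (hi : i ≤ k) :
    (((List.ofFn I.S).take i).map List.length).sum = pre I.len i := by
  induction i with
  | zero => simp [pre]
  | succ i ih =>
    rw [pre_succ, ← ih (by omega), List.map_take, List.map_take,
      List.sum_take_succ _ _ (by simpa using hi)]
    simp [len, show i < k by omega]

theorem val_pre_add (i : Fin k) (j : ℕ) (hj : j < (I.S i).length) :
    I.val (pre I.len i + j) = (I.S i)[j] := by
  have := List.getD_flatten (List.ofFn I.S) i j (by simp) (by simpa using hj)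
  rw [I.sum_take i i.2.le] at this
  rw [val, this]
  simp

theorem length_flatten : (List.ofFn I.S).flatten.length = I.size := by
  rw [List.length_flatten, ← I.pre_len, ← I.sum_take k le_rfl, List.take_of_length_le (by simp)]

theorem val_mem {w : ℕ} (hw : w < I.size) : ∃ i, I.val w ∈ I.S i := by
  rw [val, List.getD_eq_getElem _ _ (by rwa [length_flatten])]
  have := List.getElem_mem (l := (List.ofFn I.S).flatten) (n := w) (by rwa [length_flatten])
  obtain ⟨l, hl, h⟩ := List.mem_flatten.1 this
  obtain ⟨i, rfl⟩ := (List.mem_ofFn' _ _).1 hl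
  exact ⟨i, h⟩

theorem reads : Reads k I.size I.len I.val I.encode where
  total := I.pre_len
  len_eq i hi := by
    simp only [readInput, encode, Nat.cast_nonneg, if_true, Int.toNat_natCast]
    rw [List.getD_append _ _ _ _ (by simpa using hi), List.getD_eq_getElem _ _ (by simpa using hi)]
    simp [len, hi]
  val_eq w hw := by
    have : ((k : ℤ) + w).toNat = k + w := by omega
    simp only [readInput, encode, val, this]
    rw [if_pos (by positivity), List.getD_append_right _ _ _ _ (by simp)]
    simp
  bound w hw := by
    obtain ⟨i, hi⟩ := I.val_mem hw
    exact I.bound i _ hi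

/-- Solutions are restated in terms of positions in the input, which is how the graph refers to its
candidates. -/
theorem isYes_iff : I.IsYes ↔ ∃ w : Fin k → ℕ, (∀ i, w i < I.size) ∧
    (∀ i, owner I.len (w i) = i) ∧ ∑ i, I.val (w i) = 0 := by
  have hr := I.reads
  have hlen : ∀ i : Fin k, I.len i = (I.S i).length := fun i => by simp [len]
  constructor
  · rintro ⟨x, hx, hsum⟩
    choose j hj hxj using fun i => List.getElem_of_mem (hx i)
    refine ⟨fun i => pre I.len i + j i, fun i => ?_, fun i => ?_, ?_⟩
    · change pre I.len i + j i < I.size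
      have := hr.len_le i.2
      have := hlen i
      have := hj i
      omega
    · refine owner_eq (Nat.le_add_right _ _) ?_
      rw [pre_succ, hlen]
      change pre I.len i + j i < _
      have := hj i
      omega
    · rw [← hsum]
      exact Finset.sum_congr rfl fun i _ => (I.val_pre_add i _ (hj i)).trans (hxj i)
  · rintro ⟨w, hw, hown, hsum⟩
    refine ⟨fun i => I.val (w i), fun i => ?_, hsum⟩
    have h1 : w i < pre I.len (i + 1) := (hr.lt_pre_owner (hw i)).2 (hown i).le
    have h2 : pre I.len i ≤ w i := by
      rcases Nat.eq_zero_or_pos (i : ℕ) with h | h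
      · simp [h, pre]
      · by_contra! hlt
        have := (hr.lt_pre_owner (i := (i : ℕ) - 1) (hw i)).1 (by rwa [Nat.sub_add_cancel h])
        rw [hown] at this
        omega
    rw [pre_succ, hlen] at h1
    obtain ⟨j, hj⟩ := Nat.exists_eq_add_of_le h2
    have hj' : j < (I.S i).length := by omega
    simp only [hj, I.val_pre_add i j hj']
    exact List.getElem_mem _

end KSumInstance

/-! ### The complete algorithm for `k`-SUM and its resources -/

open RAM

/-- An algorithm running in time `O(n ^ e)` accepts the graphs that have a dominating set of size at
most `k`, and accepts only graphs that have a dominating set of size at most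
`k * (Nat.size n) ^ (1 / P)`. -/
def DomSetGapSolvable (k P : ℕ) (e : ℝ) : Prop :=
  SolvableInTime GraphInstance.n GraphInstance.encode (fun I s => (I.HasDomSet k → s.Accepts) ∧
    (s.Accepts → ∃ D, I.G.IsDominatingSet D ∧ D.card ^ P ≤ k ^ P * Nat.size I.n)) e

namespace KSumReduction

/-- The graph that represents an instance of `k`-SUM. -/
noncomputable def graphInstance {k : ℕ} (I : KSumInstance k) (b R : ℕ) : GraphInstance where
  n := I.size + R ^ 3
  pos := Nat.add_pos_left I.pos _
  G := graph k b R I.size (owner I.len) I.val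

theorem mul_pow_le_of_le {n c d C : ℕ} (hn : 1 ≤ n) (hc : c ≤ C) (hd : d ≤ C) :
    c * n ^ d ≤ C * n ^ C :=
  Nat.mul_le_mul hc (Nat.pow_le_pow_right hn hd)

theorem sq_le_two_mul_two_pow (U : ℕ) : U ^ 2 ≤ 2 * 2 ^ U := by
  induction U with
  | zero => simp
  | succ U ih =>
    rw [pow_succ 2 U]
    rcases lt_or_ge U 3 with h | h
    · interval_cases U <;> norm_num
    · nlinarith

/-- A number `U` with `2 ^ U ≤ X` is smaller than every power of `X`, up to a constant. -/
theorem cast_le_mul_rpow {U X : ℕ} (hU : 2 ^ U ≤ X) {δ : ℝ} (hδ : 0 < δ) :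
    (U : ℝ) ≤ (X : ℝ) ^ δ / (δ * Real.log 2) := by
  have hl : 0 < Real.log 2 := Real.log_pos (by norm_num)
  have h1 : (U : ℝ) * Real.log 2 ≤ Real.log X := by
    rw [← Real.log_pow]
    exact Real.log_le_log (by positivity) (by exact_mod_cast hU)
  have h2 := Real.log_le_rpow_div (x := (X : ℝ)) (by positivity) hδ
  rw [← div_div, le_div_iff₀ hl]
  exact h1.trans h2

/-- The whole algorithm for `k`-SUM. -/
def kSumProg (k B₀ : ℕ) (P : Prog) : Prog :=
  .seq (preamble k B₀) (.seq (P.simulate query) (.ite 40 (.const 0 1) (.const 0 0)))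

/-- Bound for the time for one access to the virtual input. -/
def accessTime (k b : ℕ) : ℕ := 17 * (b + 1) ^ k + 7 * k + 37

/-- Bound for the running time of the preamble. -/
def preambleTime (k b : ℕ) : ℕ :=
  5 * k + 7 + ((b + 2) * (3 * (b + 2) ^ k + k + 15) + 5 + 6)

/-- The preamble touches neither the arrays nor the registers from 40 on, so its final state
represents the initial state of the simulated program. Acceptance is then copied from register 40,
the image of register 0. -/
theorem runs_kSumProg {k B₀ b W W' t : ℕ} (hk : 2 ≤ k) (hb : 1 ≤ b) (I : KSumInstance k) {P : Prog}
    (hB : Admissible k B₀ I.size (b + 1))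
    (hmin : ∀ B, B₀ ≤ B → B < b + 1 → (k ^ (B + 1) ^ k) ^ 3 ≤ I.size)
    (hW : (k ^ (b + 2) ^ k) ^ 3 ≤ W) (hW' : WordSize k b I.size (k ^ (b + 1) ^ k) W)
    (hWW : W' ≤ W) {s₁ : State}
    (h : Exec W' (graphInstance I b (k ^ (b + 1) ^ k)).encode P State.init t s₁) :
    Runs W I.encode (kSumProg k B₀ P) State.init
      (preambleTime k b + (accessTime k b * t + 2)) fun s => s.Accepts ↔ s₁.Accepts := by
  have hW1 : (1 : ℤ) ≤ W := by have := hW'.alphabet; omega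
  have hr := I.reads
  refine (runs_preamble hr I.pos hk hB hmin hW hW' State.init).seq ?_
  rintro s ⟨hL, hf⟩
  have hA := GraphInstance.readInput_encode (graphInstance I b (k ^ (b + 1) ^ k))
    (Adj k b (k ^ (b + 1) ^ k) I.size (owner I.len) I.val) fun u v => Iff.rfl
  refine (Runs.simulate (I := Layout k b I.size (k ^ (b + 1) ^ k)) (κ := accessTime k b) hWW
    (by unfold accessTime; omega) (fun f r v hf => hf.update r v) ?_ h s ?_).seq ?_
  · intro s r a hs _
    rw [hA]
    exact runs_query hr hW' hb s r a hs
  · exact ⟨fun r => hf.2 _ (by omega), hf.1, hL⟩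
  · intro s₂ hs₂
    have h40 : s₂.reg 40 = s₁.reg 0 := hs₂.reg 0
    refine Runs.of_wp (by decide) ?_
    simp only [Prog.wp, State.Accepts, State.setReg_reg, h40, reduceIte]
    exact ⟨fun h => ⟨by simpa using hW1, by simpa using h⟩, fun h => ⟨by simp, by simpa using h⟩⟩

theorem exists_wordSize (k B₀ c₀ : ℕ) (hk : 2 ≤ k) : ∃ C₁ : ℕ, ∀ C ≥ C₁, ∀ n b : ℕ, 1 ≤ n →
    Admissible k B₀ n (b + 1) → WordSize k b n (k ^ (b + 1) ^ k) (C * n ^ C) ∧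
      (k ^ (b + 2) ^ k) ^ 3 ≤ C * n ^ C ∧
      c₀ * (n + (k ^ (b + 1) ^ k) ^ 3) ^ c₀ ≤ C * n ^ C := by
  set C₀ := (k ^ B₀ ^ k) ^ 3
  -- There is a summand for each coefficient and each exponent that has to stay below `C` in the
  -- bounds that follow.
  refine ⟨((1 + C₀) ^ 2 + 1) + (2 * k + 1) + C₀ + C₀ ^ 2 ^ k + 2 ^ k + (C₀ + k) + (1 + k) +
    c₀ * (1 + C₀) ^ c₀ + c₀, fun C hC n b hn hB => ?_⟩
  set R := k ^ (b + 1) ^ k with hR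
  have hup : R ^ 3 ≤ C₀ * n := hB.upper
  have h2k : 0 < 2 ^ k := by positivity
  have hU : (b + 1) ^ k < R := Nat.lt_pow_self hk
  have hbU : b + 1 ≤ (b + 1) ^ k := Nat.le_self_pow (by omega) _
  have hRR : R * R ≤ R ^ 3 := by
    rw [pow_three, ← mul_assoc]; exact Nat.le_mul_of_pos_right _ (by omega)
  have hR1 : R ≤ R ^ 3 := Nat.le_self_pow (by norm_num) _
  have hN : n + R ^ 3 ≤ (1 + C₀) * n := by rw [add_mul, one_mul]; omega
  have hlin : ∀ c ≤ C, c * n ≤ C * n ^ C := fun c hc => by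
    simpa using mul_pow_le_of_le (d := 1) hn hc (by omega)
  refine ⟨⟨?_, ?_, ?_, ?_, ?_, ?_⟩, ?_, ?_⟩
  · refine le_trans ?_ (mul_pow_le_of_le (c := (1 + C₀) ^ 2 + 1) (d := 2) hn (by omega) (by omega))
    have h1 := Nat.mul_le_mul hN hN
    have h2 : 1 ≤ n ^ 2 := Nat.one_le_pow _ _ hn
    nlinarith
  · refine le_trans ?_ (mul_pow_le_of_le (c := C₀) (d := 2 * k + 1) hn (by omega) (by omega))
    rw [pow_succ, mul_comm (n ^ (2 * k)), ← mul_assoc]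
    exact Nat.mul_le_mul_right _ (hR1.trans hup)
  · refine le_trans ?_ (hlin C₀ (by omega))
    exact ((Nat.mul_le_mul_left R (by omega)).trans hRR).trans hup
  · refine le_trans ?_ (hlin (C₀ + k) (by omega))
    nlinarith
  · refine lt_of_lt_of_le ?_ (hlin C₀ (by omega))
    omega
  · refine le_trans ?_ (hlin (1 + k) (by omega))
    nlinarith
  · refine le_trans ?_ (mul_pow_le_of_le (c := C₀ ^ 2 ^ k) (d := 2 ^ k) hn (by omega) (by omega))
    rw [← mul_pow]
    exact hB.pow_le (by omega) (by omega)
  · refine le_trans ?_ (mul_pow_le_of_le (c := c₀ * (1 + C₀) ^ c₀) (d := c₀) hn (by omega)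
      (by omega))
    rw [mul_assoc, ← mul_pow]
    exact Nat.mul_le_mul_left _ (Nat.pow_le_pow_left hN _)

/-- Since `2 ^ U = O(n)`, one access costs `O(U) = O(n ^ δ)`, and this factor multiplies the
simulated time `O(n ^ e)`. The preamble takes `O(U ^ 2) = O(n)` steps, which is harmless because `1
≤ e`. -/
theorem exists_time (k B₀ c₀ : ℕ) (hk : 2 ≤ k) {e δ : ℝ} (he : 1 ≤ e) (hδ : 0 < δ) :
    ∃ A : ℝ, ∀ n b t : ℕ, 1 ≤ n → Admissible k B₀ n (b + 1) →
      (t : ℝ) ≤ c₀ * ((n + (k ^ (b + 1) ^ k) ^ 3 : ℕ) : ℝ) ^ e →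
      ((preambleTime k b + (accessTime k b * t + 2) : ℕ) : ℝ) ≤ A * (n : ℝ) ^ (e + δ) := by
  set C₀ := (k ^ B₀ ^ k) ^ 3
  have hl : 0 < Real.log 2 := Real.log_pos (by norm_num)
  set A₁ : ℝ := 17 * ((C₀ : ℝ) ^ δ / (δ * Real.log 2)) + 7 * k + 37
  set A₂ : ℝ := c₀ * (1 + C₀ : ℝ) ^ e
  set A₃ : ℝ := (((6 * 2 ^ k + 2 * k + 30) * (2 * C₀) + 5 * k + 20 : ℕ) : ℝ)
  refine ⟨A₃ + A₁ * A₂, fun n b t hn hB ht => ?_⟩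
  set R := k ^ (b + 1) ^ k with hR
  set U := (b + 1) ^ k with hU
  have hn1 : (1 : ℝ) ≤ n := by exact_mod_cast hn
  have hup : R ^ 3 ≤ C₀ * n := hB.upper
  have hN : n + R ^ 3 ≤ (1 + C₀) * n := by rw [add_mul, one_mul]; omega
  have hUR : 2 ^ U ≤ C₀ * n :=
    ((Nat.pow_le_pow_left hk _).trans (Nat.le_self_pow (by norm_num) _)).trans hup
  have hbU : b + 1 ≤ U := Nat.le_self_pow (by omega) _
  have h1 : (accessTime k b : ℝ) ≤ A₁ * (n : ℝ) ^ δ := by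
    have := cast_le_mul_rpow hUR hδ
    push_cast at this
    rw [Real.mul_rpow (by positivity) (by positivity)] at this
    have h1n : 1 ≤ (n : ℝ) ^ δ := Real.one_le_rpow hn1 hδ.le
    unfold accessTime
    rw [← hU]
    push_cast
    have h7 : (7 * k + 37 : ℝ) ≤ (7 * k + 37) * (n : ℝ) ^ δ :=
      le_mul_of_one_le_right (by positivity) h1n
    calc (17 * U + 7 * k + 37 : ℝ) ≤ 17 * ((C₀ : ℝ) ^ δ * (n : ℝ) ^ δ / (δ * Real.log 2)) +
          (7 * k + 37) * (n : ℝ) ^ δ := by linarith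
      _ = A₁ * (n : ℝ) ^ δ := by simp only [A₁]; ring
  have h2 : (t : ℝ) ≤ A₂ * (n : ℝ) ^ e := by
    refine ht.trans ?_
    simp only [A₂]
    rw [mul_assoc, ← Real.mul_rpow (by positivity) (by positivity)]
    refine mul_le_mul_of_nonneg_left (Real.rpow_le_rpow (by positivity) ?_ (by linarith))
      (by positivity)
    exact_mod_cast hN
  have h3 : ((preambleTime k b + 2 : ℕ) : ℝ) ≤ A₃ * (n : ℝ) ^ (e + δ) := by
    have hnat : preambleTime k b + 2 ≤ ((6 * 2 ^ k + 2 * k + 30) * (2 * C₀) + 5 * k + 20) * n := by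
      have e1 : (b + 2) ^ k ≤ 2 ^ k * U := succ_pow_le (by omega) k
      have e2 : U ^ 2 ≤ 2 * (C₀ * n) := (sq_le_two_mul_two_pow U).trans (by omega)
      have e3 : 3 * (b + 2) ^ k + k + 15 ≤ (3 * 2 ^ k + k + 15) * U := by
        have hU1 : 1 ≤ U := by omega
        nlinarith
      unfold preambleTime
      calc 5 * k + 7 + ((b + 2) * (3 * (b + 2) ^ k + k + 15) + 5 + 6) + 2
          ≤ 5 * k + 7 + ((2 * U) * ((3 * 2 ^ k + k + 15) * U) + 5 + 6) + 2 := by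
            have := Nat.mul_le_mul (show b + 2 ≤ 2 * U by omega) e3
            omega
        _ = (6 * 2 ^ k + 2 * k + 30) * U ^ 2 + (5 * k + 20) := by ring
        _ ≤ (6 * 2 ^ k + 2 * k + 30) * (2 * (C₀ * n)) + (5 * k + 20) * n :=
            Nat.add_le_add (Nat.mul_le_mul_left _ e2) (Nat.le_mul_of_pos_right _ hn)
        _ = _ := by ring
    calc ((preambleTime k b + 2 : ℕ) : ℝ) ≤ A₃ * n := by
          simp only [A₃]
          exact_mod_cast hnat
      _ ≤ A₃ * (n : ℝ) ^ (e + δ) := by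
          refine mul_le_mul_of_nonneg_left ?_ (by positivity)
          exact Real.self_le_rpow_of_one_le hn1 (by linarith)
  have h4 : (accessTime k b : ℝ) * t ≤ A₁ * A₂ * (n : ℝ) ^ (e + δ) := by
    refine (mul_le_mul h1 h2 (by positivity) ((Nat.cast_nonneg _).trans h1)).trans_eq ?_
    rw [Real.rpow_add (by positivity)]
    ring
  push_cast at h3 ⊢
  linarith

end KSumReduction

open KSumReduction in
/-- A fast algorithm for the gap problem yields a fast algorithm for `k`-SUM. -/
theorem kSum_solvable_of_domSetGapSolvable {k : ℕ} (hk : 2 ≤ k) {e δ : ℝ} (he : 1 ≤ e) (hδ : 0 < δ)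
    (h : DomSetGapSolvable k (k * (k + 1)) e) :
    SolvableInTime (ι := KSumInstance k) KSumInstance.size KSumInstance.encode
      (fun I s => s.Accepts ↔ I.IsYes) (e + δ) := by
  obtain ⟨P, c₀, hP⟩ := h
  obtain ⟨B₀, hB₀, hthr⟩ := exists_threshold k hk
  obtain ⟨C₁, hC₁⟩ := exists_wordSize k B₀ c₀ hk
  obtain ⟨A, hA⟩ := exists_time k B₀ c₀ hk he hδ
  refine ⟨kSumProg k B₀ P, max C₁ ⌈A⌉₊, fun I => ?_⟩
  set n := I.size
  have hn : 1 ≤ n := I.pos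
  obtain ⟨b, hB, hmin⟩ := exists_admissible hk hB₀ hn
  -- The value `d = 0` serves only to extract `k ≤ b`.
  obtain ⟨hkb, -⟩ := hthr b n 0 hB (by rw [zero_pow (by positivity)]; exact Nat.zero_le _)
  set R := k ^ (b + 1) ^ k with hR
  obtain ⟨t, s₁, hexec, ht, hyes, hno⟩ := hP (graphInstance I b R)
  obtain ⟨hW1, hW2, hW3⟩ := hC₁ (max C₁ ⌈A⌉₊) (le_max_left _ _) n b hn hB
  obtain ⟨t', s, h1, h2, h3⟩ := runs_kSumProg hk (by omega) I hB hmin hW2 hW1 hW3 hexec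
  refine ⟨t', s, h1, ?_, ?_⟩
  · have hA' : A ≤ (max C₁ ⌈A⌉₊ : ℕ) :=
      (Nat.le_ceil A).trans (by exact_mod_cast le_max_right _ _)
    calc (t' : ℝ) ≤ A * (n : ℝ) ^ (e + δ) :=
          le_trans (by exact_mod_cast h2) (hA n b t hn hB ht)
      _ ≤ (max C₁ ⌈A⌉₊ : ℕ) * (n : ℝ) ^ (e + δ) :=
          mul_le_mul_of_nonneg_right hA' (by positivity)
  · change s.Accepts ↔ I.IsYes
    rw [h3, I.isYes_iff]
    constructor
    · intro hacc
      obtain ⟨D, hD, hcard⟩ := hno hacc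
      obtain ⟨-, hd, hπ⟩ := hthr b n D.card hB hcard
      refine exists_sum_eq_zero (M := n ^ (2 * k)) (by omega) hkb hR (fun w hw => ?_) hD hd hπ
      have := I.reads.bound w hw
      exact_mod_cast this
    · rintro ⟨w, hw, hown, hsum⟩
      obtain ⟨D, hD, hcard⟩ := exists_dominatingSet (R := R) (by omega) hkb w hw hown hsum
      exact hyes ⟨D, hD, by exact_mod_cast hcard⟩

open RAM

namespace DomSetVerifier
open KSumReduction

/-! ## Verification of the output of an approximation algorithm -/

/-- The input `inp` is the encoding of the relation `A` on `N` vertices. -/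
structure ReadsMatrix (N : ℕ) (A : ℕ → ℕ → Prop) (inp : List ℤ) : Prop where
  size_eq : readInput inp 0 = N
  zero_or_one : ∀ u < N, ∀ v < N, |readInput inp ((u : ℤ) * N + v + 1)| ≤ 1
  adj_iff : ∀ u < N, ∀ v < N, readInput inp ((u : ℤ) * N + v + 1) ≠ 0 ↔ A u v

theorem readsMatrix (I : GraphInstance) : ReadsMatrix I.n
    (fun u v => ∃ (hu : u < I.n) (hv : v < I.n), I.G.Adj ⟨u, hu⟩ ⟨v, hv⟩) I.encode := by
  have h := I.readInput_encode
    (fun u v => ∃ (hu : u < I.n) (hv : v < I.n), I.G.Adj ⟨u, hu⟩ ⟨v, hv⟩)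
    fun u v => ⟨fun h => ⟨u.2, v.2, h⟩, fun ⟨_, _, h⟩ => h⟩
  have h' : ∀ u < I.n, ∀ v < I.n, (((u : ℤ) * I.n + v + 1 - 1).toNat / I.n = u ∧
      ((u : ℤ) * I.n + v + 1 - 1).toNat % I.n = v) ∧ 0 < (u : ℤ) * I.n + v + 1 ∧
      (u : ℤ) * I.n + v + 1 ≤ (I.n * I.n : ℕ) := by
    intro u hu v hv
    have e : ((u : ℤ) * I.n + v + 1 - 1).toNat = I.n * u + v := by
      rw [add_sub_cancel_right, mul_comm]; exact Int.toNat_natCast _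
    rw [e, Nat.mul_add_div (by omega), Nat.div_eq_of_lt hv, Nat.mul_add_mod, Nat.mod_eq_of_lt hv]
    refine ⟨⟨by omega, rfl⟩, by positivity, ?_⟩
    have : u * I.n + v + 1 ≤ I.n * I.n := by nlinarith
    exact_mod_cast this
  refine ⟨by rw [h]; simp [virtualInput], fun u hu v hv => ?_, fun u hu v hv => ?_⟩
  all_goals
    obtain ⟨⟨h1, h2⟩, h3, h4⟩ := h' u hu v hv
    rw [h, virtualInput, if_neg h3.ne', if_pos ⟨h3, h4⟩, h1, h2]
  · split_ifs <;> simp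
  · simp

/-- The vertex `v` is equal or adjacent to `d`. -/
def Hit (N : ℕ) (A : ℕ → ℕ → Prop) (v : ℕ) (d : ℤ) : Prop :=
  ∃ u < N, d = u ∧ (u = v ∨ A v u)

/-- Loads an entry of the output. -/
def loadVertex : Prog := .block [.load 16 0 14, .op .lt 17 16 7, .op .lt 18 16 2]

/-- Tests whether the vertex in register 11 is hit by the one in register 16. -/
def hitTest : Prog :=
  .ite 17 .skip (.ite 18 (.seq (.op .sub 19 16 11)
    (.ite 19 (.seq (.block [.op .mul 19 11 2, .op .add 19 19 16, .op .add 19 19 8, .input 19 19])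
      (.ite 19 (.const 13 1) .skip)) (.const 13 1))) .skip)

/-- One step of the search for a vertex that hits the vertex in register 11. -/
def innerBody : Prog :=
  .seq loadVertex (.seq hitTest (.block [.op .add 14 14 8, .op .sub 15 15 8]))

/-- Initialization of the search. -/
def innerInit : Prog := .block [.const 13 0, .const 14 0, .op .add 15 0 7]

section
variable {W N L : ℕ} {A : ℕ → ℕ → Prop} {inp : List ℤ}

/-- The entry `d` may be any integer, as nothing is known about the output in general. Its range is
tested before an address is formed from it, so the address stays within the matrix. -/
theorem runs_hitTest (hr : ReadsMatrix N A inp) (hW : N * N + 1 ≤ W) {s : State} {v : ℕ}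
    (hv : v < N) {d : ℤ} (h2 : s.reg 2 = N) (h8 : s.reg 8 = 1) (h11 : s.reg 11 = v)
    (h16 : s.reg 16 = d) (h17 : s.reg 17 = if d < 0 then 1 else 0)
    (h18 : s.reg 18 = if d < N then 1 else 0) :
    Runs W inp hitTest s 10 fun s' =>
      (Hit N A v d ∧ s'.reg 13 = 1 ∨ ¬ Hit N A v d ∧ s'.reg 13 = s.reg 13) ∧
      (∀ r, r ≠ 13 → r ≠ 19 → s'.reg r = s.reg r) ∧ s'.arr = s.arr := by
  refine Runs.of_wp (by decide) ?_
  have hno : ¬ Hit N A v d → (Hit N A v d ∧ s.reg 13 = 1 ∨ ¬ Hit N A v d ∧ s.reg 13 = s.reg 13) ∧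
      (∀ r, r ≠ 13 → r ≠ 19 → s.reg r = s.reg r) ∧ s.arr = s.arr := fun h =>
    ⟨.inr ⟨h, rfl⟩, fun _ _ _ => rfl, rfl⟩
  refine ⟨fun h => hno ?_, fun h => ⟨fun h' => ?_, fun h' => hno ?_⟩⟩
  · rw [h17] at h
    rintro ⟨u, hu, rfl, -⟩
    simp at h
  · simp only [h17, h18, ne_eq, ite_eq_right_iff, one_ne_zero, imp_false, not_lt] at h h'
    obtain ⟨u, rfl⟩ := Int.eq_ofNat_of_zero_le h
    have hu : u < N := by omega
    have hNN := Nat.le_mul_self N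
    have hHit : Hit N A v u ↔ u = v ∨ A v u :=
      ⟨fun ⟨u', _, he, h⟩ => by rwa [show u = u' by exact_mod_cast he], fun h => ⟨u, hu, rfl, h⟩⟩
    have hle : v * N + u + 1 ≤ N * N := by nlinarith
    have e1 : (v : ℤ) * N = (v * N : ℕ) := by push_cast; rfl
    have e2 : ((v * N : ℕ) : ℤ) + u = (v * N + u : ℕ) := by push_cast; rfl
    have e3 : ((v * N + u : ℕ) : ℤ) + 1 = (v * N + u + 1 : ℕ) := by push_cast; rfl
    have z := hr.zero_or_one v hv u hu
    have a := hr.adj_iff v hv u hu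
    simp only [e1, e2, e3] at z a
    simp only [Prog.block, Prog.wp, Op.eval, State.setReg_reg, h16, h11, h2, h8, reduceIte,
      Nat.reduceEqDiff, e1, e2, e3, State.setReg_arr, and_true, hHit]
    refine ⟨abs_le.2 ⟨by omega, by omega⟩, fun hne => ⟨abs_natCast_le (by omega),
      abs_natCast_le (by omega), abs_natCast_le (by omega), z.trans (by omega), fun h1 => ⟨?_, ?_⟩,
      fun h1 => ?_⟩, fun heq => ⟨?_, ?_⟩⟩
    · simp; omega
    · refine ⟨.inl (.inr (a.1 h1)), fun r hr hr' => ?_⟩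
      simp only [hr, hr', if_false]
    · refine ⟨.inr ?_, fun r hr hr' => ?_⟩
      · rintro (h | h)
        · omega
        · exact a.2 h h1
      · simp only [hr', if_false]
    · simp; omega
    · refine ⟨.inl (.inl (by omega)), fun r hr hr' => ?_⟩
      simp only [hr, hr', if_false]
  · rw [h18] at h'
    rintro ⟨u, hu, rfl, -⟩
    simp at h'
    omega

open Classical in
theorem runs_inner (hr : ReadsMatrix N A inp) (hW : N * N + 1 ≤ W) (hLW : L ≤ W) {s : State}
    {v : ℕ} (hv : v < N) (h0 : s.reg 0 = L) (h2 : s.reg 2 = N) (h7 : s.reg 7 = 0)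
    (h8 : s.reg 8 = 1) (h11 : s.reg 11 = v) :
    Runs W inp (.seq innerInit (.loop 15 innerBody)) s (16 * L + 4) fun s' =>
      (s'.reg 13 = if ∃ j < L, Hit N A v (s.arr 0 (j : ℕ)) then 1 else 0) ∧ Frame 13 20 s s' := by
  have hW1 : (1 : ℤ) ≤ W := by omega
  let Inv : ℕ → State → Prop := fun j s' => ∃ i, i + j = L ∧ s'.reg 14 = i ∧ s'.reg 15 = j ∧
    (s'.reg 13 = if ∃ j < i, Hit N A v (s.arr 0 (j : ℕ)) then 1 else 0) ∧ Frame 13 20 s s'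
  have hloop := Runs.loop (W := W) (inp := inp) (P := innerBody) (r := 15) (T := 3 + (10 + 2))
    (Q := fun s' =>
      (s'.reg 13 = if ∃ j < L, Hit N A v (s.arr 0 (j : ℕ)) then 1 else 0) ∧ Frame 13 20 s s') Inv
    (by
      rintro s' ⟨i, hi, h14, h15, h13, hf⟩
      obtain rfl : i = L := by omega
      exact ⟨by simpa using h15, h13, hf⟩)
    (by
      rintro j s' ⟨i, hi, h14, h15, h13, hf⟩
      refine ⟨by rw [h15]; positivity, ?_⟩
      set d := s.arr 0 (i : ℕ) with hd
      refine (Runs.of_wp (P := loadVertex) (T := 3) (Q := fun s₁ => s₁.reg 16 = d ∧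
        (s₁.reg 17 = if d < 0 then 1 else 0) ∧ (s₁.reg 18 = if d < N then 1 else 0) ∧
        s₁.reg 13 = s'.reg 13 ∧ s₁.reg 14 = s'.reg 14 ∧ s₁.reg 15 = s'.reg 15 ∧ Frame 13 20 s s₁)
        (by decide) ?_).seq ?_
      · have h7' : s'.reg 7 = 0 := (hf.2 _ (by norm_num)).trans h7
        have h2' : s'.reg 2 = N := (hf.2 _ (by norm_num)).trans h2
        simp only [loadVertex, Prog.block, Prog.wp, Op.eval, State.setReg_reg, h14, h7', h2',
          hf.1, ← hd, reduceIte, Nat.reduceEqDiff, true_and]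
        refine ⟨abs_ite_le hW1 _, abs_ite_le hW1 _, ?_⟩
        repeat refine Frame.setReg ?_ (by norm_num) (by norm_num)
        exact hf
      · rintro s₁ ⟨h16, h17, h18, h13', h14', h15', hf₁⟩
        refine (runs_hitTest hr hW hv ((hf₁.2 _ (by norm_num)).trans h2)
          ((hf₁.2 _ (by norm_num)).trans h8) ((hf₁.2 _ (by norm_num)).trans h11) h16 h17 h18).seq ?_
        rintro s₂ ⟨h, hreg, harr⟩
        have hf₂ : Frame 13 20 s s₂ := ⟨harr.trans hf₁.1, fun r hr =>
          (hreg r (by omega) (by omega)).trans (hf₁.2 r hr)⟩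
        have h8' : s₂.reg 8 = 1 := (hf₂.2 _ (by norm_num)).trans h8
        have h14'' : s₂.reg 14 = i := ((hreg _ (by norm_num) (by norm_num)).trans h14').trans h14
        have h15'' : s₂.reg 15 = (j + 1 : ℕ) :=
          ((hreg _ (by norm_num) (by norm_num)).trans h15').trans h15
        refine Runs.of_wp (by decide) ?_
        simp only [Prog.block, Prog.wp, Op.eval, State.setReg_reg, h14'', h15'', h8', reduceIte,
          Nat.reduceEqDiff]
        refine ⟨abs_le.2 ⟨by omega, by omega⟩, abs_le.2 ⟨by omega, by omega⟩, i + 1, by omega, ?_⟩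
        simp only [State.setReg_reg, reduceIte, Nat.reduceEqDiff]
        refine ⟨by push_cast; rfl, by push_cast; ring, ?_, ?_⟩
        · have key : (∃ j < i + 1, Hit N A v (s.arr 0 (j : ℕ))) ↔
              (∃ j < i, Hit N A v (s.arr 0 (j : ℕ))) ∨ Hit N A v d := by
            simp only [Nat.lt_succ_iff_lt_or_eq, or_and_right, exists_or, exists_eq_left, hd]
          rcases h with ⟨hh, he⟩ | ⟨hh, he⟩
          · rw [he, if_pos (key.2 (.inr hh))]
          · rw [he, h13', h13]
            exact if_congr (by simp only [key, hh, or_false]) rfl rfl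
        · repeat refine Frame.setReg ?_ (by norm_num) (by norm_num)
          exact hf₂)
  refine (Runs.seq (Runs.of_wp (T := 3) (Q := Inv L) (by decide) ?_) (hloop _)).mono
    (by omega) fun _ => id
  simp only [innerInit, Prog.block, Prog.wp, Op.eval, State.setReg_reg, h0, h7, reduceIte,
    Nat.reduceEqDiff, OfNat.zero_ne_ofNat]
  refine ⟨by simp, by simp, abs_le.2 ⟨by omega, by omega⟩, 0, by omega, ?_⟩
  simp only [State.setReg_reg, reduceIte, Nat.reduceEqDiff, Nat.cast_zero, add_zero, true_and,
    not_lt_zero, false_and, exists_false]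
  repeat refine Frame.setReg ?_ (by norm_num) (by norm_num)
  exact Frame.refl _ _ _

/-- One step of the loop over all vertices. -/
def outerBody : Prog :=
  .seq (.seq innerInit (.loop 15 innerBody))
    (.seq (.ite 13 .skip (.const 1 0)) (.block [.op .add 11 11 8, .op .sub 12 12 8]))

/-- Tests whether the output is a dominating set. -/
def dominationTest : Prog :=
  .seq (.block [.const 1 1, .const 11 0, .op .add 12 2 7]) (.loop 12 outerBody)

theorem runs_dominationTest (hr : ReadsMatrix N A inp) (hW : N * N + 1 ≤ W) (hLW : L ≤ W)
    {s : State} (h0 : s.reg 0 = L) (h2 : s.reg 2 = N) (h7 : s.reg 7 = 0) (h8 : s.reg 8 = 1) :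
    Runs W inp dominationTest s (N * (16 * L + 9) + 4) fun s' =>
      (s'.reg 1 ≠ 0 ↔ ∀ v < N, ∃ j < L, Hit N A v (s.arr 0 (j : ℕ))) ∧ |s'.reg 1| ≤ 1 ∧
        s'.reg 7 = 0 := by
  classical
  have hNN := Nat.le_mul_self N
  let H : ℕ → Prop := fun v => ∃ j < L, Hit N A v (s.arr 0 (j : ℕ))
  let Inv : ℕ → State → Prop := fun j s' => ∃ i, i + j = N ∧ s'.reg 11 = i ∧ s'.reg 12 = j ∧
    (s'.reg 1 = if ∀ v < i, H v then 1 else 0) ∧ s'.arr = s.arr ∧ s'.reg 0 = L ∧ s'.reg 2 = N ∧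
    s'.reg 7 = 0 ∧ s'.reg 8 = 1
  have hloop := Runs.loop (W := W) (inp := inp) (P := outerBody) (r := 12)
    (T := 16 * L + 4 + (2 + 2)) (Q := fun s' => (s'.reg 1 ≠ 0 ↔ ∀ v < N, H v) ∧ |s'.reg 1| ≤ 1 ∧
        s'.reg 7 = 0) Inv
    (by
      rintro s' ⟨i, hi, h11, h12, h1, -, -, -, h7, -⟩
      obtain rfl : i = N := by omega
      exact ⟨by simpa using h12, by rw [h1]; simp, h1 ▸ abs_ite_le le_rfl _, h7⟩)
    (by
      rintro j s' ⟨i, hi, h11, h12, h1, harr, h0, h2, h7, h8⟩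
      refine ⟨by rw [h12]; positivity, ?_⟩
      refine (runs_inner hr hW hLW (v := i) (by omega) h0 h2 h7 h8 h11).seq ?_
      rintro s₁ ⟨h13, hf⟩
      have hreg : ∀ r < 13, s₁.reg r = s'.reg r := fun r hr => hf.2 r (.inl hr)
      have h0' := (hreg 0 (by norm_num)).trans h0
      have h1' := (hreg 1 (by norm_num)).trans h1
      have h2' := (hreg 2 (by norm_num)).trans h2
      have h7' := (hreg 7 (by norm_num)).trans h7
      have h8' := (hreg 8 (by norm_num)).trans h8
      have h11' := (hreg 11 (by norm_num)).trans h11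
      have h12' := (hreg 12 (by norm_num)).trans h12
      rw [harr] at h13
      refine Runs.of_wp (P := .seq (.ite 13 .skip (.const 1 0)) (.block [.op .add 11 11 8,
        .op .sub 12 12 8])) (by decide) ?_
      have key : (∀ v < i + 1, H v) ↔ (∀ v < i, H v) ∧ H i := by
        simp only [Nat.lt_succ_iff_lt_or_eq, or_imp, forall_and, forall_eq]
      simp only [Prog.block, Prog.wp, Op.eval, State.setReg_reg, h11', h12', h8', reduceIte,
        Nat.reduceEqDiff, OfNat.ofNat_ne_one]
      have a1 : |(i : ℤ) + 1| ≤ W := abs_le.2 ⟨by omega, by omega⟩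
      have a2 : |((j + 1 : ℕ) : ℤ) - 1| ≤ W := abs_le.2 ⟨by omega, by omega⟩
      refine ⟨fun hne => ⟨a1, a2, i + 1, by omega, ?_⟩, fun heq => ⟨by simp, a1, a2, i + 1, by omega,
        ?_⟩⟩
      · have hi' : H i := by
          by_contra hn
          rw [if_neg hn] at h13
          exact hne h13
        simp only [State.setReg_reg, State.setReg_arr, reduceIte, Nat.reduceEqDiff, h0', h1', h2',
          h7', h8', OfNat.zero_ne_ofNat, OfNat.one_ne_ofNat, hf.1, harr, and_true]
        refine ⟨by push_cast; rfl, by push_cast; ring, ?_⟩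
        simp only [key, hi', and_true]
      · have hi' : ¬ H i := by
          intro hn
          rw [if_pos hn] at h13
          rw [heq] at h13
          exact absurd h13 (by norm_num)
        simp only [State.setReg_reg, State.setReg_arr, reduceIte, Nat.reduceEqDiff, h0', h2',
          h7', h8', OfNat.zero_ne_ofNat, OfNat.one_ne_ofNat, OfNat.ofNat_ne_one, zero_ne_one,
          hf.1, harr, and_true]
        refine ⟨by push_cast; rfl, by push_cast; ring, ?_⟩
        simp only [key, hi', and_false, if_false])
  refine (Runs.seq (Runs.of_wp (T := 3) (Q := Inv N) (by decide) ?_) (hloop _)).mono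
    (by ring_nf; omega) fun _ => id
  simp only [Prog.block, Prog.wp, Op.eval, State.setReg_reg, h2, h7, reduceIte,
    Nat.reduceEqDiff, OfNat.ofNat_ne_one]
  refine ⟨by simp; omega, by simp, abs_le.2 ⟨by omega, by omega⟩, 0, by omega, ?_⟩
  simp only [State.setReg_reg, State.setReg_arr, reduceIte, Nat.reduceEqDiff, Nat.cast_zero,
    add_zero, not_lt_zero, false_imp_iff, implies_true, h0, h2, h7, h8,
    OfNat.zero_ne_ofNat, OfNat.one_ne_ofNat, OfNat.ofNat_ne_one, zero_ne_one, and_true]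

end
end DomSetVerifier

/-! ### The verifier with its length test -/

open RAM

namespace DomSetVerifier
open KSumReduction

/-- Preparation for the computation of `Nat.size N`. -/
def sizeInit : Prog := .block [.const 7 0, .const 8 1, .input 2 7, .const 3 0, .const 4 2,
  .op .add 5 2 7]

/-- Computes `Nat.size N` in register 3. -/
def sizeCode : Prog := .seq sizeInit (.loop 5 (.block [.op .div 5 5 4, .op .add 3 3 8]))

/-- Computes `k ^ P * Nat.size N` in register 3, and tests whether the length of the output is
negative or larger. -/
def lengthTest (k P : ℕ) : Prog := .block [.const 6 (k ^ P : ℕ), .op .mul 3 3 6, .const 1 0,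
  .op .lt 9 0 7, .op .lt 10 3 0, .op .add 9 9 10]

/-- Tests whether the length to the power `P` is larger than the content of register 3. -/
def powerTest (P : ℕ) : Prog := .seq (.const 10 1) (.seq (.mulPow 10 0 P) (.op .lt 9 3 10))

/-- Verifies the output of an approximation algorithm. -/
def verifier (k P : ℕ) : Prog :=
  .seq (.seq sizeCode (.seq (lengthTest k P)
    (.ite 9 .skip (.seq (powerTest P) (.ite 9 .skip dominationTest))))) (.op .add 0 1 7)

theorem size_div_two {m : ℕ} (hm : m ≠ 0) : Nat.size m = Nat.size (m / 2) + 1 := by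
  refine le_antisymm ?_ ?_
  · rw [Nat.size_le, pow_succ]
    have := Nat.lt_size_self (m / 2)
    omega
  · rw [Nat.succ_le_iff, Nat.lt_size]
    rcases Nat.eq_zero_or_pos (Nat.size (m / 2)) with h | h
    · rw [h, pow_zero]; omega
    · have h1 : 2 ^ (Nat.size (m / 2) - 1) ≤ m / 2 := Nat.lt_size.1 (by omega)
      have h2 : 2 ^ Nat.size (m / 2) = 2 ^ (Nat.size (m / 2) - 1) * 2 := by
        rw [← pow_succ, Nat.sub_add_cancel h]
      omega

theorem size_le_self (N : ℕ) : Nat.size N ≤ N := Nat.size_le.2 Nat.lt_two_pow_self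

section
variable {W N : ℕ} {A : ℕ → ℕ → Prop} {inp : List ℤ}

theorem runs_size (hr : ReadsMatrix N A inp) (hN : 1 ≤ N) (hW : N * N + 1 ≤ W) (s : State) :
    Runs W inp sizeCode s (3 * Nat.size N + 7) fun s' => s'.reg 3 = Nat.size N ∧ s'.reg 2 = N ∧
      s'.reg 7 = 0 ∧ s'.reg 8 = 1 ∧ Frame 2 9 s s' := by
  have hNN := Nat.le_mul_self N
  have hsN := size_le_self N
  let Inv : ℕ → State → Prop := fun j s' => ∃ i m : ℕ, i + j = Nat.size N ∧ Nat.size m = j ∧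
    m ≤ N ∧ s'.reg 5 = m ∧ s'.reg 3 = i ∧ s'.reg 4 = 2 ∧ s'.reg 2 = N ∧ s'.reg 7 = 0 ∧
    s'.reg 8 = 1 ∧ Frame 2 9 s s'
  have hloop := Runs.loop (W := W) (inp := inp) (P := .block [.op .div 5 5 4, .op .add 3 3 8])
    (r := 5) (T := 2) (Q := fun s' => s'.reg 3 = Nat.size N ∧ s'.reg 2 = N ∧
      s'.reg 7 = 0 ∧ s'.reg 8 = 1 ∧ Frame 2 9 s s') Inv
    (by
      rintro s' ⟨i, m, hi, hm, -, h5, h3, -, h⟩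
      obtain rfl : i = Nat.size N := by omega
      exact ⟨by rw [h5, Nat.size_eq_zero.1 hm]; rfl, h3, h⟩)
    (by
      rintro j s' ⟨i, m, hi, hm, hmN, h5, h3, h4, h2, h7, h8, hf⟩
      have hm0 : m ≠ 0 := by rintro rfl; simp at hm
      have hdiv : m / 2 ≤ m := Nat.div_le_self _ _
      have e1 : (m : ℤ) / 2 = (m / 2 : ℕ) := by push_cast; rfl
      refine ⟨by rw [h5]; exact_mod_cast hm0, Runs.of_wp (by decide) ?_⟩
      simp only [Prog.block, Prog.wp, Op.eval, State.setReg_reg, h5, h3, h4, h8, reduceIte,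
        Nat.reduceEqDiff, e1]
      refine ⟨abs_natCast_le (by omega), abs_le.2 ⟨by omega, by omega⟩, i + 1, m / 2, by omega, ?_,
        by omega, ?_⟩
      · have := size_div_two hm0
        omega
      · simp only [State.setReg_reg, reduceIte, Nat.reduceEqDiff, h2, h4, h7, h8, true_and]
        refine ⟨by push_cast; rfl, ?_⟩
        repeat refine Frame.setReg ?_ (by norm_num) (by norm_num)
        exact hf)
  refine (Runs.seq (Runs.of_wp (P := sizeInit) (T := 6) (Q := Inv (Nat.size N)) (by decide) ?_)
    (hloop _)).mono (by omega) fun _ => id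
  simp only [sizeInit, Prog.block, Prog.wp, Op.eval, State.setReg_reg, hr.size_eq, reduceIte,
    Nat.reduceEqDiff, add_zero]
  refine ⟨by simp, by simp; omega, abs_natCast_le (by omega), by simp, ?_, abs_natCast_le (by omega),
    0, N, by omega, rfl, le_rfl, ?_⟩
  · rw [abs_le]
    have : 2 ≤ N * N + 1 := by omega
    constructor <;> omega
  · simp only [State.setReg_reg, reduceIte, Nat.reduceEqDiff, Nat.cast_zero, true_and]
    repeat refine Frame.setReg ?_ (by norm_num) (by norm_num)
    exact Frame.refl _ _ _

theorem runs_powerTest {P L K : ℕ} (hP : 1 ≤ P) (hK : 1 ≤ K) (hLK : L ≤ K) (hW : K ^ P ≤ W)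
    {s : State} (h0 : s.reg 0 = L) (h3 : s.reg 3 = K) :
    Runs W inp (powerTest P) s (P + 3) fun s' => (s'.reg 9 = 0 ↔ L ^ P ≤ K) ∧ Frame 9 11 s s' := by
  have hKW : K ≤ W := (Nat.le_self_pow (by omega) K).trans hW
  have hpow : ∀ i ≤ P, L ^ i ≤ W := fun i hi =>
    ((Nat.pow_le_pow_left hLK i).trans (Nat.pow_le_pow_right hK hi)).trans hW
  refine Runs.of_wp (by simp [powerTest, Prog.cost, Prog.cost_mulPow]; omega) ?_
  refine ⟨by simp; omega, Prog.wp_mulPow (by norm_num) P ?_ ?_⟩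
  · intro i hi
    simp only [State.setReg_reg, reduceIte, OfNat.zero_ne_ofNat, h0, one_mul, ← Nat.cast_pow]
    exact abs_natCast_le (hpow i hi)
  · simp only [Prog.wp, Op.eval, State.setReg_reg, reduceIte, OfNat.zero_ne_ofNat, h0, one_mul,
      ← Nat.cast_pow, Nat.reduceEqDiff, h3, Nat.cast_lt]
    refine ⟨abs_ite_le (by omega) _, by simp, ?_⟩
    repeat refine Frame.setReg ?_ (by norm_num) (by norm_num)
    exact Frame.refl _ _ _

/-- The output of the computation with final state `s` passes the verification. -/
def Passes (N : ℕ) (A : ℕ → ℕ → Prop) (P K : ℕ) (s : State) : Prop :=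
  ∃ L : ℕ, s.reg 0 = L ∧ L ^ P ≤ K ∧ ∀ v < N, ∃ j < L, Hit N A v (s.arr 0 (j : ℕ))

/-- The claimed length is checked before it is used: `0 ≤ L ≤ K` guarantees that `L ^ P` fits into a
word, and `L ≤ K` keeps the domination test, which examines `N * L` pairs, within the time bound. -/
theorem runs_verifier {k P K : ℕ} (hr : ReadsMatrix N A inp) (hN : 1 ≤ N) (hk : 1 ≤ k) (hP : 1 ≤ P)
    (hK : K = k ^ P * Nat.size N) (hW : N * N + 1 ≤ W) (hKW : K ^ P ≤ W) (s : State) :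
    Runs W inp (verifier k P) s (3 * Nat.size N + N * (16 * K + 9) + P + 23) fun s' =>
      s'.Accepts ↔ Passes N A P K s := by
  have hW1 : (1 : ℤ) ≤ W := by omega
  have hs1 : 1 ≤ Nat.size N := Nat.size_pos.2 hN
  have hkP : 1 ≤ k ^ P := Nat.one_le_pow _ _ hk
  have hK1 : 1 ≤ K := hK ▸ Nat.mul_pos hkP hs1
  have hkPK : k ^ P ≤ K := hK ▸ Nat.le_mul_of_pos_right _ hs1
  have hKW' : K ≤ W := (Nat.le_self_pow (by omega) K).trans hKW
  have hpass : ∀ L : ℕ, s.reg 0 = L → (Passes N A P K s ↔ L ^ P ≤ K ∧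
      ∀ v < N, ∃ j < L, Hit N A v (s.arr 0 (j : ℕ))) := fun L hL =>
    ⟨fun ⟨L', hL', h⟩ => by rwa [show L = L' by exact_mod_cast hL.symm.trans hL'],
      fun h => ⟨L, hL, h⟩⟩
  have hfinal : ∀ s₁ : State, ((s₁.reg 1 ≠ 0 ↔ Passes N A P K s) ∧ |s₁.reg 1| ≤ 1 ∧
      s₁.reg 7 = 0) → Runs W inp (.op .add 0 1 7) s₁ 1 fun s' =>
        s'.Accepts ↔ Passes N A P K s := by
    rintro s₁ ⟨h1, h2, h3⟩
    refine Runs.of_wp le_rfl ?_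
    simp only [Prog.wp, Op.eval, h3, add_zero, State.Accepts, State.setReg_reg, reduceIte]
    exact ⟨h2.trans hW1, h1⟩
  refine (Runs.seq (T := 3 * Nat.size N + 7 + (6 + (P + 3 + (N * (16 * K + 9) + 5) + 1))) ?_
    hfinal).mono (by omega) fun _ => id
  refine (runs_size hr hN hW s).seq ?_
  rintro s₁ ⟨h3, h2, h7, h8, hf₁⟩
  refine (Runs.of_wp (P := lengthTest k P) (T := 6) (Q := fun s' => s'.reg 3 = K ∧ s'.reg 1 = 0 ∧
    s'.reg 2 = N ∧ s'.reg 7 = 0 ∧ s'.reg 8 = 1 ∧ s'.reg 0 = s.reg 0 ∧ s'.arr = s.arr ∧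
    (s'.reg 9 = 0 ↔ 0 ≤ s.reg 0 ∧ s.reg 0 ≤ K)) (by simp [lengthTest, Prog.block, Prog.cost])
    ?_).seq ?_
  · have h0 : s₁.reg 0 = s.reg 0 := hf₁.2 _ (by norm_num)
    have e1 : ((Nat.size N : ℕ) : ℤ) * (k ^ P : ℕ) = K := by
      rw [hK]; push_cast; ring
    simp only [lengthTest, Prog.block, Prog.wp, Op.eval, State.setReg_reg, h3, h2, h7, h8, h0,
      reduceIte, Nat.reduceEqDiff, e1, OfNat.zero_ne_ofNat, OfNat.one_ne_ofNat, zero_ne_one,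
      OfNat.ofNat_ne_one, State.setReg_arr, hf₁.1, true_and]
    refine ⟨abs_natCast_le (by omega), abs_natCast_le (by omega), by simp, abs_ite_le hW1 _,
      abs_ite_le hW1 _, ?_, ?_⟩
    · have : 2 ≤ N * N + 1 := by have := Nat.le_mul_self N; omega
      rw [abs_le]
      constructor <;> split_ifs <;> omega
    · split_ifs <;> simp <;> omega
  · rintro s₂ ⟨h3, h1, h2, h7, h8, h0, harr, h9⟩
    refine Runs.ite (fun hne => ?_) fun heq => ?_
    · refine Runs.of_wp (by simp [Prog.cost]; omega) ?_
      refine ⟨⟨fun h => absurd h1 h, ?_⟩, by simp [h1], h7⟩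
      rintro ⟨L, hL, hLK, -⟩
      refine absurd (h9.2 ?_) hne
      rw [hL]
      exact ⟨by positivity, by exact_mod_cast (Nat.le_self_pow (by omega) L).trans hLK⟩
    · obtain ⟨hnn, hle⟩ := h9.1 heq
      obtain ⟨L, hL⟩ := Int.eq_ofNat_of_zero_le hnn
      have hLK : L ≤ K := by omega
      refine (runs_powerTest hP hK1 hLK hKW (h0.trans hL) h3).seq ?_
      rintro s₃ ⟨h9', hf₃⟩
      have hreg : ∀ r < 9, s₃.reg r = s₂.reg r := fun r hr => hf₃.2 r (.inl hr)
      refine Runs.ite (fun hne => ?_) fun heq' => ?_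
      · refine Runs.of_wp (by simp [Prog.cost]) ?_
        have h1' := (hreg 1 (by norm_num)).trans h1
        refine ⟨⟨fun h => absurd h1' h, fun h => ?_⟩, by simp [h1'], (hreg 7 (by norm_num)).trans h7⟩
        exact absurd (h9'.2 ((hpass L hL).1 h).1) hne
      · refine (runs_dominationTest hr hW (hLK.trans hKW')
          ((hreg 0 (by norm_num)).trans (h0.trans hL)) ((hreg 2 (by norm_num)).trans h2)
          ((hreg 7 (by norm_num)).trans h7) ((hreg 8 (by norm_num)).trans h8)).mono ?_ ?_
        · have : N * (16 * L + 9) ≤ N * (16 * K + 9) := Nat.mul_le_mul_left _ (by omega)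
          omega
        · rintro s₄ ⟨h1, h2, h3⟩
          refine ⟨?_, h2, h3⟩
          rw [h1, hpass L hL, hf₃.1, harr]
          exact ⟨fun h => ⟨h9'.1 heq', h⟩, fun h => h.2⟩

end

/-- The valid vertices among the first `L` entries dominate; repeated and invalid entries only make
this set smaller than `L`. -/
theorem exists_of_passes (I : GraphInstance) {P K : ℕ} {s : State}
    (h : Passes I.n (fun u v => ∃ (hu : u < I.n) (hv : v < I.n), I.G.Adj ⟨u, hu⟩ ⟨v, hv⟩) P K s) :
    ∃ D, I.G.IsDominatingSet D ∧ D.card ^ P ≤ K := by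
  classical
  obtain ⟨L, -, hLK, h⟩ := h
  refine ⟨Finset.univ.filter fun u : Fin I.n => ∃ j < L, s.arr 0 (j : ℕ) = (u : ℕ), ?_, ?_⟩
  · intro v hv
    obtain ⟨j, hj, u, hu, he, h⟩ := h v v.2
    rcases h with rfl | ⟨_, _, h⟩
    · exact absurd (Finset.mem_filter.2 ⟨Finset.mem_univ _, j, hj, he⟩) hv
    · exact ⟨⟨u, hu⟩, Finset.mem_filter.2 ⟨Finset.mem_univ _, j, hj, he⟩, h⟩
  · refine le_trans (Nat.pow_le_pow_left ?_ P) hLK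
    have hsub : (Finset.univ.filter fun u : Fin I.n => ∃ j < L, s.arr 0 (j : ℕ) = (u : ℕ)).card ≤
        (Finset.range L).card := by
      refine Finset.card_le_card_of_forall_subsingleton
        (fun (u : Fin I.n) (j : ℕ) => s.arr 0 (j : ℕ) = (u : ℕ)) (fun u hu => ?_) fun j _ u hu u' hu' => ?_
      · obtain ⟨j, hj, he⟩ := (Finset.mem_filter.1 hu).2
        exact ⟨j, Finset.mem_range.2 hj, he⟩
      · have := hu.2.symm.trans hu'.2
        exact Fin.ext (by exact_mod_cast this)
    simpa using hsub

theorem passes_of_outputs (I : GraphInstance) {P K : ℕ} {s : State} {l : List (Fin I.n)}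
    (hs : s.Outputs (l.map Fin.val)) (hD : I.G.IsDominatingSet l.toFinset)
    (hl : l.length ^ P ≤ K) :
    Passes I.n (fun u v => ∃ (hu : u < I.n) (hv : v < I.n), I.G.Adj ⟨u, hu⟩ ⟨v, hv⟩) P K s := by
  refine ⟨l.length, by simpa using hs.1, hl, fun v hv => ?_⟩
  have key : ∀ u ∈ l, ∃ j < l.length, s.arr 0 (j : ℕ) = (u : ℕ) := by
    intro u hu
    obtain ⟨j, hj, rfl⟩ := List.getElem_of_mem hu
    exact ⟨j, hj, (hs.2 j (by simpa using hj)).trans (by rw [List.getElem_map])⟩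
  by_cases h : (⟨v, hv⟩ : Fin I.n) ∈ l
  · obtain ⟨j, hj, he⟩ := key _ h
    exact ⟨j, hj, v, hv, he, .inl rfl⟩
  · obtain ⟨u, hu, hadj⟩ := hD ⟨v, hv⟩ (by simpa using h)
    obtain ⟨j, hj, he⟩ := key u (by simpa using hu)
    exact ⟨j, hj, u, u.2, he, .inr ⟨hv, u.2, hadj⟩⟩

end DomSetVerifier

/-! ### From approximation and gap decision to `k`-SUM -/

open RAM

theorem Nat.size_le_rpow {n : ℕ} (hn : 1 ≤ n) {δ : ℝ} (hδ : 0 < δ) :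
    (Nat.size n : ℝ) ≤ (1 + 1 / (δ * Real.log 2)) * (n : ℝ) ^ δ := by
  have h1 : 2 ^ (Nat.size n - 1) ≤ n := Nat.lt_size.1 (by have := Nat.size_pos.2 hn; omega)
  have h2 := KSumReduction.cast_le_mul_rpow h1 hδ
  rw [Nat.cast_sub (Nat.size_pos.2 hn)] at h2
  have h3 : 1 ≤ (n : ℝ) ^ δ := Real.one_le_rpow (by exact_mod_cast hn) hδ.le
  rw [add_mul, one_mul, div_mul_eq_mul_div, one_mul]
  push_cast at h2
  linarith

/-- `Nat.size n` is an integer substitute for the logarithm that a word RAM can compute: `log n ≤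
Nat.size n * log 2 ≤ Nat.size n`. -/
theorem logFactor_pow_le {P n : ℕ} (hP : 1 ≤ P) (hn : 1 ≤ n) :
    logFactor P n ^ P ≤ Nat.size n := by
  have hn1 : (1 : ℝ) ≤ n := by exact_mod_cast hn
  have h0 : 0 ≤ Real.log n := Real.log_nonneg hn1
  unfold logFactor
  rcases max_cases (1 : ℝ) (Real.log n ^ (1 / (P : ℝ))) with ⟨h, -⟩ | ⟨h, -⟩
  · rw [h, one_pow]
    exact_mod_cast Nat.size_pos.2 hn
  · rw [h, ← Real.rpow_natCast, ← Real.rpow_mul h0, one_div, inv_mul_cancel₀ (by positivity),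
      Real.rpow_one]
    have h1 : (n : ℝ) ≤ 2 ^ Nat.size n := by exact_mod_cast (Nat.lt_size_self n).le
    have h2 := Real.log_le_log (by positivity) h1
    rw [Real.log_pow] at h2
    have h3 : Real.log 2 ≤ 1 := by linarith [Real.log_two_lt_d9]
    exact h2.trans (mul_le_of_le_one_right (by positivity) h3)

theorem card_pow_le_of_le_logFactor {k P n d : ℕ} (hP : 1 ≤ P) (hn : 1 ≤ n)
    (hd : (d : ℝ) ≤ logFactor P n * k) : d ^ P ≤ k ^ P * Nat.size n := by
  have h1 : (d : ℝ) ^ P ≤ k ^ P * Nat.size n := by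
    calc (d : ℝ) ^ P ≤ (logFactor P n * k) ^ P := pow_le_pow_left₀ (by positivity) hd P
      _ = k ^ P * logFactor P n ^ P := by rw [mul_pow, mul_comm]
      _ ≤ k ^ P * Nat.size n :=
          mul_le_mul_of_nonneg_left (logFactor_pow_le hP hn) (by positivity)
  exact_mod_cast h1

namespace RAM.SolvableInTime

theorem mono {ι : Type} {size : ι → ℕ} {enc : ι → List ℤ} {ok ok' : ι → State → Prop} {e e' : ℝ}
    (h : SolvableInTime size enc ok e) (hsize : ∀ x, 1 ≤ size x) (he : e ≤ e')
    (hok : ∀ x s, ok x s → ok' x s) : SolvableInTime size enc ok' e' := by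
  obtain ⟨P, C, h⟩ := h
  refine ⟨P, C, fun x => ?_⟩
  obtain ⟨t, s, h1, h2, h3⟩ := h x
  refine ⟨t, s, h1, h2.trans ?_, hok x s h3⟩
  exact mul_le_mul_of_nonneg_left
    (Real.rpow_le_rpow_of_exponent_le (by exact_mod_cast hsize x) he) (by positivity)

end RAM.SolvableInTime

theorem DomSetGapDecidable.gapSolvable {k P : ℕ} (hP : 1 ≤ P) {e : ℝ}
    (h : DomSetGapDecidable k (logFactor P) e) : DomSetGapSolvable k P e := by
  refine SolvableInTime.mono h (fun I => I.pos) le_rfl fun I s hs => ⟨hs.1, fun hacc => ?_⟩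
  by_contra hno
  refine hs.2 ?_ hacc
  rintro ⟨D, hD, hcard⟩
  exact hno ⟨D, hD, card_pow_le_of_le_logFactor hP I.pos hcard⟩

-- On graphs without a small dominating set the output is unrestricted, so acceptance is made to
-- depend on verifying it. The verifier runs in time `O(N * Nat.size N)`, and `Nat.size N = O(N ^ (1
-- / 2))`; this is why `e` has to be at least `3 / 2`.
open DomSetVerifier in
theorem DomSetApproximable.gapSolvable {k P : ℕ} (hk : 1 ≤ k) (hP : 1 ≤ P) {e : ℝ}
    (he : 3 / 2 ≤ e) (h : DomSetApproximable k (logFactor P) e) : DomSetGapSolvable k P e := by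
  obtain ⟨Q, C, hQ⟩ := h
  have hl : 0 < Real.log 2 := Real.log_pos (by norm_num)
  set c : ℝ := 1 + 1 / (1 / 2 * Real.log 2)
  set A : ℝ := C + (3 * c + 16 * k ^ P * c + 9 + P + 23)
  refine ⟨.seq Q (verifier k P), max (max C (2 + (k ^ P) ^ P + P)) ⌈A⌉₊, fun I => ?_⟩
  set C' := max (max C (2 + (k ^ P) ^ P + P)) ⌈A⌉₊
  have hC : C ≤ C' := (le_max_left _ _).trans (le_max_left _ _)
  have hC2 : 2 + (k ^ P) ^ P + P ≤ C' := (le_max_right _ _).trans (le_max_left _ _)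
  have hCA : A ≤ C' := (Nat.le_ceil A).trans (by exact_mod_cast le_max_right _ _)
  set N := I.n
  have hN : 1 ≤ N := I.pos
  obtain ⟨t, s, h1, h2, h3⟩ := hQ I
  set K := k ^ P * Nat.size N with hK
  have hW1 : N * N + 1 ≤ C' * N ^ C' := by
    refine le_trans ?_ (KSumReduction.mul_pow_le_of_le (c := 2) (d := 2) hN (by omega) (by omega))
    nlinarith
  have hW2 : K ^ P ≤ C' * N ^ C' := by
    refine le_trans ?_ (KSumReduction.mul_pow_le_of_le (c := (k ^ P) ^ P) (d := P) hN (by omega)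
      (by omega))
    rw [← mul_pow]
    exact Nat.pow_le_pow_left (Nat.mul_le_mul_left _ (size_le_self N)) _
  obtain ⟨t', s', h1', h2', h3'⟩ := runs_verifier (readsMatrix I) hN hk hP hK hW1 hW2 s
  refine ⟨t + t', s', .seq (h1.mono (KSumReduction.mul_pow_le_of_le hN hC hC)) h1', ?_, ?_⟩
  · have hN1 : (1 : ℝ) ≤ N := by exact_mod_cast hN
    have hs := Nat.size_le_rpow hN (show (0 : ℝ) < 1 / 2 by norm_num)
    set x : ℝ := (N : ℝ) ^ (1 / 2 : ℝ)
    have hx : 1 ≤ x := Real.one_le_rpow hN1 (by norm_num)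
    have hc : 0 ≤ c := by positivity
    have hNx : (N : ℝ) * x ≤ (N : ℝ) ^ e := by
      have : (N : ℝ) * x = (N : ℝ) ^ (3 / 2 : ℝ) := by
        rw [show (3 / 2 : ℝ) = 1 + 1 / 2 by norm_num, Real.rpow_add (by positivity), Real.rpow_one]
      rw [this]
      exact Real.rpow_le_rpow_of_exponent_le hN1 he
    have hxN : x ≤ N * x := le_mul_of_one_le_left (by positivity) hN1
    have h1Nx : 1 ≤ N * x := hx.trans hxN
    have ht' : (t' : ℝ) ≤ (3 * c + 16 * k ^ P * c + 9 + P + 23) * (N * x) := by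
      have h4 : (t' : ℝ) ≤ 3 * Nat.size N + N * (16 * (k ^ P * Nat.size N) + 9) + P + 23 := by
        exact_mod_cast h2'
      have h5 : (N : ℝ) * (16 * (k ^ P * Nat.size N)) ≤ 16 * k ^ P * c * (N * x) := by
        calc (N : ℝ) * (16 * (k ^ P * Nat.size N)) ≤ N * (16 * (k ^ P * (c * x))) := by gcongr
          _ = _ := by ring
      have h6 : (3 : ℝ) * Nat.size N ≤ 3 * c * (N * x) := by
        calc (3 : ℝ) * Nat.size N ≤ 3 * (c * x) := by gcongr
          _ ≤ 3 * (c * (N * x)) := by gcongr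
          _ = _ := by ring
      have h7 : (N : ℝ) ≤ N * x := le_mul_of_one_le_right (by positivity) hx
      have h8 : (P : ℝ) ≤ P * (N * x) := le_mul_of_one_le_right (by positivity) h1Nx
      linarith
    push_cast
    calc (t : ℝ) + t' ≤ C * (N : ℝ) ^ e + (3 * c + 16 * k ^ P * c + 9 + P + 23) * (N : ℝ) ^ e :=
          add_le_add h2 (ht'.trans (mul_le_mul_of_nonneg_left hNx (by positivity)))
      _ = A * (N : ℝ) ^ e := by simp only [A]; ring
      _ ≤ C' * (N : ℝ) ^ e := mul_le_mul_of_nonneg_right hCA (by positivity)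
  · refine ⟨fun hdom => h3'.2 ?_, fun hacc => ?_⟩
    · obtain ⟨l, hl, hD, hlen⟩ := h3 hdom
      exact passes_of_outputs I hl hD (card_pow_le_of_le_logFactor hP hN hlen)
    · exact exists_of_passes I (h3'.1 hacc)

theorem two_le_ceil_half {k : ℕ} (hk : 3 ≤ k) : (2 : ℝ) ≤ (⌈(k : ℝ) / 2⌉ : ℝ) := by
  have : (2 : ℤ) ≤ ⌈(k : ℝ) / 2⌉ := by
    rw [Int.le_ceil_iff]
    have : (3 : ℝ) ≤ k := by exact_mod_cast hk
    push_cast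
    linarith
  exact_mod_cast this

/-- One half of `ε` pays for the overhead of the simulation; the other half contradicts the
hypothesis. -/
theorem not_domSetGapSolvable (hKSum : KSumHypothesis) {k : ℕ} (hk : 3 ≤ k) {ε : ℝ} (hε : 0 < ε)
    (hε' : ε ≤ 1 / 2) : ¬ DomSetGapSolvable k (k * (k + 1)) ((⌈(k : ℝ) / 2⌉ : ℝ) - ε) := by
  intro h
  have h2 := two_le_ceil_half hk
  have := kSum_solvable_of_domSetGapSolvable (δ := ε / 2) (by omega) (by linarith) (by positivity) h
  refine hKSum k hk (ε / 2) (by positivity) ?_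
  convert this using 1
  ring

theorem theorem4 (hKSum : KSumHypothesis) :
    ∃ p : Polynomial ℕ, ∀ k : ℕ, 3 ≤ k → 0 < p.eval k ∧
      ∀ ε : ℝ, 0 < ε →
        ¬ DomSetApproximable k (logFactor (p.eval k)) ((⌈(k : ℝ) / 2⌉ : ℝ) - ε) ∧
        ¬ DomSetGapDecidable k (logFactor (p.eval k)) ((⌈(k : ℝ) / 2⌉ : ℝ) - ε) := by
  refine ⟨Polynomial.X * (Polynomial.X + 1), fun k hk => ?_⟩
  have heval : (Polynomial.X * (Polynomial.X + 1) : Polynomial ℕ).eval k = k * (k + 1) := by simp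
  rw [heval]
  have hP : 0 < k * (k + 1) := by positivity
  refine ⟨hP, fun ε hε => ?_⟩
  have h2 := two_le_ceil_half hk
  -- A smaller `ε` only allows more time. Capping it at `1 / 2` keeps the exponent at least `3 / 2`,
  -- because `⌈k / 2⌉ ≥ 2`.
  have hmin : 0 < min ε (1 / 2) := lt_min hε (by norm_num)
  have hle : (⌈(k : ℝ) / 2⌉ : ℝ) - ε ≤ (⌈(k : ℝ) / 2⌉ : ℝ) - min ε (1 / 2) := by
    linarith [min_le_left ε (1 / 2)]
  have hno := not_domSetGapSolvable hKSum hk hmin (min_le_right _ _)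
  constructor
  · intro h
    refine hno (DomSetApproximable.gapSolvable (by omega) hP ?_
      (SolvableInTime.mono h (fun I => I.pos) hle fun _ _ => id))
    linarith [min_le_right ε (1 / 2)]
  · intro h
    exact hno (DomSetGapDecidable.gapSolvable hP
      (SolvableInTime.mono h (fun I => I.pos) hle fun _ _ => id))
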